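/- Let $\mu>5$, $n\ge 2$, and let $S_\mu=\{x\in\mathbb R^{2n}: x_1^2-x_2^2-x_3^{\mu-3}=x_2x_3=0,\ x_j=0 \text{ for } j\ge 4\}$. All forms, maps and sets are taken as $C^\infty$ germs at $0$. Two $2$-forms have the same algebraic restriction to $N=S_\mu$ if their difference is $\alpha+d\beta$ with a $2$-form $\alpha$ and a $1$-form $\beta$ that vanish at every point of $N$; $[\omega]_N$ denotes the algebraic restriction of $\omega$, and $[Z^2]_{S_\mu}$ the vector space of algebraic restrictions to $S_\mu$ of closed $2$-forms. A symmetry of $S_\mu$ is a germ $\Phi$ of a diffeomorphism of $(\mathbb R^{2n},0)$ with $\Phi(S_\mu)=S_\mu$; it acts by $\Phi^*[\omega]_{S_\mu}=[\Phi^*\omega]_{S_\mu}$. Put $$\theta_1=dx_1\wedge dx_3,\quad \theta_2=dx_2\wedge dx_3,\quad \theta_3=dx_1\wedge dx_2,\quad \theta_4=x_3\,dx_1\wedge dx_2-x_1\,dx_2\wedge dx_3,\quad \theta_{4+k}=x_3^k\,dx_1\wedge dx_3\ (1\le k\le\mu-4).$$ Consider the following families of normal forms, with real parameters $c_i$ and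 codimension number $i$: - $[S_\mu]^0$: $[\theta_1+c_2\theta_2+c_3\theta_3]_{S_\mu}$, $i=0$; - $[S_\mu]^k_2$, $1\le k\le\mu-5$: $[\theta_2+c_3\theta_3+c_{4+k}\theta_{4+k}]_{S_\mu}$, $c_{4+k}\ne0$, $i=k$; - $[S_\mu]^{\mu-4}_2$: $[\theta_2+c_3\theta_3+c_\mu\theta_\mu]_{S_\mu}$, $c_3c_\mu=0$, $i=\mu-4$; - $[S_\mu]^{1+k}_r$, $1\le k\le\mu-6$: $[\theta_3+c_{4+k}\theta_{4+k}+c_{5+k}\theta_{5+k}]_{S_\mu}$, $c_{4+k}\neq0$, $i=k+1$; - $[S_\mu]^{\mu-4}_r$: $[\theta_3+c_{\mu-1}\theta_{\mu-1}]_{S_\mu}$, $i=\mu-4$; - $[S_\mu]^{3,1}$: $[c_4\theta_4+\theta_5]_{S_\mu}$, $i=3$; - $[S_\mu]^{2+k,1}$, $2\le k\le\mu-4$: $[\theta_4+c_{4+k}\theta_{4+k}]_{S_\mu}$, with $c_{4+k}\ne0$ if $k\le\mu-5$, $i=k+2$; - $[S_\mu]^{3+k,k}$, $2\le k\le\mu-4$: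 $[\theta_{4+k}]_{S_\mu}$, $i=k+3$; - $[S_\mu]^\mu$: $[0]_{S_\mu}$, $i=\mu$. The singularity class of a family is the set of all elements of $[Z^2]_{S_\mu}$ that some symmetry of $S_\mu$ brings to a normal form of the family. Then: (i) Every element of $[Z^2]_{S_\mu}$ can be brought by a symmetry of $S_\mu$ to one of these normal forms. (ii) The singularity classes of different families are disjoint. (iii) The parameters $c_i$ of each family are independent moduli: for each normal form $a$ of the family, only finitely many values of the parameters give normal forms of the family that a symmetry of $S_\mu$ brings to $a$; moreover, if $(v_i)$ is a direction such that the parameters of $a$ plus $s(v_i)$ are admissible for all sufficiently small $s\in\mathbb R$, and $[\sum_i v_i\theta_i]_{S_\mu}$ belongs to the tangent space at $a=[\omega]_{S_\mu}$ of the orbit of $a$ (the set of all $[\mathcal L_V\omega]_{S_\mu}$ with $\omega$ a closed form representing $a$ and $V$ a smooth vector field tangent to $S_\mu$, that is, one that maps functions vanishing on $S_\mu$ to such functions), then all $v_i=0$. (iv) The space $[Z^2]_{S_\mu}$ is finite dimensional, and the singularity class of each family is a nonempty smooth submanifold of it of codimension $i$. -/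

import Mathlib

open scoped Topology ContDiff

noncomputable section

namespace SMu

/-! ## Germs at `0` of forms on `ℝ^d` and algebraic restrictions

A germ at `0` is given by a representative defined on all of `ℝ^d`, about which only the values
near `0` matter. -/

/-- The space `ℝ^d` with coordinates `x 0, …, x (d-1)`. -/
abbrev E (d : ℕ) : Type := Fin d → ℝ

/-- Representatives of germs at `0` of smooth differential `p`-forms on `ℝ^d`: they are `C^∞` on
a neighbourhood of `0`. -/
def smoothForms (d p : ℕ) : Submodule ℝ (E d → E d [⋀^Fin p]→L[ℝ] ℝ) where
  carrier := {η | ∀ᶠ x in 𝓝 (0 : E d), ContDiffAt ℝ ∞ η x}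
  add_mem' := by
    intro a b ha hb
    filter_upwards [ha, hb] with x h1 h2 using h1.add h2
  zero_mem' := Filter.Eventually.of_forall fun x => contDiffAt_const
  smul_mem' := by
    intro c a ha
    filter_upwards [ha] with x h1 using h1.const_smul c

/-- The type of these representatives, a real vector space. -/
def SmoothForm (d p : ℕ) : Type := smoothForms d p

instance (d p : ℕ) : AddCommGroup (SmoothForm d p) :=
  inferInstanceAs (AddCommGroup (smoothForms d p))

instance (d p : ℕ) : Module ℝ (SmoothForm d p) :=
  inferInstanceAs (Module ℝ (smoothForms d p))

theorem SmoothForm.add_val {d p : ℕ} (a b : SmoothForm d p) : (a + b).1 = a.1 + b.1 := rfl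
theorem SmoothForm.smul_val {d p : ℕ} (c : ℝ) (a : SmoothForm d p) : (c • a).1 = c • a.1 := rfl
theorem SmoothForm.zero_val {d p : ℕ} : (0 : SmoothForm d p).1 = 0 := rfl

/-- The germ at `0` of the form `η` vanishes at all points of the germ at `0` of `N`. -/
def VanishesOn {d p : ℕ} (N : Set (E d)) (η : E d → E d [⋀^Fin p]→L[ℝ] ℝ) : Prop :=
  ∀ᶠ x in 𝓝 (0 : E d), x ∈ N → η x = 0

/-- The space `A_0^2(N, ℝ^d)` of germs of `2`-forms `α + dβ`, where the `2`-form `α` and the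
`1`-form `β` vanish at all points of `N`. It contains all representatives of the zero germ. -/
def zeroRestr {d : ℕ} (N : Set (E d)) : Submodule ℝ (SmoothForm d 2) where
  carrier := {η | ∃ (α : SmoothForm d 2) (β : SmoothForm d 1),
    VanishesOn N α.1 ∧ VanishesOn N β.1 ∧ ∀ᶠ x in 𝓝 (0 : E d), η.1 x = α.1 x + extDeriv β.1 x}
  add_mem' := by
    rintro a b ⟨α, β, h1, h2, h3⟩ ⟨α', β', h1', h2', h3'⟩
    refine ⟨α + α', β + β', ?_, ?_, ?_⟩
    · filter_upwards [h1, h1'] with x hx hx' hN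
      simp [SmoothForm.add_val, hx hN, hx' hN]
    · filter_upwards [h2, h2'] with x hx hx' hN
      simp [SmoothForm.add_val, hx hN, hx' hN]
    · filter_upwards [h3, h3', β.2, β'.2] with x hx hx' hb hb'
      have : extDeriv (β.1 + β'.1) x = extDeriv β.1 x + extDeriv β'.1 x :=
        extDeriv_add (hb.differentiableAt (by simp)) (hb'.differentiableAt (by simp))
      simp only [SmoothForm.add_val, Pi.add_apply, hx, hx', this]
      abel
  zero_mem' := by
    refine ⟨0, 0, ?_, ?_, ?_⟩
    · exact Filter.Eventually.of_forall fun x _ => rfl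
    · exact Filter.Eventually.of_forall fun x _ => rfl
    · refine Filter.Eventually.of_forall fun x => ?_
      have := extDeriv_smul (x := x) (0 : ℝ) (0 : E d → E d [⋀^Fin 1]→L[ℝ] ℝ)
      simp only [zero_smul] at this
      simp [SmoothForm.zero_val, this]
  smul_mem' := by
    rintro c a ⟨α, β, h1, h2, h3⟩
    refine ⟨c • α, c • β, ?_, ?_, ?_⟩
    · filter_upwards [h1] with x hx hN
      simp [SmoothForm.smul_val, hx hN]
    · filter_upwards [h2] with x hx hN
      simp [SmoothForm.smul_val, hx hN]
    · filter_upwards [h3] with x hx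
      have : extDeriv (c • β.1) x = c • extDeriv β.1 x := extDeriv_smul c β.1
      simp only [SmoothForm.smul_val, Pi.smul_apply, hx, this, smul_add]

/-- The space `[Λ²(ℝ^d)]_N` of algebraic restrictions to `N` of germs of `2`-forms. -/
abbrev AlgRestr {d : ℕ} (N : Set (E d)) : Type := SmoothForm d 2 ⧸ zeroRestr N

/-- The algebraic restriction `[η]_N` of `η` to `N`. -/
def restr {d : ℕ} (N : Set (E d)) : SmoothForm d 2 →ₗ[ℝ] AlgRestr N := (zeroRestr N).mkQ

/-- Representatives of germs at `0` of closed smooth `2`-forms. -/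
def closedForms (d : ℕ) : Submodule ℝ (SmoothForm d 2) where
  carrier := {η | ∀ᶠ x in 𝓝 (0 : E d), extDeriv η.1 x = 0}
  add_mem' := by
    intro a b ha hb
    filter_upwards [ha, hb, a.2, b.2] with x h1 h2 h3 h4
    have : extDeriv (a.1 + b.1) x = extDeriv a.1 x + extDeriv b.1 x :=
      extDeriv_add (h3.differentiableAt (by simp)) (h4.differentiableAt (by simp))
    simp [SmoothForm.add_val, this, h1, h2]
  zero_mem' := by
    refine Filter.Eventually.of_forall fun x => ?_
    have := extDeriv_smul (x := x) (0 : ℝ) (0 : E d → E d [⋀^Fin 2]→L[ℝ] ℝ)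
    simp only [zero_smul] at this
    simpa [SmoothForm.zero_val] using this
  smul_mem' := by
    intro c a ha
    filter_upwards [ha] with x h1
    have : extDeriv (c • a.1) x = c • extDeriv a.1 x := extDeriv_smul c a.1
    simp [SmoothForm.smul_val, this, h1]

/-- The space `[Z²(ℝ^d)]_N` of algebraic restrictions to `N` of germs of closed `2`-forms. -/
def closedRestr {d : ℕ} (N : Set (E d)) : Submodule ℝ (AlgRestr N) :=
  (closedForms d).map (restr N)

/-! ## Symmetries and their action -/

/-- `Φ` represents a local symmetry of the germ of `N` at `0`: the germ at `0` of a diffeomorphism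
of `(ℝ^d, 0)` with `Φ(N) = N` as germs. -/
structure IsSymmetry {d : ℕ} (N : Set (E d)) (Φ : E d → E d) : Prop where
  map_zero : Φ 0 = 0
  smooth : ∀ᶠ x in 𝓝 (0 : E d), ContDiffAt ℝ ∞ Φ x
  invertible : (fderiv ℝ Φ 0).IsInvertible
  preserves : ∀ᶠ x in 𝓝 (0 : E d), Φ x ∈ N ↔ x ∈ N

/-- The pullback `Φ^* η` of a `2`-form. -/
def pullback {d : ℕ} (Φ : E d → E d) (η : E d → E d [⋀^Fin 2]→L[ℝ] ℝ) :
    E d → E d [⋀^Fin 2]→L[ℝ] ℝ :=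
  fun x => (η (Φ x)).compContinuousLinearMap (fderiv ℝ Φ x)

/-- The algebraic restriction `a` is brought to `b` by a symmetry of `N`: there is a local
symmetry `Φ` of `N` with `Φ^* a = b`, where `Φ^* [η]_N = [Φ^* η]_N`. -/
def Diffeomorphic {d : ℕ} {N : Set (E d)} (a b : AlgRestr N) : Prop :=
  ∃ (Φ : E d → E d) (η η' : SmoothForm d 2), IsSymmetry N Φ ∧
    restr N η = a ∧ restr N η' = b ∧ η'.1 =ᶠ[𝓝 0] pullback Φ η.1

/-- `V` represents the germ at `0` of a smooth vector field tangent to `N`: it differentiates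
functions vanishing on `N` to functions vanishing on `N`. -/
def IsTangentField {d : ℕ} (N : Set (E d)) (V : E d → E d) : Prop :=
  (∀ᶠ x in 𝓝 (0 : E d), ContDiffAt ℝ ∞ V x) ∧
    ∀ f : E d → ℝ, (∀ᶠ x in 𝓝 (0 : E d), ContDiffAt ℝ ∞ f x) →
      (∀ᶠ x in 𝓝 (0 : E d), x ∈ N → f x = 0) →
      ∀ᶠ x in 𝓝 (0 : E d), x ∈ N → fderiv ℝ f x (V x) = 0

/-- The form `d(V ⌟ η)`, which is the Lie derivative `L_V η` when the `2`-form `η` is closed. -/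
def lieClosed {d : ℕ} (V : E d → E d) (η : E d → E d [⋀^Fin 2]→L[ℝ] ℝ) :
    E d → E d [⋀^Fin 2]→L[ℝ] ℝ :=
  extDeriv (n := 1) fun x => ContinuousAlternatingMap.curryLeft (n := 1) (η x) (V x)

/-- The tangent space at `a ∈ [Z²(ℝ^d)]_N` to the orbit of `a` under the symmetries of `N`: all
`L_V a = [L_V η]_N`, where `a = [η]_N`, `η` is closed and `V` is tangent to `N`. -/
def orbitTangent {d : ℕ} {N : Set (E d)} (a : AlgRestr N) : Set (AlgRestr N) :=
  {b | ∃ (V : E d → E d) (η τ : SmoothForm d 2), IsTangentField N V ∧ η ∈ closedForms d ∧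
    restr N η = a ∧ restr N τ = b ∧ τ.1 =ᶠ[𝓝 0] lieClosed V η.1}

/-! ## The curve `S_μ` and the basic forms -/

/-- The form `dx_i ∧ dx_j`. -/
def dxdx {d : ℕ} (i j : Fin d) : E d [⋀^Fin 2]→L[ℝ] ℝ where
  toFun v := v 0 i * v 1 j - v 0 j * v 1 i
  map_update_add' := by
    intro _ m k x y
    fin_cases k <;> simp [Function.update] <;> ring
  map_update_smul' := by
    intro _ m k c x
    fin_cases k <;> simp [Function.update] <;> ring
  cont := by fun_prop
  map_eq_zero_of_eq' := by
    intro v k l hkl hne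
    fin_cases k <;> fin_cases l <;> simp_all <;> ring

section
variable (d : ℕ) (hd : 3 ≤ d)

/-- The index of the coordinate called `x₁`. -/
def i₁ : Fin d := ⟨0, by omega⟩
/-- The index of the coordinate called `x₂`. -/
def i₂ : Fin d := ⟨1, by omega⟩
/-- The index of the coordinate called `x₃`. -/
def i₃ : Fin d := ⟨2, by omega⟩

/-- `S_μ = {x₁² - x₂² - x₃^(μ-3) = x₂ x₃ = x_{≥ 4} = 0} ⊆ ℝ^d`. -/
def curve (μ : ℕ) : Set (E d) :=
  {x | x (i₁ d hd) ^ 2 - x (i₂ d hd) ^ 2 - x (i₃ d hd) ^ (μ - 3) = 0 ∧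
    x (i₂ d hd) * x (i₃ d hd) = 0 ∧ ∀ j : Fin d, 3 ≤ (j : ℕ) → x j = 0}

/-- The forms `θ₁ = dx₁∧dx₃`, `θ₂ = dx₂∧dx₃`, `θ₃ = dx₁∧dx₂`, `θ₄ = x₃ dx₁∧dx₂ - x₁ dx₂∧dx₃` and
`θ_{4+k} = x₃^k dx₁∧dx₃` for `k ≥ 1` (and, unused, `θ₀ = 0`). -/
def thetaFun : ℕ → E d → E d [⋀^Fin 2]→L[ℝ] ℝ
  | 0 => fun _ => 0
  | 1 => fun _ => dxdx (i₁ d hd) (i₃ d hd)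
  | 2 => fun _ => dxdx (i₂ d hd) (i₃ d hd)
  | 3 => fun _ => dxdx (i₁ d hd) (i₂ d hd)
  | 4 => fun x => x (i₃ d hd) • dxdx (i₁ d hd) (i₂ d hd) - x (i₁ d hd) • dxdx (i₂ d hd) (i₃ d hd)
  | k + 5 => fun x => x (i₃ d hd) ^ (k + 1) • dxdx (i₁ d hd) (i₃ d hd)

theorem contDiff_thetaFun (i : ℕ) : ContDiff ℝ ∞ (thetaFun d hd i) := by
  match i with
  | 0 | 1 | 2 | 3 => exact contDiff_const
  | 4 => unfold thetaFun; fun_prop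
  | k + 5 => unfold thetaFun; fun_prop

/-- `θ_i` as a smooth form. -/
def theta (i : ℕ) : SmoothForm d 2 :=
  ⟨thetaFun d hd i, Filter.Eventually.of_forall fun _ => (contDiff_thetaFun d hd i).contDiffAt⟩

end

/-! ## The normal forms -/

/-- Labels of the families of normal forms:
`zero` is `[S_μ]^0`, `two k` is `[S_μ]^k_2`, `twoTop` is `[S_μ]^{μ-4}_2`, `r k` is
`[S_μ]^{1+k}_r`, `rTop` is `[S_μ]^{μ-4}_r`, `threeOne` is `[S_μ]^{3,1}`, `one k` is
`[S_μ]^{2+k,1}`, `iso k` is `[S_μ]^{3+k,k}`, `top` is `[S_μ]^μ`. -/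
inductive Label : Type
  | zero
  | two (k : ℕ)
  | twoTop
  | r (k : ℕ)
  | rTop
  | threeOne
  | one (k : ℕ)
  | iso (k : ℕ)
  | top

namespace Label

/-- The range of the index `k` in the table of normal forms. -/
def Valid (μ : ℕ) : Label → Prop
  | two k => 1 ≤ k ∧ k ≤ μ - 5
  | r k => 1 ≤ k ∧ k ≤ μ - 6
  | one k => 2 ≤ k ∧ k ≤ μ - 4
  | iso k => 2 ≤ k ∧ k ≤ μ - 4
  | zero | twoTop | rTop | threeOne | top => True

/-- The indices `i` of the parameters `c_i` of a family. -/
def params (μ : ℕ) : Label → Finset ℕ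
  | zero => {2, 3}
  | two k => {3, 4 + k}
  | twoTop => {3, μ}
  | r k => {4 + k, 5 + k}
  | rTop => {μ - 1}
  | threeOne => {4}
  | one k => {4 + k}
  | iso _ => ∅
  | top => ∅

/-- The conditions on the parameters of a family. -/
def Admissible (μ : ℕ) : Label → (ℕ → ℝ) → Prop
  | two k, c => c (4 + k) ≠ 0
  | twoTop, c => c 3 * c μ = 0
  | r k, c => c (4 + k) ≠ 0
  | one k, c => k ≤ μ - 5 → c (4 + k) ≠ 0
  | zero, _ | rTop, _ | threeOne, _ | iso _, _ | top, _ => True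

/-- The codimension `i` in the table of normal forms. -/
def cod (μ : ℕ) : Label → ℕ
  | zero => 0
  | two k => k
  | twoTop => μ - 4
  | r k => k + 1
  | rTop => μ - 4
  | threeOne => 3
  | one k => k + 2
  | iso k => k + 3
  | top => μ

/-- The form whose algebraic restriction is the normal form with parameters `c_i = c i`. -/
def form (d : ℕ) (hd : 3 ≤ d) (μ : ℕ) : Label → (ℕ → ℝ) → SmoothForm d 2
  | zero, c => theta d hd 1 + c 2 • theta d hd 2 + c 3 • theta d hd 3
  | two k, c => theta d hd 2 + c 3 • theta d hd 3 + c (4 + k) • theta d hd (4 + k)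
  | twoTop, c => theta d hd 2 + c 3 • theta d hd 3 + c μ • theta d hd μ
  | r k, c => theta d hd 3 + c (4 + k) • theta d hd (4 + k) + c (5 + k) • theta d hd (5 + k)
  | rTop, c => theta d hd 3 + c (μ - 1) • theta d hd (μ - 1)
  | threeOne, c => c 4 • theta d hd 4 + theta d hd 5
  | one k, c => theta d hd 4 + c (4 + k) • theta d hd (4 + k)
  | iso k, _ => theta d hd (4 + k)
  | top, _ => 0

end Label

/-- The normal form of the family `l` with parameters `c`, an algebraic restriction to `S_μ`. -/
def normalForm (d : ℕ) (hd : 3 ≤ d) (μ : ℕ) (l : Label) (c : ℕ → ℝ) : AlgRestr (curve d hd μ) :=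
  restr (curve d hd μ) (l.form d hd μ c)

/-- The singularity class corresponding to the family `l`: the set of all `a ∈ [Z²(ℝ^d)]_{S_μ}`
that are diffeomorphic to some normal form of the family. -/
def singularityClass (d : ℕ) (hd : 3 ≤ d) (μ : ℕ) (l : Label) :
    Set (closedRestr (curve d hd μ)) :=
  {a | ∃ c : ℕ → ℝ, l.Admissible μ c ∧ Diffeomorphic a.1 (normalForm d hd μ l c)}

/-- The parameters `c_i` of the family `l` are (independent) moduli:
* each normal form of the family is diffeomorphic to normal forms of the family for finitely many
  values of the parameters only;
* no nonzero direction `∑ v_i θ_i` in which the parameters can vary within the family is tangent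
  to the orbit of the normal form. -/
def ParametersAreModuli (d : ℕ) (hd : 3 ≤ d) (μ : ℕ) (l : Label) : Prop :=
  ∀ c : ℕ → ℝ, l.Admissible μ c →
    {t : l.params μ → ℝ | ∃ c' : ℕ → ℝ, l.Admissible μ c' ∧ (∀ i, t i = c' i) ∧
      Diffeomorphic (normalForm d hd μ l c') (normalForm d hd μ l c)}.Finite ∧
    ∀ v : ℕ → ℝ, (∀ᶠ s in 𝓝 (0 : ℝ), l.Admissible μ (c + s • v)) →
      restr (curve d hd μ) (∑ i ∈ l.params μ, v i • theta d hd i) ∈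
        orbitTangent (normalForm d hd μ l c) →
      ∀ i ∈ l.params μ, v i = 0

theorem three_le {n : ℕ} (hn : 2 ≤ n) : 3 ≤ 2 * n := by omega

/-! ## Codimension -/

/-- `A ⊆ ℝ^m` is a smooth (embedded) submanifold of codimension `i`: near each of its points it is
the zero set of a submersion to `ℝ^i`. -/
def IsSubmanifoldOfCodim {m : ℕ} (A : Set (Fin m → ℝ)) (i : ℕ) : Prop :=
  ∀ a ∈ A, ∃ (U : Set (Fin m → ℝ)) (f : (Fin m → ℝ) → (Fin i → ℝ)), IsOpen U ∧ a ∈ U ∧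
    ContDiffOn ℝ ∞ f U ∧ (∀ x ∈ U, Function.Surjective (fderiv ℝ f x)) ∧
    A ∩ U = {x ∈ U | f x = 0}

/-- `A` is nonempty and has codimension `i` in the finite-dimensional real vector space `W`: in
linear coordinates on `W`, it is a smooth submanifold of codimension `i`. -/
def HasCodim {W : Type*} [AddCommGroup W] [Module ℝ W] (A : Set W) (i : ℕ) : Prop :=
  A.Nonempty ∧ ∃ (m : ℕ) (e : W ≃ₗ[ℝ] (Fin m → ℝ)), IsSubmanifoldOfCodim (e '' A) i

end SMu

end

noncomputable section

namespace SMu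

/-! ## Smooth dependence of integrals on parameters and Hadamard's lemma -/

/-! Put m = μ - 3. The curve contains the two lines (±t, t, 0) and the arcs (±t^m, 0, t²); for odd m
the arcs are one cusp run through in both directions, for even m they are halves of two smooth
branches. The ideal of germs vanishing on S_μ is never determined. From below, only the defining
equations themselves are used as vanishing germs; from above, only the fact that a vanishing germ
has zero Taylor series along these lines and arcs. The two bounds meet.

Linear structure. If h vanishes on the curve, then d(b h dx_i) shows that b dh ∧ dx_i restricts to
zero (`sum_w_pd`). Applied to x₂x₃, to the quadric x₁² - x₂² - x₃^m and to x₄, x₅, …, this leaves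
finitely many derivatives at 0 of the coefficients (`restr_eq`), and closedness reduces the rest to
the span of θ₁, …, θ_μ (`restr_eq_comb`). Conversely, the functionals `crd` read c₁, …, c_μ off a
form. They kill every α + dβ, because for h flat on the arcs the even and odd parts in ±t^m give
congruences between h, ∂₁h and ∂₁²h on the x₃-axis (`FlatCusp.dvd_T`, `FlatCusp.dvd_T_pd`), while
flatness on the lines constrains the 2-jet in x₁, x₂. So the space of restrictions of closed forms
is ℝ^μ with coordinates c_i (`coordMap_bijective`).

Group action. A symmetry pulls both equations back to germs flat on the branches. Comparing jets
gives its linear part on (x₁, x₂, x₃) as diag(α, a, γ) with α² = a² = γ^m, with further constraints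
on higher jets (`symJets_of_van`). Ordering the terms x₃^k dx₁∧dx₃ by k (the "slots": θ₁, θ₅, …,
θ_μ), the action on the c_i is triangular enough that c₁, c₂, c₃ and the first nonzero slot are
multiplied by monomials in α, a, γ, as is c₄ once c₁ = c₂ = c₃ = 0 (`IsSymmetry.transforms`).
Exceptional terms occur for θ₄ and θ_μ. Tangent vector fields obey the linearised law
(`FieldJets.varies`), with linear part diag(l₁, l₁, l₃) and m l₃ = 2 l₁.

Reduction. For every germ f with f(0) ≠ 0 the weighted scaling x ↦ (±f^m x₁, ±f^m x₂, f² x₃, x₄, …)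
preserves the curve. A constant f normalises a coefficient to 1; f = 1 + κx₁ and f = 1 + κx₂ act on
θ₄ and θ_μ; f = 1 + κx₃^j removes slots behind the first nonzero one.

Conclusion. Conditions c_i = 0 or c_i ≠ 0 (`Label.InClass`) partition ℝ^μ into pieces that are
invariant under the action, and each piece is carried to the normal forms of one family. The
singularity classes are therefore open subsets of coordinate subspaces, which gives the reduction,
the disjointness and the codimensions. Between two normal forms of one family the leading
coefficient 1 is preserved; together with α² = a² = γ^m over ℝ this forces α, a, γ to be ±1, so the
parameters agree up to sign. Infinitesimally it forces l₁ = l₃ = 0. -/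

theorem hasFDerivAt_intervalIntegral_of_contDiff {H F : Type} [NormedAddCommGroup H]
    [NormedSpace ℝ H] [FiniteDimensional ℝ H] [NormedAddCommGroup F] [NormedSpace ℝ F]
    [CompleteSpace F] {G : H × ℝ → F} (hG : ContDiff ℝ ∞ G) (x₀ : H) :
    HasFDerivAt (fun x => ∫ t in (0 : ℝ)..1, G (x, t))
      (∫ t in (0 : ℝ)..1, (fderiv ℝ G (x₀, t)).comp (ContinuousLinearMap.inl ℝ H ℝ)) x₀ := by
  have hG' : Continuous fun p : H × ℝ =>
      (fderiv ℝ G p).comp (ContinuousLinearMap.inl ℝ H ℝ) :=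
    (hG.continuous_fderiv (by simp)).clm_comp continuous_const
  obtain ⟨C, hC⟩ := ((isCompact_closedBall x₀ 1).prod
    (isCompact_Icc (a := (0 : ℝ)) (b := 1))).exists_bound_of_continuousOn hG'.continuousOn
  refine intervalIntegral.hasFDerivAt_integral_of_dominated_of_fderiv_le
    (F := fun x t => G (x, t))
    (F' := fun x t => (fderiv ℝ G (x, t)).comp (ContinuousLinearMap.inl ℝ H ℝ))
    (bound := fun _ => C) (Metric.closedBall_mem_nhds x₀ one_pos) ?_ ?_ ?_ ?_ ?_ ?_
  · exact Filter.Eventually.of_forall fun x =>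
      (hG.continuous.comp (by fun_prop : Continuous fun t : ℝ => (x, t))).aestronglyMeasurable
  · exact (hG.continuous.comp
      (by fun_prop : Continuous fun t : ℝ => (x₀, t))).intervalIntegrable _ _
  · exact (hG'.comp (by fun_prop : Continuous fun t : ℝ => (x₀, t))).aestronglyMeasurable
  · refine Filter.Eventually.of_forall fun t ht x hx => hC (x, t) ⟨hx, ?_⟩
    rw [Set.uIoc_of_le zero_le_one] at ht
    exact ⟨ht.1.le, ht.2⟩
  · exact intervalIntegrable_const
  · refine Filter.Eventually.of_forall fun t _ x _ => ?_
    have h1 : HasFDerivAt G (fderiv ℝ G (x, t)) (x, t) :=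
      (hG.differentiable (by simp) _).hasFDerivAt
    exact h1.comp x (hasFDerivAt_prodMk_left x t)

/-- The derivative is again an integral of this kind, with values in `H →L[ℝ] F`; this is why the
target space is quantified inside the induction. -/
theorem contDiff_intervalIntegral_of_contDiff {H : Type} [NormedAddCommGroup H]
    [NormedSpace ℝ H] [FiniteDimensional ℝ H] (n : ℕ) :
    ∀ {F : Type} [NormedAddCommGroup F] [NormedSpace ℝ F] [CompleteSpace F] {G : H × ℝ → F},
      ContDiff ℝ ∞ G → ContDiff ℝ n (fun x => ∫ t in (0 : ℝ)..1, G (x, t)) := by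
  induction n with
  | zero =>
    intro F _ _ _ G hG
    exact contDiff_zero.2 (continuous_iff_continuousAt.2 fun x =>
      (hasFDerivAt_intervalIntegral_of_contDiff hG x).continuousAt)
  | succ n ih =>
    intro F _ _ _ G hG
    rw [Nat.cast_add, Nat.cast_one, contDiff_succ_iff_hasFDerivAt]
    refine ⟨fun x => ∫ t in (0 : ℝ)..1,
      (fderiv ℝ G (x, t)).comp (ContinuousLinearMap.inl ℝ H ℝ),
      ih (G := fun p => (fderiv ℝ G p).comp (ContinuousLinearMap.inl ℝ H ℝ)) ?_,
      fun x => hasFDerivAt_intervalIntegral_of_contDiff hG x⟩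
    exact (hG.fderiv_right (m := ∞) (by simp)).clm_comp contDiff_const

/-- A function that is smooth near `0` agrees near `0` with a globally smooth one. -/
theorem exists_contDiff_eventuallyEq {d : ℕ} {f : E d → ℝ}
    (hf : ∀ᶠ x in 𝓝 (0 : E d), ContDiffAt ℝ ∞ f x) :
    ∃ g : E d → ℝ, ContDiff ℝ ∞ g ∧ g =ᶠ[𝓝 0] f := by
  obtain ⟨r, hr, h⟩ := Metric.eventually_nhds_iff_ball.1 hf
  let χ : ContDiffBump (0 : E d) := ⟨r / 4, r / 2, by positivity, by linarith⟩
  refine ⟨fun x => χ x * f x, contDiff_iff_contDiffAt.2 fun x => ?_, ?_⟩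
  · by_cases hx : x ∈ Metric.ball (0 : E d) r
    · exact χ.contDiffAt.mul (h x hx)
    · have : (fun x => χ x * f x) =ᶠ[𝓝 x] fun _ => 0 := by
        have hx' : x ∈ (Metric.closedBall (0 : E d) (r / 2))ᶜ := by
          simp only [Metric.mem_ball, not_lt, Set.mem_compl_iff, Metric.mem_closedBall, not_le] at *
          linarith
        filter_upwards [Metric.isClosed_closedBall.isOpen_compl.mem_nhds hx'] with y hy
        rw [χ.zero_of_le_dist, zero_mul]
        simp only [Set.mem_compl_iff, Metric.mem_closedBall, not_le] at hy
        exact hy.le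
      exact contDiffAt_const.congr_of_eventuallyEq this
  · filter_upwards [χ.eventuallyEq_one] with x hx
    simp [hx]

/-- Hadamard's lemma. -/
theorem hadamard {d : ℕ} {f : E d → ℝ} (hf : ContDiff ℝ ∞ f) :
    ∃ q : Fin d → E d → ℝ, (∀ i, ContDiff ℝ ∞ (q i)) ∧
      ∀ x, f x = f 0 + ∑ i, x i * q i x := by
  have hG (i : Fin d) : ContDiff ℝ ∞ fun p : E d × ℝ => fderiv ℝ f (p.2 • p.1) (Pi.single i 1) := by
    have h1 : ContDiff ℝ ∞ (fderiv ℝ f) := hf.fderiv_right (by simp)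
    exact (h1.comp (contDiff_snd.smul contDiff_fst)).clm_apply contDiff_const
  refine ⟨fun i x => ∫ t in (0 : ℝ)..1, fderiv ℝ f (t • x) (Pi.single i 1), fun i => ?_, ?_⟩
  · exact contDiff_infty.2 fun n => contDiff_intervalIntegral_of_contDiff n (hG i)
  · intro x
    have h1 (t : ℝ) : HasDerivAt (fun t : ℝ => f (t • x)) (fderiv ℝ f (t • x) x) t := by
      have h2 : HasDerivAt (fun t : ℝ => t • x) x t := by
        simpa using (hasDerivAt_id t).smul_const x
      exact ((hf.differentiable (by simp) (t • x)).hasFDerivAt).comp_hasDerivAt t h2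
    have hc (i : Fin d) : Continuous fun t : ℝ => fderiv ℝ f (t • x) (Pi.single i 1) :=
      (hG i).continuous.comp (by fun_prop : Continuous fun t : ℝ => (x, t))
    have h3 (t : ℝ) : fderiv ℝ f (t • x) x =
        ∑ i, x i * fderiv ℝ f (t • x) (Pi.single i 1) := by
      conv_lhs => arg 2; rw [pi_eq_sum_univ' x]
      simp [map_sum]
    have h4 : ∫ t in (0 : ℝ)..1, fderiv ℝ f (t • x) x = f x - f 0 := by
      rw [intervalIntegral.integral_eq_sub_of_hasDerivAt (fun t _ => h1 t)]
      · simp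
      · simp_rw [h3]
        exact (continuous_finsetSum _ fun i _ =>
          continuous_const.mul (hc i)).intervalIntegrable _ _
    simp_rw [h3] at h4
    rw [intervalIntegral.integral_finsetSum] at h4
    · simp_rw [intervalIntegral.integral_const_mul] at h4
      linarith
    · exact fun i _ => (continuous_const.mul (hc i)).intervalIntegrable _ _

end SMu

namespace SMu

/-! ## The ring of germs at `0` of smooth functions -/

/-- `f` is smooth near `0`. -/
def IsSm {d : ℕ} (f : E d → ℝ) : Prop := ∀ᶠ x in 𝓝 (0 : E d), ContDiffAt ℝ ∞ f x

theorem IsSm.add {d : ℕ} {f g : E d → ℝ} (hf : IsSm f) (hg : IsSm g) :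
    IsSm fun x => f x + g x := by
  filter_upwards [hf, hg] with x h1 h2 using h1.add h2

theorem IsSm.sub {d : ℕ} {f g : E d → ℝ} (hf : IsSm f) (hg : IsSm g) :
    IsSm fun x => f x - g x := by
  filter_upwards [hf, hg] with x h1 h2 using h1.sub h2

theorem IsSm.mul {d : ℕ} {f g : E d → ℝ} (hf : IsSm f) (hg : IsSm g) :
    IsSm fun x => f x * g x := by
  filter_upwards [hf, hg] with x h1 h2 using h1.mul h2

theorem IsSm.pow {d : ℕ} {f : E d → ℝ} (hf : IsSm f) (n : ℕ) : IsSm fun x => f x ^ n := by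
  filter_upwards [hf] with x h1 using h1.pow n

theorem IsSm.of_contDiff {d : ℕ} {f : E d → ℝ} (hf : ContDiff ℝ ∞ f) : IsSm f :=
  Filter.Eventually.of_forall fun _ => hf.contDiffAt

theorem isSm_const {d : ℕ} (c : ℝ) : IsSm fun _ : E d => c := .of_contDiff contDiff_const

theorem isSm_coord {d : ℕ} (i : Fin d) : IsSm fun x : E d => x i :=
  .of_contDiff (by fun_prop)

theorem IsSm.fderiv_apply {d : ℕ} {f : E d → ℝ} (hf : IsSm f) (v : E d) :
    IsSm fun x => fderiv ℝ f x v := by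
  filter_upwards [hf] with x h1
  exact (h1.fderiv_right (m := ∞) (by simp)).clm_apply contDiffAt_const

/-- The algebra of functions that are smooth near `0`. -/
def smoothFun (d : ℕ) : Subalgebra ℝ (E d → ℝ) where
  carrier := {f | IsSm f}
  mul_mem' hf hg := IsSm.mul hf hg
  add_mem' hf hg := IsSm.add hf hg
  algebraMap_mem' c := isSm_const c

/-- The ideal of functions that vanish near `0`. -/
def nullIdeal (d : ℕ) : Ideal (smoothFun d) where
  carrier := {f | f.1 =ᶠ[𝓝 0] fun _ => 0}
  add_mem' := by
    intro a b ha hb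
    filter_upwards [ha, hb] with x h1 h2
    simp [h1, h2]
  zero_mem' := Filter.Eventually.of_forall fun _ => rfl
  smul_mem' := by
    intro c a ha
    filter_upwards [ha] with x h1
    simp [h1]

/-- The ring of germs at `0` of smooth functions. -/
def Gm (d : ℕ) : Type := smoothFun d ⧸ nullIdeal d

instance (d : ℕ) : CommRing (Gm d) := inferInstanceAs (CommRing (smoothFun d ⧸ nullIdeal d))

instance (d : ℕ) : Algebra ℝ (Gm d) := inferInstanceAs (Algebra ℝ (smoothFun d ⧸ nullIdeal d))

/-- Algebra homomorphisms out of the ring of germs. -/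
def Gm.lift {d : ℕ} {A : Type} [CommRing A] [Algebra ℝ A] (φ : smoothFun d →ₐ[ℝ] A)
    (h : ∀ f : smoothFun d, f ∈ nullIdeal d → φ f = 0) : Gm d →ₐ[ℝ] A :=
  Ideal.Quotient.liftₐ (nullIdeal d) φ h

/-- The germ of a function. -/
def germ {d : ℕ} (f : E d → ℝ) (hf : IsSm f) : Gm d := Ideal.Quotient.mk (nullIdeal d) ⟨f, hf⟩

variable {d : ℕ}

theorem exists_germ (r : Gm d) : ∃ f hf, r = germ f hf := by
  obtain ⟨⟨f, hf⟩, rfl⟩ := Ideal.Quotient.mk_surjective (I := nullIdeal d) r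
  exact ⟨f, hf, rfl⟩

theorem germ_eq_iff {f g : E d → ℝ} {hf : IsSm f} {hg : IsSm g} :
    germ f hf = germ g hg ↔ f =ᶠ[𝓝 0] g := by
  refine (Ideal.Quotient.eq (I := nullIdeal d)).trans ?_
  change (∀ᶠ x in 𝓝 (0 : E d), f x - g x = 0) ↔ _
  simp only [sub_eq_zero]
  rfl

theorem germ_add {f g : E d → ℝ} (hf : IsSm f) (hg : IsSm g) :
    germ f hf + germ g hg = germ (fun x => f x + g x) (hf.add hg) := rfl

theorem germ_sub {f g : E d → ℝ} (hf : IsSm f) (hg : IsSm g) :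
    germ f hf - germ g hg = germ (fun x => f x - g x) (hf.sub hg) := rfl

theorem germ_mul {f g : E d → ℝ} (hf : IsSm f) (hg : IsSm g) :
    germ f hf * germ g hg = germ (fun x => f x * g x) (hf.mul hg) := rfl

theorem germ_pow {f : E d → ℝ} (hf : IsSm f) (n : ℕ) :
    germ f hf ^ n = germ (fun x => f x ^ n) (hf.pow n) := rfl

theorem germ_const (c : ℝ) : germ (fun _ : E d => c) (isSm_const c) = algebraMap ℝ (Gm d) c := rfl

theorem germ_zero : germ (fun _ : E d => (0 : ℝ)) (isSm_const 0) = 0 := rfl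

theorem smul_germ {f : E d → ℝ} (c : ℝ) (hf : IsSm f) :
    c • germ f hf = germ (fun x => c * f x) ((isSm_const c).mul hf) := rfl

theorem isSm_sum {ι : Type*} {s : Finset ι} {f : ι → E d → ℝ} (hf : ∀ i ∈ s, IsSm (f i)) :
    IsSm fun x => ∑ i ∈ s, f i x := by
  have h : ∀ᶠ x in 𝓝 (0 : E d), ∀ i ∈ s, ContDiffAt ℝ ∞ (f i) x :=
    (Filter.eventually_all_finset s).2 hf
  filter_upwards [h] with x hx using ContDiffAt.sum hx

theorem germ_sum {ι : Type*} (s : Finset ι) {f : ι → E d → ℝ} (hf : ∀ i, IsSm (f i)) :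
    ∑ i ∈ s, germ (f i) (hf i) = germ (fun x => ∑ i ∈ s, f i x) (isSm_sum fun i _ => hf i) := by
  classical
  induction s using Finset.induction_on with
  | empty => rfl
  | insert a s ha ih =>
    rw [Finset.sum_insert ha, ih, germ_add]
    exact germ_eq_iff.2 (Filter.Eventually.of_forall fun x => by simp [Finset.sum_insert ha])

/-- The germ of the `i`-th coordinate. -/
def coord (i : Fin d) : Gm d := germ (fun x => x i) (isSm_coord i)

/-- The `i`-th basis vector. -/
abbrev bv (i : Fin d) : E d := Pi.single i 1

/-- The `i`-th partial derivative of a germ. -/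
def pdFun (i : Fin d) : Gm d → Gm d :=
  Quotient.lift (fun f : smoothFun d => germ (fun x => fderiv ℝ f.1 x (bv i)) (f.2.fderiv_apply _))
    (by
      intro a b hab
      have h : a.1 =ᶠ[𝓝 0] b.1 := by
        have h' := (Ideal.Quotient.eq (I := nullIdeal d)).1 (Quotient.sound hab)
        filter_upwards [show ∀ᶠ x in 𝓝 (0 : E d), a.1 x - b.1 x = 0 from h'] with x hx
        linarith
      rw [germ_eq_iff]
      filter_upwards [h.fderiv (𝕜 := ℝ)] with x hx
      rw [hx])

theorem pdFun_germ (i : Fin d) {f : E d → ℝ} (hf : IsSm f) :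
    pdFun i (germ f hf) = germ (fun x => fderiv ℝ f x (bv i)) (hf.fderiv_apply _) := rfl

theorem IsSm.differentiableAt {f : E d → ℝ} (hf : IsSm f) :
    ∀ᶠ x in 𝓝 (0 : E d), DifferentiableAt ℝ f x := by
  filter_upwards [hf] with x hx using hx.differentiableAt (by simp)

/-- The `i`-th partial derivative, a derivation of the ring of germs. -/
def pd (i : Fin d) : Derivation ℝ (Gm d) (Gm d) :=
  Derivation.mk'
    { toFun := pdFun i
      map_add' := by
        intro a b
        obtain ⟨f, hf, rfl⟩ := exists_germ a
        obtain ⟨g, hg, rfl⟩ := exists_germ b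
        rw [germ_add, pdFun_germ, pdFun_germ, pdFun_germ, germ_add, germ_eq_iff]
        filter_upwards [hf.differentiableAt, hg.differentiableAt] with x h1 h2
        rw [fderiv_fun_add h1 h2]
        rfl
      map_smul' := by
        intro c a
        obtain ⟨f, hf, rfl⟩ := exists_germ a
        rw [smul_germ, pdFun_germ, pdFun_germ, RingHom.id_apply, smul_germ, germ_eq_iff]
        filter_upwards [hf.differentiableAt] with x h1
        rw [fderiv_const_mul h1]
        rfl }
    (by
      intro a b
      obtain ⟨f, hf, rfl⟩ := exists_germ a
      obtain ⟨g, hg, rfl⟩ := exists_germ b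
      simp only [LinearMap.coe_mk, AddHom.coe_mk, smul_eq_mul]
      rw [germ_mul, pdFun_germ, pdFun_germ, pdFun_germ, germ_mul, germ_mul, germ_add, germ_eq_iff]
      filter_upwards [hf.differentiableAt, hg.differentiableAt] with x h1 h2
      rw [fderiv_fun_mul h1 h2]
      rfl)

theorem pd_germ (i : Fin d) {f : E d → ℝ} (hf : IsSm f) :
    pd i (germ f hf) = germ (fun x => fderiv ℝ f x (bv i)) (hf.fderiv_apply _) := rfl

theorem pd_coord (i j : Fin d) : pd i (coord j) = if i = j then 1 else 0 := by
  have h (x : E d) : fderiv ℝ (fun x : E d => x j) x (bv i) = if i = j then 1 else 0 := by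
    have : (fun x : E d => x j) = ContinuousLinearMap.proj (R := ℝ) (φ := fun _ : Fin d => ℝ) j :=
      rfl
    rw [this, ContinuousLinearMap.fderiv]
    simp [Pi.single_apply, eq_comm]
  rw [coord, pd_germ]
  split_ifs with hij
  · rw [← map_one (algebraMap ℝ (Gm d)), ← germ_const, germ_eq_iff]
    exact Filter.Eventually.of_forall fun x => by simp only [h, if_pos hij]
  · rw [← germ_zero, germ_eq_iff]
    exact Filter.Eventually.of_forall fun x => by simp only [h, if_neg hij]

/-- Partial derivatives commute. -/
theorem pd_comm (i j : Fin d) (r : Gm d) : pd i (pd j r) = pd j (pd i r) := by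
  obtain ⟨f, hf, rfl⟩ := exists_germ r
  rw [pd_germ, pd_germ, pd_germ, pd_germ, germ_eq_iff]
  filter_upwards [hf] with x hx
  have h1 : DifferentiableAt ℝ (fderiv ℝ f) x :=
    (hx.fderiv_right (m := ∞) (by simp)).differentiableAt (by simp)
  have h2 (v : E d) : fderiv ℝ (fun y => fderiv ℝ f y v) x = (fderiv ℝ (fderiv ℝ f) x).flip v := by
    rw [fderiv_clm_apply h1 (differentiableAt_const v)]
    simp
  rw [h2, h2]
  exact (hx.isSymmSndFDerivAt (by
    simp only [minSmoothness_of_isRCLikeNormedField]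
    exact WithTop.coe_le_coe.2 le_top)).eq _ _

/-- The value of a germ at `0`. -/
def ev : Gm d →ₐ[ℝ] ℝ :=
  Gm.lift
    ((Pi.evalAlgHom ℝ (fun _ : E d => ℝ) 0).comp (smoothFun d).val)
    (fun a ha => Filter.Eventually.self_of_nhds (p := fun x => a.1 x = 0) ha)

theorem ev_germ {f : E d → ℝ} (hf : IsSm f) : ev (germ f hf) = f 0 := rfl

@[simp] theorem ev_coord (i : Fin d) : ev (coord i) = 0 := rfl

/-- Hadamard's lemma for germs. -/
theorem exists_eq_ev_add_sum (r : Gm d) :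
    ∃ q : Fin d → Gm d, r = algebraMap ℝ (Gm d) (ev r) + ∑ i, coord i * q i := by
  obtain ⟨f, hf, rfl⟩ := exists_germ r
  obtain ⟨g, hg, hgf⟩ := exists_contDiff_eventuallyEq hf
  obtain ⟨q, hq, h⟩ := hadamard hg
  refine ⟨fun i => germ (q i) (.of_contDiff (hq i)), ?_⟩
  rw [ev_germ, ← germ_const]
  simp only [coord, germ_mul]
  rw [germ_sum, germ_add, germ_eq_iff]
  filter_upwards [hgf] with x hx
  rw [← hgf.eq_of_nhds, ← hx]
  exact h x

/-! ## Taylor series along curves -/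

/-- A smooth curve through `0`. -/
structure IsCurve (γ : ℝ → E d) : Prop where
  contDiff : ContDiff ℝ ∞ γ
  zero : γ 0 = 0

theorem IsCurve.tendsto {γ : ℝ → E d} (hγ : IsCurve γ) : Filter.Tendsto γ (𝓝 0) (𝓝 0) := by
  have := hγ.contDiff.continuous.tendsto 0
  rwa [hγ.zero] at this

theorem IsCurve.contDiffAt_comp {γ : ℝ → E d} (hγ : IsCurve γ) {f : E d → ℝ} (hf : IsSm f) :
    ContDiffAt ℝ ∞ (fun t => f (γ t)) 0 := by
  have h : ContDiffAt ℝ ∞ f (γ 0) := by rw [hγ.zero]; exact hf.self_of_nhds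
  exact h.comp 0 hγ.contDiff.contDiffAt

/-- The Taylor series at `0` of a function of one variable. -/
def taylorSeries (f : ℝ → ℝ) : PowerSeries ℝ :=
  PowerSeries.mk fun n => iteratedDeriv n f 0 / n.factorial

theorem taylorSeries_mul {f g : ℝ → ℝ} (hf : ContDiffAt ℝ ∞ f 0) (hg : ContDiffAt ℝ ∞ g 0) :
    taylorSeries (fun t => f t * g t) = taylorSeries f * taylorSeries g := by
  ext n
  have h := iteratedDeriv_mul (n := n) (hf.of_le (by exact_mod_cast le_top))
    (hg.of_le (by exact_mod_cast le_top))
  rw [PowerSeries.coeff_mul, Finset.Nat.sum_antidiagonal_eq_sum_range_succ_mk]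
  simp only [taylorSeries, PowerSeries.coeff_mk]
  rw [show (fun t => f t * g t) = f * g from rfl, h, Finset.sum_div]
  refine Finset.sum_congr rfl fun i hi => ?_
  have hi' : i ≤ n := Nat.lt_succ_iff.1 (Finset.mem_range.1 hi)
  rw [Nat.cast_choose ℝ hi']
  have := Nat.factorial_ne_zero i
  have := Nat.factorial_ne_zero n
  have := Nat.factorial_ne_zero (n - i)
  field_simp

theorem taylorSeries_add {f g : ℝ → ℝ} (hf : ContDiffAt ℝ ∞ f 0) (hg : ContDiffAt ℝ ∞ g 0) :
    taylorSeries (fun t => f t + g t) = taylorSeries f + taylorSeries g := by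
  ext n
  simp only [taylorSeries, PowerSeries.coeff_mk, map_add]
  rw [iteratedDeriv_fun_add (hf.of_le (by exact_mod_cast le_top))
    (hg.of_le (by exact_mod_cast le_top)), add_div]

theorem taylorSeries_const (c : ℝ) :
    taylorSeries (fun _ => c) = algebraMap ℝ (PowerSeries ℝ) c := by
  ext n
  simp [taylorSeries, PowerSeries.coeff_mk, iteratedDeriv_const, PowerSeries.coeff_C]
  split_ifs with h <;> simp [h]

theorem taylorSeries_congr {f g : ℝ → ℝ} (h : f =ᶠ[𝓝 0] g) : taylorSeries f = taylorSeries g := by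
  ext n
  simp only [taylorSeries, PowerSeries.coeff_mk]
  rw [h.iteratedDeriv_eq]

theorem taylorSeries_deriv (f : ℝ → ℝ) :
    taylorSeries (deriv f) = PowerSeries.derivative ℝ (taylorSeries f) := by
  ext n
  simp only [taylorSeries, PowerSeries.coeff_mk, PowerSeries.coeff_derivative]
  rw [← iteratedDeriv_succ', Nat.factorial_succ]
  have := Nat.factorial_ne_zero n
  push_cast
  field_simp

theorem taylorSeries_id : taylorSeries (fun t => t) = PowerSeries.X := by
  ext n
  simp only [taylorSeries, PowerSeries.coeff_mk, PowerSeries.coeff_X]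
  match n with
  | 0 => simp
  | 1 => simp
  | n + 2 =>
    rw [iteratedDeriv_succ', iteratedDeriv_succ']
    simp

/-- The Taylor series of a germ along a curve. -/
def tay (γ : ℝ → E d) (hγ : IsCurve γ) : Gm d →ₐ[ℝ] PowerSeries ℝ :=
  Gm.lift
    { toFun := fun f => taylorSeries fun t => f.1 (γ t)
      map_one' := (taylorSeries_const 1).trans (map_one _)
      map_mul' := fun f g => taylorSeries_mul (hγ.contDiffAt_comp f.2) (hγ.contDiffAt_comp g.2)
      map_zero' := (taylorSeries_const 0).trans (map_zero _)
      map_add' := fun f g => taylorSeries_add (hγ.contDiffAt_comp f.2) (hγ.contDiffAt_comp g.2)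
      commutes' := fun c => taylorSeries_const c }
    (fun _ ha => (taylorSeries_congr (hγ.tendsto.eventually ha)).trans
      ((taylorSeries_const 0).trans (map_zero _)))

theorem tay_germ {γ : ℝ → E d} (hγ : IsCurve γ) {f : E d → ℝ} (hf : IsSm f) :
    tay γ hγ (germ f hf) = taylorSeries fun t => f (γ t) := rfl

theorem constantCoeff_tay {γ : ℝ → E d} (hγ : IsCurve γ) (r : Gm d) :
    PowerSeries.constantCoeff (tay γ hγ r) = ev r := by
  obtain ⟨f, hf, rfl⟩ := exists_germ r
  rw [tay_germ, ev_germ, ← PowerSeries.coeff_zero_eq_constantCoeff_apply]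
  simp [taylorSeries, hγ.zero]

theorem tay_coord {γ : ℝ → E d} (hγ : IsCurve γ) (i : Fin d) :
    tay γ hγ (coord i) = taylorSeries fun t => γ t i := rfl

theorem taylorSeries_monomial (c : ℝ) (n : ℕ) :
    taylorSeries (fun t => c * t ^ n) = PowerSeries.C c * PowerSeries.X ^ n := by
  have h : ∀ n : ℕ, taylorSeries (fun t => t ^ n) = PowerSeries.X ^ n := by
    intro n
    induction n with
    | zero => simpa using (taylorSeries_const 1).trans (map_one _)
    | succ n ih =>
      simp only [pow_succ]
      rw [taylorSeries_mul (by fun_prop) (by fun_prop), ih, taylorSeries_id]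
  rw [taylorSeries_mul (by fun_prop) (by fun_prop), taylorSeries_const, h]
  rfl

/-- The Taylor series along the `i`-th axis turns `∂ᵢ` into the derivative. -/
theorem tay_pd_axis (i : Fin d) (hγ : IsCurve fun t : ℝ => t • bv i) (r : Gm d) :
    tay _ hγ (pd i r) = PowerSeries.derivative ℝ (tay _ hγ r) := by
  obtain ⟨f, hf, rfl⟩ := exists_germ r
  rw [pd_germ, tay_germ, tay_germ, ← taylorSeries_deriv]
  apply taylorSeries_congr
  filter_upwards [hγ.tendsto.eventually hf.differentiableAt] with t ht
  have h2 : HasDerivAt (fun t : ℝ => t • bv i) (bv i) t := by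
    simpa using (hasDerivAt_id t).smul_const (bv i)
  exact (ht.hasFDerivAt.comp_hasDerivAt t h2).deriv.symm

end SMu

namespace SMu

/-! ## Taylor expansions along the branches of the curve -/

section
variable {d : ℕ} (hd : 3 ≤ d)

theorem i₁_ne_i₂ : i₁ d hd ≠ i₂ d hd := by simp [i₁, i₂]
theorem i₁_ne_i₃ : i₁ d hd ≠ i₃ d hd := by simp [i₁, i₃]
theorem i₂_ne_i₃ : i₂ d hd ≠ i₃ d hd := by simp [i₂, i₃]

theorem eq_of_val_lt_three {j : Fin d} (hj : (j : ℕ) < 3) :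
    j = i₁ d hd ∨ j = i₂ d hd ∨ j = i₃ d hd := by
  simp only [i₁, i₂, i₃, Fin.ext_iff]
  omega

theorem ne_of_three_le {j : Fin d} (hj : 3 ≤ (j : ℕ)) :
    j ≠ i₁ d hd ∧ j ≠ i₂ d hd ∧ j ≠ i₃ d hd := by
  simp only [i₁, i₂, i₃, ne_eq, Fin.ext_iff]
  omega

theorem sum_fin_eq {M : Type*} [AddCommMonoid M] (f : Fin d → M) :
    ∑ j, f j = f (i₁ d hd) + f (i₂ d hd) + f (i₃ d hd) +
      ∑ j ∈ Finset.univ.filter (fun j : Fin d => 3 ≤ (j : ℕ)), f j := by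
  rw [← Finset.sum_filter_not_add_sum_filter Finset.univ (fun j : Fin d => 3 ≤ (j : ℕ))]
  congr 1
  have h : Finset.univ.filter (fun j : Fin d => ¬ 3 ≤ (j : ℕ)) =
      {i₁ d hd, i₂ d hd, i₃ d hd} := by
    ext j
    simp only [Finset.mem_filter, Finset.mem_univ, true_and, Finset.mem_insert,
      Finset.mem_singleton, i₁, i₂, i₃, Fin.ext_iff]
    omega
  rw [h, Finset.sum_insert (by simp [i₁_ne_i₂, i₁_ne_i₃]),
    Finset.sum_insert (by simp [i₂_ne_i₃]), Finset.sum_singleton, add_assoc]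

/-- The ideal generated by the coordinates `x₄, x₅, …`. -/
def restIdeal (d : ℕ) : Ideal (Gm d) := Ideal.span {r | ∃ j : Fin d, 3 ≤ (j : ℕ) ∧ r = coord j}

theorem coord_mem_restIdeal {j : Fin d} (hj : 3 ≤ (j : ℕ)) : coord j ∈ restIdeal d :=
  Ideal.subset_span ⟨j, hj, rfl⟩

theorem pd_mem_restIdeal {i : Fin d} (hi : (i : ℕ) < 3) {s : Gm d} (hs : s ∈ restIdeal d) :
    pd i s ∈ restIdeal d := by
  induction hs using Submodule.span_induction with
  | mem x h =>
    obtain ⟨j, hj, rfl⟩ := h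
    rw [pd_coord, if_neg (by rintro rfl; omega)]
    exact zero_mem _
  | zero => rw [map_zero]; exact zero_mem _
  | add x y _ _ hx hy => rw [map_add]; exact add_mem hx hy
  | smul a x hx h =>
    rw [smul_eq_mul, Derivation.leibniz]
    exact add_mem (Ideal.mul_mem_left _ _ h) (Ideal.mul_mem_right _ _ hx)

theorem map_eq_zero_of_mem_restIdeal {A : Type*} [CommRing A] [Algebra ℝ A] (φ : Gm d →ₐ[ℝ] A)
    (hφ : ∀ j : Fin d, 3 ≤ (j : ℕ) → φ (coord j) = 0) {s : Gm d} (hs : s ∈ restIdeal d) :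
    φ s = 0 := by
  have h : restIdeal d ≤ RingHom.ker φ := by
    refine Ideal.span_le.2 ?_
    rintro _ ⟨j, hj, rfl⟩
    exact hφ j hj
  exact h hs

/-- Hadamard's lemma, separating the coordinates `x₁, x₂, x₃`. -/
theorem exists_hadamard (r : Gm d) : ∃ q₁ q₂ q₃ s : Gm d, s ∈ restIdeal d ∧
    r = algebraMap ℝ (Gm d) (ev r) + coord (i₁ d hd) * q₁ + coord (i₂ d hd) * q₂ +
      coord (i₃ d hd) * q₃ + s := by
  obtain ⟨q, hq⟩ := exists_eq_ev_add_sum r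
  refine ⟨q (i₁ d hd), q (i₂ d hd), q (i₃ d hd),
    ∑ j ∈ Finset.univ.filter (fun j : Fin d => 3 ≤ (j : ℕ)), coord j * q j,
    sum_mem fun j hj => Ideal.mul_mem_right _ _
      (coord_mem_restIdeal (Finset.mem_filter.1 hj).2), ?_⟩
  conv_lhs => rw [hq, sum_fin_eq hd]
  simp only [← add_assoc]

theorem isCurve_axis (i : Fin d) : IsCurve fun t : ℝ => t • bv i :=
  ⟨by fun_prop, by simp⟩

/-- The branch `t ↦ (σ t ^ m, 0, t ^ 2)` of the curve, for `σ = ±1`. -/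
def cusp (m : ℕ) (σ : ℝ) (t : ℝ) : E d := (σ * t ^ m) • bv (i₁ d hd) + t ^ 2 • bv (i₃ d hd)

/-- The branch `t ↦ (σ t, t, 0)` of the curve, for `σ = ±1`. -/
def line (σ : ℝ) (t : ℝ) : E d := (σ * t) • bv (i₁ d hd) + t • bv (i₂ d hd)

theorem isCurve_cusp {m : ℕ} (hm : m ≠ 0) (σ : ℝ) : IsCurve (cusp hd m σ) :=
  ⟨by unfold cusp; fun_prop, by simp [cusp, hm]⟩

theorem isCurve_line (σ : ℝ) : IsCurve (line hd σ) :=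
  ⟨by unfold line; fun_prop, by simp [line]⟩

/-- The Taylor series along the third axis. -/
def T : Gm d →ₐ[ℝ] PowerSeries ℝ := tay _ (isCurve_axis (i₃ d hd))

/-- The Taylor series along a cuspidal branch. -/
def Γ {m : ℕ} (hm : m ≠ 0) (σ : ℝ) : Gm d →ₐ[ℝ] PowerSeries ℝ := tay _ (isCurve_cusp hd hm σ)

/-- The Taylor series along a line. -/
def Λ (σ : ℝ) : Gm d →ₐ[ℝ] PowerSeries ℝ := tay _ (isCurve_line hd σ)

open PowerSeries in
theorem T_coord (j : Fin d) : T hd (coord j) = if j = i₃ d hd then X else 0 := by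
  have h0 : taylorSeries (fun _ => 0) = 0 := (taylorSeries_const 0).trans (map_zero _)
  rw [T, tay_coord]
  split_ifs with h
  · subst h; simp [taylorSeries_id]
  · simp [h, h0]

theorem T_restIdeal {s : Gm d} (hs : s ∈ restIdeal d) : T hd s = 0 :=
  map_eq_zero_of_mem_restIdeal _
    (fun j hj => by rw [T_coord, if_neg (ne_of_three_le hd hj).2.2]) hs

open PowerSeries in
theorem Γ_coord {m : ℕ} (hm : m ≠ 0) (σ : ℝ) (j : Fin d) : Γ hd hm σ (coord j) =
    if j = i₁ d hd then C σ * X ^ m else if j = i₃ d hd then X ^ 2 else 0 := by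
  have h0 : taylorSeries (fun _ => 0) = 0 := (taylorSeries_const 0).trans (map_zero _)
  have h2 := taylorSeries_monomial 1 2
  rw [Γ, tay_coord]
  split_ifs with h h'
  · subst h; simp [cusp, i₁_ne_i₃, taylorSeries_monomial]
  · subst h'; simpa [cusp, (i₁_ne_i₃ hd).symm] using h2
  · simp [cusp, h, h', h0]

theorem Γ_restIdeal {m : ℕ} (hm : m ≠ 0) (σ : ℝ) {s : Gm d} (hs : s ∈ restIdeal d) :
    Γ hd hm σ s = 0 :=
  map_eq_zero_of_mem_restIdeal _ (fun j hj => by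
    rw [Γ_coord, if_neg (ne_of_three_le hd hj).1, if_neg (ne_of_three_le hd hj).2.2]) hs

open PowerSeries in
theorem Λ_coord (σ : ℝ) (j : Fin d) : Λ hd σ (coord j) =
    if j = i₁ d hd then C σ * X else if j = i₂ d hd then X else 0 := by
  have h0 : taylorSeries (fun _ => 0) = 0 := (taylorSeries_const 0).trans (map_zero _)
  have h2 := taylorSeries_monomial σ 1
  rw [Λ, tay_coord]
  split_ifs with h h'
  · subst h; simpa [line, i₁_ne_i₂] using h2
  · subst h'; simp [line, (i₁_ne_i₂ hd).symm, taylorSeries_id]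
  · simp [line, h, h', h0]

theorem Λ_restIdeal (σ : ℝ) {s : Gm d} (hs : s ∈ restIdeal d) : Λ hd σ s = 0 :=
  map_eq_zero_of_mem_restIdeal _ (fun j hj => by
    rw [Λ_coord, if_neg (ne_of_three_le hd hj).1, if_neg (ne_of_three_le hd hj).2.1]) hs

theorem ev_restIdeal {s : Gm d} (hs : s ∈ restIdeal d) : ev s = 0 :=
  map_eq_zero_of_mem_restIdeal ev (fun j _ => ev_coord j) hs

theorem constantCoeff_T (r : Gm d) : PowerSeries.constantCoeff (T hd r) = ev r :=
  constantCoeff_tay _ r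

theorem constantCoeff_Λ (σ : ℝ) (r : Gm d) : PowerSeries.constantCoeff (Λ hd σ r) = ev r :=
  constantCoeff_tay _ r

theorem T_pd_three (r : Gm d) : T hd (pd (i₃ d hd) r) = PowerSeries.derivative ℝ (T hd r) :=
  tay_pd_axis _ _ r

theorem coeff_one_T (r : Gm d) : PowerSeries.coeff 1 (T hd r) = ev (pd (i₃ d hd) r) := by
  rw [← constantCoeff_T hd, T_pd_three, ← PowerSeries.coeff_zero_eq_constantCoeff_apply,
    PowerSeries.coeff_derivative]
  simp

end

/-! ### Congruences on the x₃-axis for germs flat along the branches. -/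

section
variable {d : ℕ} (hd : 3 ≤ d)

local notation "x₁" => coord (i₁ d hd)
local notation "x₂" => coord (i₂ d hd)
local notation "x₃" => coord (i₃ d hd)
local notation "∂₁" => pd (i₁ d hd)
local notation "∂₂" => pd (i₂ d hd)
local notation "∂₃" => pd (i₃ d hd)

open PowerSeries

/-- The expansion in powers of `x₁` along the cuspidal branches. -/
theorem Γ_expansion {m : ℕ} (hm : m ≠ 0) (σ : ℝ) (j : ℕ) (hj : j ≤ 4 * m) (r : Gm d) :
    X ^ j ∣ Γ hd hm σ r - (expand 2 two_ne_zero (T hd r) +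
      C σ * X ^ m * expand 2 two_ne_zero (T hd (∂₁ r)) +
      C (σ ^ 2 / 2) * X ^ (2 * m) * expand 2 two_ne_zero (T hd (∂₁ (∂₁ r))) +
      C (σ ^ 3 / 6) * X ^ (3 * m) * expand 2 two_ne_zero (T hd (∂₁ (∂₁ (∂₁ r))))) := by
  induction j generalizing r with
  | zero => simp
  | succ j ih =>
    -- Along the arc x₁ = σX^m and x₃ = X² are divisible by X, while x₂ and the remaining
    -- coordinates vanish. Congruences modulo X^j for q₁ and q₃ thus give one modulo X^(j+1) for r.
    obtain ⟨q₁, q₂, q₃, s, hs, hr⟩ := exists_hadamard hd r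
    have hs1 : ∂₁ s ∈ restIdeal d := pd_mem_restIdeal (by simp [i₁]) hs
    have hs2 : ∂₁ (∂₁ s) ∈ restIdeal d := pd_mem_restIdeal (by simp [i₁]) hs1
    have hs3 : ∂₁ (∂₁ (∂₁ s)) ∈ restIdeal d := pd_mem_restIdeal (by simp [i₁]) hs2
    have n12 := i₁_ne_i₂ hd
    have n13 := i₁_ne_i₃ hd
    have n23 := i₂_ne_i₃ hd
    have e1 : Γ hd hm σ r = C (ev r) + C σ * X ^ m * Γ hd hm σ q₁ + X ^ 2 * Γ hd hm σ q₃ := by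
      conv_lhs => rw [hr]
      simp [Γ_coord, Γ_restIdeal hd hm σ hs, n12.symm, n13.symm, n23, AlgHom.commutes]
    have e2 : T hd r = C (ev r) + X * T hd q₃ := by
      conv_lhs => rw [hr]
      simp [T_coord, T_restIdeal hd hs, n13, n23, AlgHom.commutes]
    have e3 : T hd (∂₁ r) = T hd q₁ + X * T hd (∂₁ q₃) := by
      conv_lhs => rw [hr]
      simp [T_coord, T_restIdeal hd hs1, n12, n13, n23, pd_coord]
    have e4 : T hd (∂₁ (∂₁ r)) = 2 * T hd (∂₁ q₁) + X * T hd (∂₁ (∂₁ q₃)) := by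
      conv_lhs => rw [hr]
      simp [T_coord, T_restIdeal hd hs2, n12, n13, n23, pd_coord]
      ring
    have e5 : T hd (∂₁ (∂₁ (∂₁ r))) = 3 * T hd (∂₁ (∂₁ q₁)) + X * T hd (∂₁ (∂₁ (∂₁ q₃))) := by
      conv_lhs => rw [hr]
      simp [T_coord, T_restIdeal hd hs3, n12, n13, n23, pd_coord]
      ring
    obtain ⟨u, hu⟩ := ih (by omega) q₁
    obtain ⟨v, hv⟩ := ih (by omega) q₃
    rw [sub_eq_iff_eq_add] at hu hv
    rw [e1, e2, e3, e4, e5, hu, hv]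
    simp only [map_add, map_mul, expand_X, expand_C, map_ofNat]
    obtain ⟨m, rfl⟩ : ∃ k, m = k + 1 := ⟨m - 1, by omega⟩
    obtain ⟨k, hk⟩ := Nat.exists_eq_add_of_le hj
    have c2 : (C (σ ^ 2 / 2) : PowerSeries ℝ) * 2 = C σ ^ 2 := by
      rw [← map_ofNat C 2, ← map_mul, ← map_pow]; congr 1; ring
    have c3 : (C (σ ^ 3 / 6) : PowerSeries ℝ) * 3 = C σ * C (σ ^ 2 / 2) := by
      rw [← map_ofNat C 3, ← map_mul, ← map_mul]; congr 1; ring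
    -- The cubic term of q₁, multiplied by x₁, is of order 4m and has no counterpart in the
    -- expansion of r. It is absorbed in the remainder, which is where j ≤ 4m is needed.
    have hX : (X : PowerSeries ℝ) ^ (m + 1) * X ^ (3 * (m + 1)) = X ^ (j + 1) * X ^ k := by
      rw [← pow_add, ← pow_add]; congr 1; omega
    refine ⟨C σ * X ^ m * u + X * v + C σ * C (σ ^ 3 / 6) * X ^ k *
      expand 2 two_ne_zero (T hd (∂₁ (∂₁ (∂₁ q₁)))), ?_⟩
    linear_combination (C σ * C (σ ^ 3 / 6) *
      expand 2 two_ne_zero (T hd (∂₁ (∂₁ (∂₁ q₁))))) * hX -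
      X ^ (2 * (m + 1)) * expand 2 two_ne_zero (T hd (∂₁ q₁)) * c2 -
      X ^ (3 * (m + 1)) * expand 2 two_ne_zero (T hd (∂₁ (∂₁ q₁))) * c3

theorem X_pow_dvd_of_expand {k : ℕ} {p : PowerSeries ℝ}
    (h : X ^ (2 * k) ∣ expand 2 two_ne_zero p) : X ^ k ∣ p := by
  rw [X_pow_dvd_iff] at h ⊢
  intro n hn
  have := h (2 * n) (by omega)
  rwa [coeff_expand_mul] at this

/-- A germ that vanishes on the cuspidal branches, to infinite order at `0`. -/
structure FlatCusp {m : ℕ} (hm : m ≠ 0) (h : Gm d) : Prop where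
  pos : Γ hd hm 1 h = 0
  neg : Γ hd hm (-1) h = 0

/-- A germ that vanishes on the lines, to infinite order at `0`. -/
structure FlatLine (h : Gm d) : Prop where
  pos : Λ hd 1 h = 0
  neg : Λ hd (-1) h = 0

variable {hd}

/-- Adding the expansions for σ = 1 and σ = -1 cancels the odd powers of x₁; what remains is a
series in X², known modulo X^(4m). -/
theorem FlatCusp.dvd_T {m : ℕ} {hm : m ≠ 0} {h : Gm d} (hh : FlatCusp hd hm h) :
    X ^ (2 * m) ∣ T hd h + C (1 / 2) * X ^ m * T hd (∂₁ (∂₁ h)) := by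
  have h1 := Γ_expansion hd hm 1 (4 * m) le_rfl h
  have h2 := Γ_expansion hd hm (-1) (4 * m) le_rfl h
  rw [hh.pos] at h1
  rw [hh.neg] at h2
  apply X_pow_dvd_of_expand
  have h3 := (dvd_add h1 h2).mul_left (C (-1 / 2))
  rw [show 4 * m = 2 * (2 * m) by ring] at h3
  convert h3 using 1
  have e1 : (C (-1 : ℝ) : PowerSeries ℝ) = -1 := by simp
  have e2 : (C (-1 / 2 : ℝ) : PowerSeries ℝ) = - C (1 / 2) := by rw [← map_neg]; congr 1; ring
  have e3 : (C ((-1 : ℝ) ^ 3 / 6) : PowerSeries ℝ) = - C (1 / 6) := by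
    rw [← map_neg]; congr 1; ring
  have e4 : (C (1 / 2 : ℝ) : PowerSeries ℝ) * 2 = 1 := by
    rw [← map_ofNat C 2, ← map_mul]; norm_num
  simp only [map_add, map_mul, map_pow, expand_X, expand_C, e1, e2, e3, one_pow, map_one,
    neg_one_sq]
  linear_combination (-1 : PowerSeries ℝ) * (expand 2 two_ne_zero (T hd h) +
    C (1 / 2) * X ^ (2 * m) * expand 2 two_ne_zero (T hd (∂₁ (∂₁ h)))) * e4

/-- Subtracting the two expansions leaves the odd powers of x₁. Modulo X^(3m) only the linear one
survives, and its factor X^m can be cancelled. -/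
theorem FlatCusp.dvd_T_pd {m : ℕ} {hm : m ≠ 0} {h : Gm d} (hh : FlatCusp hd hm h) :
    X ^ m ∣ T hd (∂₁ h) := by
  have h1 := Γ_expansion hd hm 1 (3 * m) (by omega) h
  have h2 := Γ_expansion hd hm (-1) (3 * m) (by omega) h
  rw [hh.pos] at h1
  rw [hh.neg] at h2
  apply X_pow_dvd_of_expand
  have h3 := (dvd_sub h1 h2).mul_left (C (-1 / 2))
  have e1 : (C (-1 : ℝ) : PowerSeries ℝ) = -1 := by simp
  have e2 : (C (-1 / 2 : ℝ) : PowerSeries ℝ) = - C (1 / 2) := by rw [← map_neg]; congr 1; ring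
  have e3 : (C ((-1 : ℝ) ^ 3 / 6) : PowerSeries ℝ) = - C (1 / 6) := by
    rw [← map_neg]; congr 1; ring
  have e4 : (C (1 / 2 : ℝ) : PowerSeries ℝ) * 2 = 1 := by
    rw [← map_ofNat C 2, ← map_mul]; norm_num
  have h4 : X ^ (3 * m) ∣ X ^ m * expand 2 two_ne_zero (T hd (∂₁ h)) := by
    rw [← dvd_add_left (c := C (1 / 6) * X ^ (3 * m) *
      expand 2 two_ne_zero (T hd (∂₁ (∂₁ (∂₁ h))))) ((dvd_mul_left _ _).mul_right _)]
    convert h3 using 1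
    simp only [e1, e2, e3, one_pow, map_one, neg_one_sq]
    linear_combination (-1 : PowerSeries ℝ) * (X ^ m * expand 2 two_ne_zero (T hd (∂₁ h)) +
      C (1 / 6) * X ^ (3 * m) * expand 2 two_ne_zero (T hd (∂₁ (∂₁ (∂₁ h))))) * e4
  rw [show 3 * m = m + 2 * m by ring, pow_add] at h4
  exact (mul_dvd_mul_iff_left (pow_ne_zero _ X_ne_zero)).1 h4

theorem FlatCusp.dvd_T_self {m : ℕ} {hm : m ≠ 0} {h : Gm d} (hh : FlatCusp hd hm h) :
    X ^ m ∣ T hd h := by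
  have h1 := (pow_dvd_pow X (by omega : m ≤ 2 * m)).trans hh.dvd_T
  rwa [dvd_add_left] at h1
  exact (dvd_mul_left _ _).mul_right _

theorem coeff_one_Λ (σ : ℝ) (r : Gm d) :
    coeff 1 (Λ hd σ r) = σ * ev (∂₁ r) + ev (∂₂ r) := by
  obtain ⟨q₁, q₂, q₃, s, hs, hr⟩ := exists_hadamard hd r
  have hs1 : ∂₁ s ∈ restIdeal d := pd_mem_restIdeal (by simp [i₁]) hs
  have hs2 : ∂₂ s ∈ restIdeal d := pd_mem_restIdeal (by simp [i₂]) hs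
  have n12 := i₁_ne_i₂ hd
  have n13 := i₁_ne_i₃ hd
  have n23 := i₂_ne_i₃ hd
  have e1 : Λ hd σ r = C (ev r) + X * (C σ * Λ hd σ q₁) + X * Λ hd σ q₂ := by
    conv_lhs => rw [hr]
    simp [Λ_coord, Λ_restIdeal hd σ hs, n12.symm, n13.symm, n23.symm, AlgHom.commutes]
    ring
  have e2 : ev (∂₁ r) = ev q₁ := by
    conv_lhs => rw [hr]
    simp [ev_restIdeal hs1, n12, n13, pd_coord]
  have e3 : ev (∂₂ r) = ev q₂ := by
    conv_lhs => rw [hr]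
    simp [ev_restIdeal hs2, n12.symm, n23, pd_coord]
  rw [e1, e2, e3, show coeff (R := ℝ) 1 = coeff (0 + 1) from rfl]
  simp only [map_add, coeff_succ_X_mul, coeff_C_mul, coeff_zero_eq_constantCoeff_apply,
    constantCoeff_Λ]
  simp

theorem coeff_two_Λ (σ : ℝ) (r : Gm d) : coeff 2 (Λ hd σ r) =
    (σ ^ 2 * ev (∂₁ (∂₁ r)) + 2 * σ * ev (∂₁ (∂₂ r)) + ev (∂₂ (∂₂ r))) / 2 := by
  obtain ⟨q₁, q₂, q₃, s, hs, hr⟩ := exists_hadamard hd r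
  have hs1 : ∂₁ s ∈ restIdeal d := pd_mem_restIdeal (by simp [i₁]) hs
  have hs2 : ∂₂ s ∈ restIdeal d := pd_mem_restIdeal (by simp [i₂]) hs
  have hs3 : ∂₁ (∂₁ s) ∈ restIdeal d := pd_mem_restIdeal (by simp [i₁]) hs1
  have hs4 : ∂₁ (∂₂ s) ∈ restIdeal d := pd_mem_restIdeal (by simp [i₁]) hs2
  have hs5 : ∂₂ (∂₂ s) ∈ restIdeal d := pd_mem_restIdeal (by simp [i₂]) hs2
  have n12 := i₁_ne_i₂ hd
  have n13 := i₁_ne_i₃ hd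
  have n23 := i₂_ne_i₃ hd
  have e1 : Λ hd σ r = C (ev r) + X * (C σ * Λ hd σ q₁) + X * Λ hd σ q₂ := by
    conv_lhs => rw [hr]
    simp [Λ_coord, Λ_restIdeal hd σ hs, n12.symm, n13.symm, n23.symm, AlgHom.commutes]
    ring
  have e2 : ev (∂₁ (∂₁ r)) = 2 * ev (∂₁ q₁) := by
    conv_lhs => rw [hr]
    simp [ev_restIdeal hs3, n12, n13, pd_coord]
    ring
  have e3 : ev (∂₁ (∂₂ r)) = ev (∂₁ q₂) + ev (∂₂ q₁) := by
    conv_lhs => rw [hr]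
    simp [ev_restIdeal hs4, n12, n12.symm, n13, n23, pd_coord]
    ring
  have e4 : ev (∂₂ (∂₂ r)) = 2 * ev (∂₂ q₂) := by
    conv_lhs => rw [hr]
    simp [ev_restIdeal hs5, n12.symm, n23, pd_coord]
    ring
  rw [e1, e2, e3, e4, show (2 : ℕ) = 1 + 1 from rfl]
  simp only [map_add, coeff_succ_X_mul, coeff_C_mul, coeff_one_Λ]
  rw [coeff_C, if_neg (by omega)]
  ring

theorem FlatLine.ev_pd {h : Gm d} (hh : FlatLine hd h) : ev (∂₁ h) = 0 ∧ ev (∂₂ h) = 0 := by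
  have h1 := coeff_one_Λ (hd := hd) 1 h
  have h2 := coeff_one_Λ (hd := hd) (-1) h
  rw [hh.pos, map_zero] at h1
  rw [hh.neg, map_zero] at h2
  constructor <;> linarith

/-- The two lines give two equations for three second derivatives. The pure ones are not zero
separately, as x₁² - x₂² shows. -/
theorem FlatLine.ev_pd_pd {h : Gm d} (hh : FlatLine hd h) :
    ev (∂₁ (∂₂ h)) = 0 ∧ ev (∂₁ (∂₁ h)) + ev (∂₂ (∂₂ h)) = 0 := by
  have h1 := coeff_two_Λ (hd := hd) 1 h
  have h2 := coeff_two_Λ (hd := hd) (-1) h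
  rw [hh.pos, map_zero] at h1
  rw [hh.neg, map_zero] at h2
  constructor <;> linarith

theorem FlatLine.ev_eq_zero {h : Gm d} (hh : FlatLine hd h) : ev h = 0 := by
  rw [← constantCoeff_Λ hd 1, hh.pos, map_zero]

end

end SMu

namespace SMu

/-! ## Coefficients of forms -/

section
variable {d : ℕ}

theorem isSm_form_apply {p : ℕ} (η : SmoothForm d p) (v : Fin p → E d) :
    IsSm fun x => η.1 x v := by
  filter_upwards [η.2] with x hx
  exact (ContinuousAlternatingMap.apply ℝ (E d) ℝ v).contDiff.contDiffAt.comp x hx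

/-- The coefficient of `dx_i` in a `1`-form. -/
def coef₁ (β : SmoothForm d 1) (i : Fin d) : Gm d :=
  germ (fun x => β.1 x ![bv i]) (isSm_form_apply β _)

/-- The coefficient of `dx_i ∧ dx_j` in a `2`-form. -/
def coef (i j : Fin d) : SmoothForm d 2 →ₗ[ℝ] Gm d where
  toFun η := germ (fun x => η.1 x ![bv i, bv j]) (isSm_form_apply η _)
  map_add' _ _ := rfl
  map_smul' _ _ := rfl

theorem coef_apply (i j : Fin d) (η : SmoothForm d 2) :
    coef i j η = germ (fun x => η.1 x ![bv i, bv j]) (isSm_form_apply η _) := rfl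

theorem coef_congr {η η' : SmoothForm d 2} (h : η.1 =ᶠ[𝓝 0] η'.1) (i j : Fin d) :
    coef i j η = coef i j η' := by
  rw [coef_apply, coef_apply, germ_eq_iff]
  filter_upwards [h] with x hx
  rw [hx]

theorem apply_swap (ζ : E d [⋀^Fin 2]→L[ℝ] ℝ) (v w : E d) : ζ ![w, v] = -ζ ![v, w] := by
  have h := ζ.toAlternatingMap.map_swap ![v, w] (i := 0) (j := 1) (by simp)
  have h2 : ![v, w] ∘ Equiv.swap (0 : Fin 2) 1 = ![w, v] := by
    ext k : 1
    fin_cases k <;> simp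
  rw [h2] at h
  exact h

theorem coef_swap (i j : Fin d) (η : SmoothForm d 2) : coef j i η = -coef i j η := by
  rw [coef_apply, coef_apply, ← neg_one_smul ℝ, smul_germ, germ_eq_iff]
  exact Filter.Eventually.of_forall fun x => by simp [apply_swap (η.1 x) (bv i)]

theorem SmoothForm.differentiableAt {p : ℕ} (η : SmoothForm d p) :
    ∀ᶠ x in 𝓝 (0 : E d), DifferentiableAt ℝ η.1 x := by
  filter_upwards [η.2] with x hx using hx.differentiableAt (by simp)

theorem extDeriv_one_apply {β : E d → E d [⋀^Fin 1]→L[ℝ] ℝ} {x : E d}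
    (h : DifferentiableAt ℝ β x) (v w : E d) :
    extDeriv β x ![v, w] =
      fderiv ℝ (fun y => β y ![w]) x v - fderiv ℝ (fun y => β y ![v]) x w := by
  rw [extDeriv_apply h]
  have h0 : (0 : Fin 2).removeNth ![v, w] = ![w] := by
    ext k : 1; fin_cases k; rfl
  have h1 : (1 : Fin 2).removeNth ![v, w] = ![v] := by
    ext k : 1; fin_cases k; rfl
  simp [Fin.sum_univ_two, h0, h1, sub_eq_add_neg]

theorem coef_of_eq_add_extDeriv {η α : SmoothForm d 2} {β : SmoothForm d 1}
    (h : ∀ᶠ x in 𝓝 (0 : E d), η.1 x = α.1 x + extDeriv β.1 x) (i j : Fin d) :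
    coef i j η = coef i j α + (pd i (coef₁ β j) - pd j (coef₁ β i)) := by
  rw [coef_apply, coef_apply, coef₁, coef₁, pd_germ, pd_germ, germ_sub, germ_add, germ_eq_iff]
  filter_upwards [h, β.differentiableAt] with x hx hb
  rw [hx, ContinuousAlternatingMap.add_apply, extDeriv_one_apply hb]

/-- The germ of a function that vanishes on `N`. -/
def Van (N : Set (E d)) (r : Gm d) : Prop :=
  ∃ f hf, r = germ f hf ∧ ∀ᶠ x in 𝓝 (0 : E d), x ∈ N → f x = 0

theorem Van.mul_left {N : Set (E d)} {r : Gm d} (s : Gm d) (hr : Van N r) : Van N (s * r) := by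
  obtain ⟨f, hf, rfl, h⟩ := hr
  obtain ⟨g, hg, rfl⟩ := exists_germ s
  refine ⟨_, _, germ_mul _ _, ?_⟩
  filter_upwards [h] with x hx hN
  rw [hx hN, mul_zero]

theorem van_coef {N : Set (E d)} {α : SmoothForm d 2} (h : VanishesOn N α.1) (i j : Fin d) :
    Van N (coef i j α) := by
  refine ⟨_, _, coef_apply _ _ _, ?_⟩
  filter_upwards [h] with x hx hN
  rw [hx hN]; rfl

theorem van_coef₁ {N : Set (E d)} {α : SmoothForm d 1} (h : VanishesOn N α.1) (i : Fin d) :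
    Van N (coef₁ α i) := by
  refine ⟨_, _, rfl, ?_⟩
  filter_upwards [h] with x hx hN
  rw [hx hN]; rfl

theorem dxdx_apply (i j : Fin d) (v : Fin 2 → E d) :
    dxdx i j v = v 0 i * v 1 j - v 0 j * v 1 i := rfl

theorem form_ext {ζ ζ' : E d [⋀^Fin 2]→L[ℝ] ℝ}
    (h : ∀ i j, ζ ![bv i, bv j] = ζ' ![bv i, bv j]) : ζ = ζ' := by
  apply ContinuousAlternatingMap.toAlternatingMap_injective
  refine Module.Basis.ext_alternating (Pi.basisFun ℝ (Fin d)) fun v _ => ?_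
  have hv : (fun i => Pi.basisFun ℝ (Fin d) (v i)) = ![bv (v 0), bv (v 1)] := by
    ext k : 1
    fin_cases k <;> simp
  rw [hv]
  exact h _ _

theorem form_eq_sum (ζ : E d [⋀^Fin 2]→L[ℝ] ℝ) :
    ζ = ∑ i, ∑ j, (2⁻¹ * ζ ![bv i, bv j]) • dxdx i j := by
  refine form_ext fun k l => ?_
  simp only [ContinuousAlternatingMap.sum_apply, ContinuousAlternatingMap.smul_apply, dxdx_apply,
    smul_eq_mul, Matrix.cons_val_zero, Matrix.cons_val_one, mul_sub, Finset.sum_sub_distrib]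
  have h1 : ∀ a b : Fin d, (bv a : E d) b = if b = a then 1 else 0 := fun a b => by
    simp [Pi.single_apply]
  simp only [h1]
  have e1 : ∑ i, ∑ j, 2⁻¹ * ζ ![bv i, bv j] *
      ((if i = k then (1 : ℝ) else 0) * if j = l then 1 else 0) = 2⁻¹ * ζ ![bv k, bv l] := by
    rw [Finset.sum_eq_single k (fun i _ hi => by simp [hi]) (by simp),
      Finset.sum_eq_single l (fun i _ hi => by simp [hi]) (by simp)]
    simp
  have e2 : ∑ i, ∑ j, 2⁻¹ * ζ ![bv i, bv j] *
      ((if j = k then (1 : ℝ) else 0) * if i = l then 1 else 0) = 2⁻¹ * ζ ![bv l, bv k] := by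
    rw [Finset.sum_eq_single l (fun i _ hi => by simp [hi]) (by simp),
      Finset.sum_eq_single k (fun i _ hi => by simp [hi]) (by simp)]
    simp
  rw [e1, e2, apply_swap ζ (bv k)]
  ring

theorem form_apply_eq_sum (ζ : E d [⋀^Fin 2]→L[ℝ] ℝ) (v w : E d) :
    ζ ![v, w] = ∑ i, ∑ j, 2⁻¹ * ζ ![bv i, bv j] * (v i * w j - v j * w i) := by
  conv_lhs => rw [form_eq_sum ζ]
  simp [ContinuousAlternatingMap.sum_apply, dxdx_apply]

/-- A family of `2`-forms is smooth if its coefficients are. -/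
theorem contDiffAt_of_coef {η : E d → E d [⋀^Fin 2]→L[ℝ] ℝ}
    (h : ∀ i j, IsSm fun x => η x ![bv i, bv j]) : ∀ᶠ x in 𝓝 (0 : E d), ContDiffAt ℝ ∞ η x := by
  have h' : ∀ᶠ x in 𝓝 (0 : E d), ∀ i j, ContDiffAt ℝ ∞ (fun x => η x ![bv i, bv j]) x :=
    Filter.eventually_all.2 fun i => Filter.eventually_all.2 fun j => h i j
  filter_upwards [h'] with x hx
  have e : η = fun x => ∑ i, ∑ j, (2⁻¹ * η x ![bv i, bv j]) • dxdx i j :=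
    funext fun x => form_eq_sum _
  rw [e]
  exact ContDiffAt.sum fun i _ => ContDiffAt.sum fun j _ =>
    (contDiffAt_const.mul (hx i j)).smul contDiffAt_const

end

/-! ## Germs vanishing on the curve -/

section
variable {d : ℕ} (hd : 3 ≤ d) {μ : ℕ}

theorem cusp_mem_curve {σ : ℝ} (hσ : σ ^ 2 = 1) (t : ℝ) :
    cusp hd (μ - 3) σ t ∈ curve d hd μ := by
  have n12 := i₁_ne_i₂ hd
  have n13 := i₁_ne_i₃ hd
  have n23 := i₂_ne_i₃ hd
  refine ⟨?_, ?_, fun j hj => ?_⟩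
  · simp only [cusp, Pi.add_apply, Pi.smul_apply, Pi.single_apply, n12.symm, n13, n13.symm, n23,
      smul_eq_mul, if_true, if_false, mul_one, mul_zero, add_zero, zero_add]
    rw [mul_pow, hσ, ← pow_mul, ← pow_mul, mul_comm 2]; ring
  · simp [cusp, n12.symm, n23]
  · obtain ⟨h1, -, h3⟩ := ne_of_three_le hd hj
    simp [cusp, h1, h3]

theorem line_mem_curve (hμ : 5 < μ) {σ : ℝ} (hσ : σ ^ 2 = 1) (t : ℝ) :
    line hd σ t ∈ curve d hd μ := by
  have n12 := i₁_ne_i₂ hd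
  have n13 := i₁_ne_i₃ hd
  have n23 := i₂_ne_i₃ hd
  have hm : μ - 3 ≠ 0 := by omega
  refine ⟨?_, ?_, fun j hj => ?_⟩
  · simp only [line, Pi.add_apply, Pi.smul_apply, Pi.single_apply, n12, n12.symm, n13.symm,
      n23.symm, smul_eq_mul, if_true, if_false, mul_one, mul_zero, add_zero, zero_add, zero_pow hm]
    rw [mul_pow, hσ]; ring
  · simp [line, n13.symm, n23.symm]
  · obtain ⟨h1, h2, h3⟩ := ne_of_three_le hd hj
    simp [line, h1, h2]

theorem tay_eq_zero {N : Set (E d)} {r : Gm d} (hr : Van N r) {γ : ℝ → E d} (hγ : IsCurve γ)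
    (hN : ∀ t, γ t ∈ N) : tay γ hγ r = 0 := by
  obtain ⟨f, hf, rfl, h⟩ := hr
  rw [tay_germ, taylorSeries_congr (g := fun _ => 0), taylorSeries_const, map_zero]
  filter_upwards [hγ.tendsto.eventually h] with t ht using ht (hN t)

theorem Van.flatCusp (hm : μ - 3 ≠ 0) {r : Gm d} (hr : Van (curve d hd μ) r) :
    FlatCusp hd hm r :=
  ⟨tay_eq_zero hr _ fun t => cusp_mem_curve hd (by norm_num) t,
    tay_eq_zero hr _ fun t => cusp_mem_curve hd (by norm_num) t⟩

theorem Van.flatLine (hμ : 5 < μ) {r : Gm d} (hr : Van (curve d hd μ) r) : FlatLine hd r :=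
  ⟨tay_eq_zero hr _ fun t => line_mem_curve hd hμ (by norm_num) t,
    tay_eq_zero hr _ fun t => line_mem_curve hd hμ (by norm_num) t⟩

end

/-! ## Coordinates of algebraic restrictions -/

section
variable {d : ℕ} (hd : 3 ≤ d)

local notation "∂₁" => pd (i₁ d hd)
local notation "∂₂" => pd (i₂ d hd)
local notation "∂₃" => pd (i₃ d hd)

open PowerSeries

/-- The coordinates, with respect to the forms `θ_i`, of the algebraic restriction to `S_μ` of the
closed form `a dx₁∧dx₂ + b dx₁∧dx₃ + c dx₂∧dx₃`. -/
def crd (μ : ℕ) (a b c : Gm d) : ℕ → ℝ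
  | 0 => 0
  | 1 => ev b
  | 2 => ev c
  | 3 => ev a
  | 4 => -ev (∂₁ c)
  | k + 5 => coeff (k + 1) (T hd b) - if k + 5 = μ then ((μ - 3 : ℕ) / 2 : ℝ) * ev (∂₂ a) else 0

theorem crd_add (μ : ℕ) (a b c a' b' c' : Gm d) (i : ℕ) :
    crd hd μ (a + a') (b + b') (c + c') i = crd hd μ a b c i + crd hd μ a' b' c' i := by
  match i with
  | 0 => simp [crd]
  | 1 | 2 | 3 => simp [crd]
  | 4 => simp [crd]; ring
  | k + 5 => simp only [crd, map_add]; split_ifs <;> ring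

theorem crd_smul (μ : ℕ) (t : ℝ) (a b c : Gm d) (i : ℕ) :
    crd hd μ (t • a) (t • b) (t • c) i = t * crd hd μ a b c i := by
  match i with
  | 0 => simp [crd]
  | 1 | 2 | 3 => simp [crd]
  | 4 => simp [crd]
  | k + 5 => simp only [crd, map_smul, Derivation.map_smul, smul_eq_mul]; split_ifs <;> ring

variable {hd} {μ : ℕ}

theorem crd_of_van (hμ : 5 < μ) {a b c : Gm d} (ha : Van (curve d hd μ) a)
    (hb : Van (curve d hd μ) b) (hc : Van (curve d hd μ) c) {i : ℕ} (hi : i ≤ μ) :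
    crd hd μ a b c i = 0 := by
  have hm : μ - 3 ≠ 0 := by omega
  match i with
  | 0 => rfl
  | 1 => exact (hb.flatLine hd hμ).ev_eq_zero
  | 2 => exact (hc.flatLine hd hμ).ev_eq_zero
  | 3 => exact (ha.flatLine hd hμ).ev_eq_zero
  | 4 => simp [crd, (hc.flatLine hd hμ).ev_pd.1]
  | k + 5 =>
    simp only [crd, (ha.flatLine hd hμ).ev_pd.2, mul_zero, ite_self, sub_zero]
    -- The index k + 5 ≤ μ means the exponent k + 1 ≤ m - 1, just below the order m to which a
    -- vanishing germ is zero on the axis.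
    exact X_pow_dvd_iff.1 (hb.flatCusp hd hm).dvd_T_self _ (by omega)

/-- This accounts for the correction by ∂₂a in the last coordinate of `crd`. There ∂₃b₁ contributes
the coefficient of X^m of b₁ on the axis, one degree beyond the range in which a vanishing germ must
vanish. -/
theorem crd_of_extDeriv (hμ : 5 < μ) {b₁ b₂ b₃ : Gm d} (h1 : Van (curve d hd μ) b₁)
    (h2 : Van (curve d hd μ) b₂) (h3 : Van (curve d hd μ) b₃) {i : ℕ} (hi : i ≤ μ) :
    crd hd μ (∂₁ b₂ - ∂₂ b₁) (∂₁ b₃ - ∂₃ b₁) (∂₂ b₃ - ∂₃ b₂) i = 0 := by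
  have hm : μ - 3 ≠ 0 := by omega
  have hT (b : Gm d) (hb : Van (curve d hd μ) b) : ev (∂₃ b) = 0 := by
    rw [← coeff_one_T]
    exact X_pow_dvd_iff.1 (hb.flatCusp hd hm).dvd_T_self _ (by omega)
  have l1 := (h1.flatLine hd hμ)
  have l2 := (h2.flatLine hd hμ)
  have l3 := (h3.flatLine hd hμ)
  match i with
  | 0 => rfl
  | 1 => simp [crd, l3.ev_pd.1, hT b₁ h1]
  | 2 => simp [crd, l3.ev_pd.2, hT b₂ h2]
  | 3 => simp [crd, l2.ev_pd.1, l1.ev_pd.2]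
  | 4 =>
    have : ev (∂₁ (∂₃ b₂)) = 0 := by
      rw [pd_comm, ← coeff_one_T]
      exact X_pow_dvd_iff.1 (h2.flatCusp hd hm).dvd_T_pd _ (by omega)
    simp [crd, l3.ev_pd_pd.1, this]
  | k + 5 =>
    have e1 : coeff (k + 1) (T hd (∂₁ b₃)) = 0 :=
      X_pow_dvd_iff.1 (h3.flatCusp hd hm).dvd_T_pd _ (by omega)
    have e2 : ev (∂₂ (∂₁ b₂)) = 0 := by rw [pd_comm]; exact l2.ev_pd_pd.1
    simp only [crd, map_sub, e1, e2, T_pd_three, coeff_derivative]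
    split_ifs with hk
    -- The arcs give coeff_m(b₁) = -½ ∂₁²b₁(0), and the lines give ∂₁²b₁(0) = -∂₂²b₁(0); the
    -- correction term cancels exactly the resulting multiple of ∂₂²b₁(0).
    · have e3 := X_pow_dvd_iff.1 (h1.flatCusp hd hm).dvd_T (μ - 3) (by omega)
      rw [map_add, mul_assoc, coeff_C_mul, coeff_X_pow_mul', if_pos le_rfl, Nat.sub_self,
        coeff_zero_eq_constantCoeff_apply, constantCoeff_T] at e3
      have e4 := l1.ev_pd_pd.2
      obtain rfl : μ = k + 5 := hk.symm
      rw [show k + 5 - 3 = k + 2 by omega] at *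
      push_cast
      rw [show (k : ℝ) + 2 = k + 1 + 1 by ring]
      rw [show k + 1 + 1 = k + 2 by ring]
      linear_combination (-(k + 2 : ℝ)) * e3 + ((k + 2 : ℝ) / 2) * e4
    · rw [X_pow_dvd_iff.1 (h1.flatCusp hd hm).dvd_T_self _ (by omega)]
      ring

/-- The coordinates of the algebraic restriction of a closed `2`-form. -/
def coords (hd : 3 ≤ d) (μ : ℕ) (η : SmoothForm d 2) : ℕ → ℝ :=
  crd hd μ (coef (i₁ d hd) (i₂ d hd) η) (coef (i₁ d hd) (i₃ d hd) η) (coef (i₂ d hd) (i₃ d hd) η)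

theorem coords_add (η η' : SmoothForm d 2) (i : ℕ) :
    coords hd μ (η + η') i = coords hd μ η i + coords hd μ η' i := by
  simp only [coords, map_add, crd_add]

theorem coords_smul (t : ℝ) (η : SmoothForm d 2) (i : ℕ) :
    coords hd μ (t • η) i = t * coords hd μ η i := by
  simp only [coords, map_smul, crd_smul]

theorem coords_of_mem_zeroRestr (hμ : 5 < μ) {η : SmoothForm d 2}
    (h : η ∈ zeroRestr (curve d hd μ)) {i : ℕ} (hi : i ≤ μ) : coords hd μ η i = 0 := by
  obtain ⟨α, β, h1, h2, h3⟩ := h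
  simp only [coords, coef_of_eq_add_extDeriv h3]
  rw [crd_add, crd_of_van hμ (van_coef h1 _ _) (van_coef h1 _ _) (van_coef h1 _ _) hi,
    crd_of_extDeriv hμ (van_coef₁ h2 _) (van_coef₁ h2 _) (van_coef₁ h2 _) hi, add_zero]

theorem coords_eq_of_restr_eq (hμ : 5 < μ) {η η' : SmoothForm d 2}
    (h : restr (curve d hd μ) η = restr (curve d hd μ) η') {i : ℕ} (hi : i ≤ μ) :
    coords hd μ η i = coords hd μ η' i := by
  have h1 : η - η' ∈ zeroRestr (curve d hd μ) := (Submodule.Quotient.eq _).1 h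
  have h2 := coords_add (hd := hd) (μ := μ) (η - η') η' i
  rw [sub_add_cancel, coords_of_mem_zeroRestr hμ h1 hi, zero_add] at h2
  exact h2

end

end SMu

namespace SMu

/-! ## Relations between algebraic restrictions -/

section
variable {d : ℕ} (N : Set (E d))

theorem restr_congr {η η' : SmoothForm d 2} (h : η.1 =ᶠ[𝓝 0] η'.1) : restr N η = restr N η' := by
  refine (Submodule.Quotient.eq _).2 ⟨η - η', 0, ?_, ?_, ?_⟩
  · filter_upwards [h] with x hx _
    change η.1 x - η'.1 x = 0
    rw [hx, sub_self]
  · exact Filter.Eventually.of_forall fun x _ => rfl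
  · refine Filter.Eventually.of_forall fun x => ?_
    have := extDeriv_smul (x := x) (0 : ℝ) (0 : E d → E d [⋀^Fin 1]→L[ℝ] ℝ)
    simp only [zero_smul] at this
    simp [SmoothForm.zero_val, this]

theorem restr_eq_zero_of_vanishesOn {η : SmoothForm d 2} (h : VanishesOn N η.1) :
    restr N η = 0 := by
  refine (Submodule.Quotient.mk_eq_zero _).2 ⟨η, 0, h, ?_, ?_⟩
  · exact Filter.Eventually.of_forall fun x _ => rfl
  · refine Filter.Eventually.of_forall fun x => ?_
    have := extDeriv_smul (x := x) (0 : ℝ) (0 : E d → E d [⋀^Fin 1]→L[ℝ] ℝ)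
    simp only [zero_smul] at this
    simp [SmoothForm.zero_val, this]

theorem restr_eq_zero_of_eq_extDeriv {η : SmoothForm d 2} {β : SmoothForm d 1}
    (hβ : VanishesOn N β.1) (h : η.1 =ᶠ[𝓝 0] extDeriv β.1) : restr N η = 0 := by
  refine (Submodule.Quotient.mk_eq_zero _).2 ⟨0, β, ?_, hβ, ?_⟩
  · exact Filter.Eventually.of_forall fun x _ => rfl
  · filter_upwards [h] with x hx
    simp [SmoothForm.zero_val, hx]

/-- The form `f dx_i ∧ dx_j`. -/
def sform (f : E d → ℝ) (hf : IsSm f) (i j : Fin d) : SmoothForm d 2 :=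
  ⟨fun x => f x • dxdx i j, by
    filter_upwards [hf] with x hx using hx.smul contDiffAt_const⟩

theorem sform_val (f : E d → ℝ) (hf : IsSm f) (i j : Fin d) :
    (sform f hf i j).1 = fun x => f x • dxdx i j := rfl

/-- The algebraic restriction of `r dx_i ∧ dx_j`. -/
def w (i j : Fin d) : Gm d →ₗ[ℝ] AlgRestr N :=
  -- The map is defined through a chosen representative of the germ; the restriction does not depend
  -- on the choice.
  haveI h : ∀ (f : E d → ℝ) (hf : IsSm f), restr N (sform (exists_germ (germ f hf)).choose
      (exists_germ (germ f hf)).choose_spec.choose i j) = restr N (sform f hf i j) := by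
    intro f hf
    have h := (exists_germ (germ f hf)).choose_spec.choose_spec
    rw [germ_eq_iff] at h
    refine restr_congr N ?_
    filter_upwards [h] with x hx
    simp only [sform_val, hx]
  { toFun := fun r => restr N (sform (exists_germ r).choose (exists_germ r).choose_spec.choose i j)
    map_add' := by
      intro r s
      obtain ⟨f, hf, rfl⟩ := exists_germ r
      obtain ⟨g, hg, rfl⟩ := exists_germ s
      rw [germ_add, h, h, h, ← map_add]
      refine restr_congr N (Filter.Eventually.of_forall fun x => ?_)
      simp [sform_val, SmoothForm.add_val, add_smul]
    map_smul' := by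
      intro c r
      obtain ⟨f, hf, rfl⟩ := exists_germ r
      rw [smul_germ, h, h, RingHom.id_apply, ← map_smul]
      refine restr_congr N (Filter.Eventually.of_forall fun x => ?_)
      simp [sform_val, SmoothForm.smul_val, mul_smul] }

theorem w_germ (i j : Fin d) (f : E d → ℝ) (hf : IsSm f) :
    w N i j (germ f hf) = restr N (sform f hf i j) := by
  have h := (exists_germ (germ f hf)).choose_spec.choose_spec
  rw [germ_eq_iff] at h
  refine restr_congr N ?_
  filter_upwards [h] with x hx
  simp only [sform_val, hx]

theorem w_van (i j : Fin d) {r : Gm d} (hr : Van N r) : w N i j r = 0 := by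
  obtain ⟨f, hf, rfl, h⟩ := hr
  rw [w_germ]
  refine restr_eq_zero_of_vanishesOn N ?_
  filter_upwards [h] with x hx hN
  rw [sform_val]
  simp [hx hN]

theorem dxdx_swap (i j : Fin d) : dxdx j i = -dxdx i j := by
  ext v
  simp [dxdx_apply]

theorem w_swap (i j : Fin d) (r : Gm d) : w N j i r = -w N i j r := by
  obtain ⟨f, hf, rfl⟩ := exists_germ r
  rw [w_germ, w_germ, ← neg_one_smul ℝ, ← map_smul]
  refine restr_congr N (Filter.Eventually.of_forall fun x => ?_)
  simp only [sform_val, dxdx_swap i j, smul_neg, neg_smul, one_smul]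
  rfl

theorem w_self (i : Fin d) (r : Gm d) : w N i i r = 0 := by
  obtain ⟨f, hf, rfl⟩ := exists_germ r
  rw [w_germ]
  refine restr_eq_zero_of_vanishesOn N (Filter.Eventually.of_forall fun x _ => ?_)
  rw [sform_val]
  ext v
  simp [dxdx_apply]

/-- The coercion of forms to functions, as a linear map. -/
def SmoothForm.valₗ (d p : ℕ) : SmoothForm d p →ₗ[ℝ] (E d → E d [⋀^Fin p]→L[ℝ] ℝ) :=
  (smoothForms d p).subtype

theorem SmoothForm.sum_val {ι : Type*} {p : ℕ} (s : Finset ι) (η : ι → SmoothForm d p) :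
    (∑ i ∈ s, η i).1 = ∑ i ∈ s, (η i).1 :=
  map_sum (SmoothForm.valₗ d p) η s

theorem restr_eq_sum (η : SmoothForm d 2) :
    restr N η = ∑ i, ∑ j, w N i j ((2⁻¹ : ℝ) • coef i j η) := by
  simp only [coef_apply, smul_germ, w_germ, ← map_sum]
  refine restr_congr N (Filter.Eventually.of_forall fun x => ?_)
  simp only [SmoothForm.sum_val, Finset.sum_apply, sform_val]
  exact form_eq_sum _

/-- The form `dx_i`. -/
def dxi (i : Fin d) : E d [⋀^Fin 1]→L[ℝ] ℝ where
  toFun v := v 0 i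
  map_update_add' := by
    intro _ m k x y
    fin_cases k; simp
  map_update_smul' := by
    intro _ m k c x
    fin_cases k; simp
  cont := by fun_prop
  map_eq_zero_of_eq' := by
    intro v k l _ hne
    exact absurd (Subsingleton.elim k l) hne

theorem dxi_apply (i : Fin d) (v : Fin 1 → E d) : dxi i v = v 0 i := rfl

/-- The form `f dx_i`. -/
def sform₁ (f : E d → ℝ) (hf : IsSm f) (i : Fin d) : SmoothForm d 1 :=
  ⟨fun x => f x • dxi i, by filter_upwards [hf] with x hx using hx.smul contDiffAt_const⟩

theorem coef₁_sform₁ (f : E d → ℝ) (hf : IsSm f) (i j : Fin d) :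
    coef₁ (sform₁ f hf i) j = if j = i then germ f hf else 0 := by
  have h : ∀ x, (sform₁ f hf i).1 x ![bv j] = if j = i then f x else 0 := fun x => by
    simp [sform₁, dxi_apply, Pi.single_apply, eq_comm]
  rw [coef₁]
  split_ifs with hij
  · exact germ_eq_iff.2 (Filter.Eventually.of_forall fun x => by simp only [h, if_pos hij])
  · rw [← germ_zero]
    exact germ_eq_iff.2 (Filter.Eventually.of_forall fun x => by simp only [h, if_neg hij])

/-- The exterior derivative of a `1`-form. -/
def dForm (β : SmoothForm d 1) : SmoothForm d 2 :=
  ⟨extDeriv β.1, by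
    refine contDiffAt_of_coef fun i j => ?_
    have h := ((isSm_form_apply β ![bv j]).fderiv_apply (bv i)).sub
      ((isSm_form_apply β ![bv i]).fderiv_apply (bv j))
    filter_upwards [h, β.differentiableAt.eventually_nhds] with x hx hb
    refine hx.congr_of_eventuallyEq ?_
    filter_upwards [hb] with y hy
    rw [extDeriv_one_apply hy]⟩

theorem coef_dForm (β : SmoothForm d 1) (i j : Fin d) :
    coef i j (dForm β) = pd i (coef₁ β j) - pd j (coef₁ β i) := by
  have := coef_of_eq_add_extDeriv (η := dForm β) (α := 0) (β := β)
    (Filter.Eventually.of_forall fun x => by simp [dForm, SmoothForm.zero_val]) i j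
  rwa [map_zero, zero_add] at this

/-- The relation `[b dh ∧ dx_i]_N = 0` for `h` vanishing on `N`. -/
theorem sum_w_pd {h : Gm d} (hh : Van N h) (b : Gm d) (i : Fin d) :
    ∑ k, w N k i (b * pd k h) = 0 := by
  obtain ⟨f, hf, hbh, hfN⟩ := hh.mul_left b
  -- Here f represents b h, so the form is d(b h dx_i) = b dh ∧ dx_i + h db ∧ dx_i, and the second
  -- summand vanishes on N.
  have h1 : restr N (dForm (sform₁ f hf i)) = 0 := by
    refine restr_eq_zero_of_eq_extDeriv N (β := sform₁ f hf i) ?_ (Filter.EventuallyEq.refl _ _)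
    filter_upwards [hfN] with x hx hN
    simp [sform₁, hx hN]
  rw [restr_eq_sum] at h1
  simp only [coef_dForm, coef₁_sform₁, smul_sub, map_sub, Finset.sum_sub_distrib] at h1
  -- The sum runs over ordered pairs. The two halves of the exterior derivative contribute equally,
  -- which cancels the factors 1/2.
  rw [Finset.sum_comm (f := fun k l => w N k l _)] at h1
  have e1 : ∀ l, ∑ k, w N k l ((2⁻¹ : ℝ) • pd k (if l = i then germ f hf else 0)) =
      if l = i then ∑ k, w N k i ((2⁻¹ : ℝ) • pd k (germ f hf)) else 0 := by
    intro l
    split_ifs with hl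
    · rw [hl]
    · simp
  have e2 : ∀ k, ∑ l, w N k l ((2⁻¹ : ℝ) • pd l (if k = i then germ f hf else 0)) =
      if k = i then -∑ l, w N l i ((2⁻¹ : ℝ) • pd l (germ f hf)) else 0 := by
    intro k
    split_ifs with hk
    · rw [hk, ← Finset.sum_neg_distrib]
      exact Finset.sum_congr rfl fun l _ => w_swap N l i _
    · simp
  simp only [e1] at h1
  rw [Finset.sum_congr rfl fun k _ => e2 k] at h1
  simp only [Finset.sum_ite_eq', Finset.mem_univ, if_true, sub_neg_eq_add,
    ← Finset.sum_add_distrib, ← map_add, ← add_smul] at h1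
  norm_num at h1
  rw [← hbh] at h1
  simp only [Derivation.leibniz, smul_eq_mul, map_add, Finset.sum_add_distrib] at h1
  have e3 : ∑ k, w N k i (h * pd k b) = 0 :=
    Finset.sum_eq_zero fun k _ => w_van N k i (by rw [mul_comm]; exact hh.mul_left _)
  rwa [e3, add_zero] at h1

end

/-! ### The relations on S_μ and the reduction to finitely many derivatives at 0. -/

section
variable {d : ℕ} (hd : 3 ≤ d) (μ : ℕ)

local notation "x₁" => coord (i₁ d hd)
local notation "x₂" => coord (i₂ d hd)
local notation "x₃" => coord (i₃ d hd)
local notation "∂₁" => pd (i₁ d hd)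
local notation "∂₂" => pd (i₂ d hd)
local notation "∂₃" => pd (i₃ d hd)
local notation "w₁₂" => w (curve d hd μ) (i₁ d hd) (i₂ d hd)
local notation "w₁₃" => w (curve d hd μ) (i₁ d hd) (i₃ d hd)
local notation "w₂₃" => w (curve d hd μ) (i₂ d hd) (i₃ d hd)

theorem van_x₂x₃ : Van (curve d hd μ) (x₂ * x₃) :=
  ⟨_, _, rfl, Filter.Eventually.of_forall fun _ hx => hx.2.1⟩

theorem van_quadric : Van (curve d hd μ) (x₁ ^ 2 - x₂ ^ 2 - x₃ ^ (μ - 3)) :=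
  ⟨_, _, rfl, Filter.Eventually.of_forall fun _ hx => hx.1⟩

theorem van_coord {j : Fin d} (hj : 3 ≤ (j : ℕ)) : Van (curve d hd μ) (coord j) :=
  ⟨_, _, rfl, Filter.Eventually.of_forall fun _ hx => hx.2.2 j hj⟩

theorem w_rest_left {j : Fin d} (hj : 3 ≤ (j : ℕ)) (i : Fin d) (r : Gm d) :
    w (curve d hd μ) j i r = 0 := by
  have h := sum_w_pd _ (van_coord hd μ hj) r i
  rw [Finset.sum_eq_single j (fun k _ hk => by simp [pd_coord, hk]) (by simp)] at h
  simpa [pd_coord] using h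

theorem w_rest_right {j : Fin d} (hj : 3 ≤ (j : ℕ)) (i : Fin d) (r : Gm d) :
    w (curve d hd μ) i j r = 0 := by
  rw [w_swap, w_rest_left hd μ hj, neg_zero]

theorem sum_w_eq (i : Fin d) (f : Fin d → Gm d) :
    ∑ k, w (curve d hd μ) k i (f k) = w (curve d hd μ) (i₁ d hd) i (f (i₁ d hd)) +
      w (curve d hd μ) (i₂ d hd) i (f (i₂ d hd)) + w (curve d hd μ) (i₃ d hd) i (f (i₃ d hd)) := by
  rw [sum_fin_eq hd, Finset.sum_eq_zero (s := Finset.univ.filter _) fun k hk =>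
    w_rest_left hd μ (Finset.mem_filter.1 hk).2 i _, add_zero]

theorem restr_eq_three (η : SmoothForm d 2) : restr (curve d hd μ) η =
    w₁₂ (coef (i₁ d hd) (i₂ d hd) η) + w₁₃ (coef (i₁ d hd) (i₃ d hd) η) +
      w₂₃ (coef (i₂ d hd) (i₃ d hd) η) := by
  rw [restr_eq_sum, Finset.sum_comm]
  simp only [sum_w_eq]
  rw [sum_fin_eq hd, Finset.sum_eq_zero (s := Finset.univ.filter _) fun k hk => by
    simp only [w_rest_right hd μ (Finset.mem_filter.1 hk).2, add_zero]]
  simp only [w_self, w_swap _ (i₁ d hd) (i₂ d hd), w_swap _ (i₁ d hd) (i₃ d hd),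
    w_swap _ (i₂ d hd) (i₃ d hd), coef_swap (i₁ d hd) (i₂ d hd), coef_swap (i₁ d hd) (i₃ d hd),
    coef_swap (i₂ d hd) (i₃ d hd), map_smul, map_neg]
  module

/-- Wedging d(x₂x₃) with dx₁, dx₂ and dx₃ yields this relation and the next two. -/
theorem w₁₂_x₃ (b : Gm d) : w₁₂ (x₃ * b) = -w₁₃ (x₂ * b) := by
  have h := sum_w_pd _ (van_x₂x₃ hd μ) b (i₁ d hd)
  rw [sum_w_eq] at h
  simp only [w_self, Derivation.leibniz, pd_coord, i₁_ne_i₂, i₁_ne_i₃, i₂_ne_i₃,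
    (i₂_ne_i₃ hd).symm, smul_eq_mul, w_swap _ (i₁ d hd) (i₂ d hd),
    w_swap _ (i₁ d hd) (i₃ d hd), if_true, if_false, mul_one, mul_zero, add_zero, zero_add] at h
  rw [mul_comm x₃, mul_comm x₂]
  rw [← sub_eq_zero, ← neg_eq_zero, ← h]
  abel

theorem w₂₃_x₂ (b : Gm d) : w₂₃ (x₂ * b) = 0 := by
  have h := sum_w_pd _ (van_x₂x₃ hd μ) b (i₂ d hd)
  rw [sum_w_eq] at h
  simp only [w_self, Derivation.leibniz, pd_coord, i₁_ne_i₂, i₁_ne_i₃, i₂_ne_i₃,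
    (i₂_ne_i₃ hd).symm, smul_eq_mul, w_swap _ (i₂ d hd) (i₃ d hd), map_zero,
    if_true, if_false, mul_one, mul_zero, add_zero, zero_add, neg_eq_zero] at h
  rw [mul_comm x₂, h]

theorem w₂₃_x₃ (b : Gm d) : w₂₃ (x₃ * b) = 0 := by
  have h := sum_w_pd _ (van_x₂x₃ hd μ) b (i₃ d hd)
  rw [sum_w_eq] at h
  simp only [w_self, Derivation.leibniz, pd_coord, i₁_ne_i₂, i₁_ne_i₃, i₂_ne_i₃,
    (i₂_ne_i₃ hd).symm, smul_eq_mul, map_zero,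
    if_true, if_false, mul_one, mul_zero, add_zero, zero_add] at h
  rw [mul_comm x₃, h]

theorem pd_quadric₁ : ∂₁ (x₁ ^ 2 - x₂ ^ 2 - x₃ ^ (μ - 3)) = 2 * x₁ := by
  simp [pd_coord, Derivation.leibniz_pow, i₁_ne_i₂, i₁_ne_i₃]

theorem pd_quadric₂ : ∂₂ (x₁ ^ 2 - x₂ ^ 2 - x₃ ^ (μ - 3)) = -(2 * x₂) := by
  simp [pd_coord, Derivation.leibniz_pow, (i₁_ne_i₂ hd).symm, i₂_ne_i₃]

theorem pd_quadric₃ : ∂₃ (x₁ ^ 2 - x₂ ^ 2 - x₃ ^ (μ - 3)) =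
    -((μ - 3 : ℕ) • x₃ ^ (μ - 4)) := by
  simp [pd_coord, Derivation.leibniz_pow, (i₁_ne_i₃ hd).symm, (i₂_ne_i₃ hd).symm,
    Nat.sub_sub]

variable {μ}

/-- Wedging the differential of the quadric with dx₁, dx₂ and dx₃ yields this relation and the next
two. In the case of dx₂ the term with x₃^(m-1) disappears because m > 1 and multiples of x₃ dx₂∧dx₃
are already zero. -/
theorem w₁₂_x₂ (b : Gm d) :
    w₁₂ (x₂ * b) = -((μ - 3 : ℕ) / 2 : ℝ) • w₁₃ (x₃ ^ (μ - 4) * b) := by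
  have h := sum_w_pd _ (van_quadric hd μ) b (i₁ d hd)
  rw [sum_w_eq, pd_quadric₁, pd_quadric₂, pd_quadric₃, w_self,
    w_swap _ (i₁ d hd) (i₂ d hd), w_swap _ (i₁ d hd) (i₃ d hd),
    show b * -(2 * x₂) = (-2 : ℝ) • (x₂ * b) by
      rw [Algebra.smul_def, map_neg, map_ofNat]; ring,
    show b * -((μ - 3 : ℕ) • x₃ ^ (μ - 4)) = (-(μ - 3 : ℕ) : ℝ) • (x₃ ^ (μ - 4) * b) by
      rw [nsmul_eq_mul, Algebra.smul_def, map_neg, map_natCast]; ring, map_smul, map_smul] at h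
  have h2 : w₁₂ (x₂ * b) + ((μ - 3 : ℕ) / 2 : ℝ) • w₁₃ (x₃ ^ (μ - 4) * b) =
    (2⁻¹ : ℝ) • (0 + -((-2 : ℝ) • w₁₂ (x₂ * b)) +
      -((-(μ - 3 : ℕ) : ℝ) • w₁₃ (x₃ ^ (μ - 4) * b))) := by module
  rw [h, smul_zero] at h2
  rw [eq_neg_of_add_eq_zero_left h2, neg_smul]

theorem w₁₂_x₁ (hμ : 5 < μ) (b : Gm d) : w₁₂ (x₁ * b) = 0 := by
  have h := sum_w_pd _ (van_quadric hd μ) b (i₂ d hd)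
  obtain ⟨k, rfl⟩ : ∃ k, μ = k + 5 := ⟨μ - 5, by omega⟩
  rw [sum_w_eq, pd_quadric₁, pd_quadric₂, pd_quadric₃, w_self,
    w_swap _ (i₂ d hd) (i₃ d hd),
    show b * (2 * x₁) = (2 : ℝ) • (x₁ * b) by
      rw [Algebra.smul_def, map_ofNat]; ring,
    show b * -((k + 5 - 3 : ℕ) • x₃ ^ (k + 5 - 4)) =
        x₃ * (-((k + 5 - 3 : ℕ) • x₃ ^ k) * b) by
      rw [show k + 5 - 4 = k + 1 by omega]
      simp only [nsmul_eq_mul]; ring, w₂₃_x₃, map_smul] at h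
  simpa using h

theorem w₁₃_x₁ (b : Gm d) : w₁₃ (x₁ * b) = 0 := by
  have h := sum_w_pd _ (van_quadric hd μ) b (i₃ d hd)
  rw [sum_w_eq, pd_quadric₁, pd_quadric₂, pd_quadric₃, w_self,
    show b * (2 * x₁) = (2 : ℝ) • (x₁ * b) by
      rw [Algebra.smul_def, map_ofNat]; ring,
    show b * -(2 * x₂) = x₂ * (-2 * b) by ring, w₂₃_x₂, map_smul] at h
  simpa using h

theorem w₁₃_x₂x₃ (b : Gm d) : w₁₃ (x₂ * x₃ * b) = 0 :=
  w_van _ _ _ (by rw [mul_comm]; exact (van_x₂x₃ hd μ).mul_left b)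

/-- On the curve x₃^m = x₁² - x₂². Multiples of x₁ dx₁∧dx₃ are zero, and x₂² dx₁∧dx₃ becomes -x₂x₃
dx₁∧dx₂, which vanishes on the curve. -/
theorem w₁₃_x₃_pow (b : Gm d) : w₁₃ (x₃ ^ (μ - 3) * b) = 0 := by
  have h := w_van _ (i₁ d hd) (i₃ d hd) ((van_quadric hd μ).mul_left b)
  have e : b * (x₁ ^ 2 - x₂ ^ 2 - x₃ ^ (μ - 3)) =
    x₁ * (x₁ * b) - x₂ * (x₂ * b) - x₃ ^ (μ - 3) * b := by ring
  have e2 : w₁₃ (x₂ * (x₂ * b)) = 0 := by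
    have := w₁₂_x₃ hd μ (x₂ * b)
    rw [eq_comm, neg_eq_iff_eq_neg] at this
    rw [this, neg_eq_zero]
    exact w_van _ _ _ (by
      rw [show x₃ * (x₂ * b) = b * (x₂ * x₃) by ring]; exact (van_x₂x₃ hd μ).mul_left b)
  rw [e, map_sub, map_sub, w₁₃_x₁, e2] at h
  simpa using h

theorem mul_mem_rest {b s : Gm d} (hs : s ∈ restIdeal d) (i j : Fin d) :
    w (curve d hd μ) i j (b * s) = 0 := by
  have h : ∀ b : Gm d, Van (curve d hd μ) (b * s) := by
    induction hs using Submodule.span_induction with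
    | mem x h => obtain ⟨j, hj, rfl⟩ := h; exact fun b => (van_coord hd μ hj).mul_left b
    | zero =>
      intro b
      rw [mul_zero, ← germ_zero]
      exact ⟨_, _, rfl, Filter.Eventually.of_forall fun _ _ => rfl⟩
    | add x y _ _ hx hy =>
      intro b
      obtain ⟨f, hf, h1, h2⟩ := hx b
      obtain ⟨g, hg, h3, h4⟩ := hy b
      refine ⟨_, hf.add hg, by rw [mul_add, h1, h3, germ_add], ?_⟩
      filter_upwards [h2, h4] with x h5 h6 hN
      rw [h5 hN, h6 hN, add_zero]
    | smul a x _ h => intro b; rw [smul_eq_mul, ← mul_assoc]; exact h _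
  exact w_van _ _ _ (h b)

theorem ev_pd_of_hadamard {r q₁ q₂ q₃ s : Gm d} (hs : s ∈ restIdeal d)
    (hr : r = algebraMap ℝ (Gm d) (ev r) + x₁ * q₁ + x₂ * q₂ + x₃ * q₃ + s) :
    ev (∂₁ r) = ev q₁ ∧ ev (∂₂ r) = ev q₂ ∧ ev (∂₃ r) = ev q₃ := by
  have hs1 : ∂₁ s ∈ restIdeal d := pd_mem_restIdeal (by simp [i₁]) hs
  have hs2 : ∂₂ s ∈ restIdeal d := pd_mem_restIdeal (by simp [i₂]) hs
  have hs3 : ∂₃ s ∈ restIdeal d := pd_mem_restIdeal (by simp [i₃]) hs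
  have n12 := i₁_ne_i₂ hd
  have n13 := i₁_ne_i₃ hd
  have n23 := i₂_ne_i₃ hd
  refine ⟨?_, ?_, ?_⟩
  all_goals
    conv_lhs => rw [hr]
    simp [ev_restIdeal hs1, ev_restIdeal hs2, ev_restIdeal hs3, n12, n12.symm, n13, n13.symm, n23,
      n23.symm, pd_coord]

/-- By Hadamard's lemma it is enough that x₁x₂, x₂², x₂x₃ and the coordinates x_j with j ≥ 4 all
annihilate dx₁∧dx₃. -/
theorem w₁₃_x₂ (b : Gm d) : w₁₃ (x₂ * b) = ev b • w₁₃ x₂ := by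
  obtain ⟨q₁, q₂, q₃, s, hs, hr⟩ := exists_hadamard hd b
  have e2 : w₁₃ (x₂ * (x₂ * q₂)) = 0 := by
    have := w₁₂_x₃ hd μ (x₂ * q₂)
    rw [eq_comm, neg_eq_iff_eq_neg] at this
    rw [this, neg_eq_zero]
    exact w_van _ _ _ (by
      rw [show x₃ * (x₂ * q₂) = q₂ * (x₂ * x₃) by ring]; exact (van_x₂x₃ hd μ).mul_left q₂)
  have e : x₂ * b = ev b • x₂ + x₁ * (x₂ * q₁) + x₂ * (x₂ * q₂) + x₂ * x₃ * q₃ + x₂ * s := by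
    conv_lhs => rw [hr]
    rw [Algebra.smul_def]; ring
  rw [e, map_add, map_add, map_add, map_add, w₁₃_x₁, e2, w₁₃_x₂x₃, mul_mem_rest hd hs, map_smul]
  simp

/-- Both x₂ and x₃ annihilate dx₂∧dx₃, hence so does x₁² = x₂² + x₃^m on the curve; only the 1-jet
of b in x₁ is left. -/
theorem w₂₃_eq (hμ : 5 < μ) (b : Gm d) : w₂₃ b = ev b • w₂₃ 1 + ev (∂₁ b) • w₂₃ x₁ := by
  obtain ⟨q₁, q₂, q₃, s, hs, hr⟩ := exists_hadamard hd b
  obtain ⟨p₁, p₂, p₃, s', hs', hr'⟩ := exists_hadamard hd q₁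
  have hsq : w₂₃ (x₁ * (x₁ * p₁)) = 0 := by
    have h := w_van _ (i₂ d hd) (i₃ d hd) ((van_quadric hd μ).mul_left p₁)
    obtain ⟨k, hk⟩ : ∃ k, μ - 3 = k + 1 := ⟨μ - 4, by omega⟩
    have e : p₁ * (x₁ ^ 2 - x₂ ^ 2 - x₃ ^ (μ - 3)) =
      x₁ * (x₁ * p₁) - x₂ * (x₂ * p₁) - x₃ * (x₃ ^ k * p₁) := by rw [hk]; ring
    rw [e, map_sub, map_sub, w₂₃_x₂, w₂₃_x₃] at h
    simpa using h
  have e : b = ev b • 1 + ev q₁ • x₁ + x₁ * (x₁ * p₁) + x₂ * (x₁ * p₂) + x₃ * (x₁ * p₃) +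
      x₁ * s' + x₂ * q₂ + x₃ * q₃ + 1 * s := by
    conv_lhs => rw [hr, hr']
    simp only [Algebra.smul_def]; ring
  rw [(ev_pd_of_hadamard hd hs hr).1]
  conv_lhs => rw [e]
  simp only [map_add, map_smul, hsq, w₂₃_x₂, w₂₃_x₃, mul_mem_rest hd hs, mul_mem_rest hd hs',
    add_zero]

/-- Powers of x₃ are split off one at a time by Hadamard's lemma. The remainder r carries the
shifted Taylor coefficients of b on the axis, so that the induction can continue; for n + 1 = m its
term vanishes by `w₁₃_x₃_pow`. -/
theorem w₁₃_expand (n : ℕ) (b : Gm d) : ∃ r : Gm d,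
    (∀ k, PowerSeries.coeff (k + (n + 1)) (T hd b) = PowerSeries.coeff k (T hd r)) ∧
    w₁₃ b = ∑ k ∈ Finset.range (n + 1), PowerSeries.coeff k (T hd b) • w₁₃ (x₃ ^ k) +
      ev (∂₂ b) • w₁₃ x₂ + w₁₃ (x₃ ^ (n + 1) * r) := by
  have hT {r q₁ q₂ q₃ s : Gm d} (hs : s ∈ restIdeal d)
      (hr : r = algebraMap ℝ (Gm d) (ev r) + x₁ * q₁ + x₂ * q₂ + x₃ * q₃ + s) :
      T hd r = PowerSeries.C (ev r) + PowerSeries.X * T hd q₃ := by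
    conv_lhs => rw [hr]
    simp [T_coord, T_restIdeal hd hs, i₁_ne_i₃, i₂_ne_i₃, AlgHom.commutes]
  induction n with
  | zero =>
    obtain ⟨q₁, q₂, q₃, s, hs, hr⟩ := exists_hadamard hd b
    refine ⟨q₃, fun k => ?_, ?_⟩
    · rw [hT hs hr, map_add, PowerSeries.coeff_succ_X_mul, PowerSeries.coeff_C,
        if_neg (by omega), zero_add]
    · have e : b = ev b • 1 + x₁ * q₁ + x₂ * q₂ + x₃ * q₃ + 1 * s := by
        conv_lhs => rw [hr]
        rw [Algebra.smul_def]; ring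
      rw [(ev_pd_of_hadamard hd hs hr).2.1]
      conv_lhs => rw [e]
      simp [map_add, map_smul, mul_mem_rest hd hs, w₁₃_x₁, w₁₃_x₂ hd q₂, constantCoeff_T,
        - one_mul]
  | succ n ih =>
    obtain ⟨r, h1, h2⟩ := ih
    obtain ⟨q₁, q₂, q₃, s, hs, hr⟩ := exists_hadamard hd r
    refine ⟨q₃, fun k => ?_, ?_⟩
    · rw [← add_assoc, add_right_comm, h1, hT hs hr, map_add, PowerSeries.coeff_succ_X_mul,
        PowerSeries.coeff_C, if_neg (by omega), zero_add]
    · have e : x₃ ^ (n + 1) * r = ev r • x₃ ^ (n + 1) + x₁ * (x₃ ^ (n + 1) * q₁) +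
          x₂ * x₃ * (x₃ ^ n * q₂) + x₃ ^ (n + 1 + 1) * q₃ + x₃ ^ (n + 1) * s := by
        conv_lhs => rw [hr]
        rw [Algebra.smul_def]; ring
      have h3 : PowerSeries.coeff (n + 1) (T hd b) = ev r := by
        have := h1 0
        rwa [zero_add, PowerSeries.coeff_zero_eq_constantCoeff_apply, constantCoeff_T] at this
      rw [h2, Finset.sum_range_succ _ (n + 1), h3, e]
      simp only [map_add, map_smul, mul_mem_rest hd hs, w₁₃_x₁, w₁₃_x₂x₃, add_zero]
      abel

/-- The algebraic restriction of a `2`-form in terms of finitely many derivatives of its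
coefficients. -/
theorem restr_eq (hμ : 5 < μ) (η : SmoothForm d 2) : restr (curve d hd μ) η =
    ∑ k ∈ Finset.range (μ - 3),
        PowerSeries.coeff k (T hd (coef (i₁ d hd) (i₃ d hd) η)) • w₁₃ (x₃ ^ k) +
      (ev (∂₂ (coef (i₁ d hd) (i₃ d hd) η)) - ev (∂₃ (coef (i₁ d hd) (i₂ d hd) η))) • w₁₃ x₂ +
      ev (coef (i₁ d hd) (i₂ d hd) η) • w₁₂ 1 -
      (((μ - 3 : ℕ) / 2 : ℝ) * ev (∂₂ (coef (i₁ d hd) (i₂ d hd) η))) • w₁₃ (x₃ ^ (μ - 4)) +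
      ev (coef (i₂ d hd) (i₃ d hd) η) • w₂₃ 1 +
      ev (∂₁ (coef (i₂ d hd) (i₃ d hd) η)) • w₂₃ x₁ := by
  rw [restr_eq_three, w₂₃_eq hd hμ]
  set a := coef (i₁ d hd) (i₂ d hd) η
  set b := coef (i₁ d hd) (i₃ d hd) η
  obtain ⟨r, -, h2⟩ := w₁₃_expand hd (μ := μ) (μ - 4) b
  rw [show μ - 4 + 1 = μ - 3 by omega, w₁₃_x₃_pow, add_zero] at h2
  have h4 (q : Gm d) : w₁₃ (x₃ ^ (μ - 4) * q) = ev q • w₁₃ (x₃ ^ (μ - 4)) := by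
    obtain ⟨q₁, q₂, q₃, s, hs, hr⟩ := exists_hadamard hd q
    have e : x₃ ^ (μ - 4) * q = ev q • x₃ ^ (μ - 4) + x₁ * (x₃ ^ (μ - 4) * q₁) +
        x₂ * x₃ * (x₃ ^ (μ - 5) * q₂) + x₃ ^ (μ - 3) * q₃ + x₃ ^ (μ - 4) * s := by
      conv_lhs => rw [hr]
      rw [Algebra.smul_def, show μ - 3 = μ - 5 + 2 by omega, show μ - 4 = μ - 5 + 1 by omega]
      ring
    rw [e]
    simp only [map_add, map_smul, mul_mem_rest hd hs, w₁₃_x₁, w₁₃_x₂x₃, w₁₃_x₃_pow, add_zero]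
  have h5 : w₁₂ a = ev a • w₁₂ 1 - (((μ - 3 : ℕ) / 2 : ℝ) * ev (∂₂ a)) • w₁₃ (x₃ ^ (μ - 4)) -
      ev (∂₃ a) • w₁₃ x₂ := by
    obtain ⟨q₁, q₂, q₃, s, hs, hr⟩ := exists_hadamard hd a
    obtain ⟨-, e2, e3⟩ := ev_pd_of_hadamard hd hs hr
    have e : a = ev a • 1 + x₁ * q₁ + x₂ * q₂ + x₃ * q₃ + 1 * s := by
      conv_lhs => rw [hr]
      rw [Algebra.smul_def]; ring
    rw [e2, e3]
    conv_lhs => rw [e]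
    simp only [map_add, map_smul, mul_mem_rest hd hs, w₁₂_x₁ hd hμ, w₁₂_x₂, w₁₂_x₃, w₁₃_x₂, h4]
    module
  rw [h5, h2]
  module

end

end SMu

namespace SMu

/-! ## The basis `θ₁, …, θ_μ` -/

section
variable {d : ℕ} (hd : 3 ≤ d)

local notation "x₁" => coord (i₁ d hd)
local notation "x₂" => coord (i₂ d hd)
local notation "x₃" => coord (i₃ d hd)
local notation "∂₁" => pd (i₁ d hd)
local notation "∂₂" => pd (i₂ d hd)
local notation "∂₃" => pd (i₃ d hd)

/-- The coefficient of `dx₁ ∧ dx₂` in `θ_i`. -/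
def thetaCoef₁₂ : ℕ → Gm d
  | 3 => 1
  | 4 => x₃
  | _ => 0

/-- The coefficient of `dx₁ ∧ dx₃` in `θ_i`. -/
def thetaCoef₁₃ : ℕ → Gm d
  | 1 => 1
  | k + 5 => x₃ ^ (k + 1)
  | _ => 0

/-- The coefficient of `dx₂ ∧ dx₃` in `θ_i`. -/
def thetaCoef₂₃ : ℕ → Gm d
  | 2 => 1
  | 4 => -x₁
  | _ => 0

theorem germ_eq_of_forall {f g : E d → ℝ} (hf : IsSm f) (hg : IsSm g) (h : ∀ x, f x = g x) :
    germ f hf = germ g hg := germ_eq_iff.2 (Filter.Eventually.of_forall h)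

theorem coef_theta (i : ℕ) : coef (i₁ d hd) (i₂ d hd) (theta d hd i) = thetaCoef₁₂ hd i ∧
    coef (i₁ d hd) (i₃ d hd) (theta d hd i) = thetaCoef₁₃ hd i ∧
    coef (i₂ d hd) (i₃ d hd) (theta d hd i) = thetaCoef₂₃ hd i := by
  have n12 := i₁_ne_i₂ hd
  have n13 := i₁_ne_i₃ hd
  have n23 := i₂_ne_i₃ hd
  have h1 : (1 : Gm d) = germ (fun _ => 1) (isSm_const 1) := rfl
  have h0 : (0 : Gm d) = germ (fun _ => 0) (isSm_const 0) := rfl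
  have hx : -x₁ = germ (fun x => -1 * x (i₁ d hd)) ((isSm_const (-1)).mul (isSm_coord _)) := by
    rw [← neg_one_smul ℝ, coord, smul_germ]
  have hp (k : ℕ) : x₃ ^ (k + 1) = germ (fun x => x (i₃ d hd) ^ (k + 1)) ((isSm_coord _).pow _) :=
    rfl
  have hc : x₃ = germ (fun x => x (i₃ d hd)) (isSm_coord _) := rfl
  match i with
  | 0 =>
    refine ⟨?_, ?_, ?_⟩ <;> simp only [thetaCoef₁₂, thetaCoef₁₃, thetaCoef₂₃, coef_apply, h0] <;>
      exact germ_eq_of_forall _ _ fun x => rfl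
  | 1 | 2 | 3 =>
    refine ⟨?_, ?_, ?_⟩ <;>
      simp only [thetaCoef₁₂, thetaCoef₁₃, thetaCoef₂₃, coef_apply, h0, h1] <;>
      refine germ_eq_of_forall _ _ fun x => ?_ <;>
      simp [theta, thetaFun, dxdx_apply, n12, n12.symm, n13, n13.symm, n23, n23.symm]
  | 4 =>
    refine ⟨?_, ?_, ?_⟩ <;>
      simp only [thetaCoef₁₂, thetaCoef₁₃, thetaCoef₂₃, coef_apply, h0, hx, hc] <;>
      refine germ_eq_of_forall _ _ fun x => ?_ <;>
      simp [theta, thetaFun, dxdx_apply, n12, n13, n13.symm, n23.symm]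
  | k + 5 =>
    refine ⟨?_, ?_, ?_⟩ <;>
      simp only [thetaCoef₁₂, thetaCoef₁₃, thetaCoef₂₃, coef_apply, h0, hp] <;>
      refine germ_eq_of_forall _ _ fun x => ?_ <;>
      simp [theta, thetaFun, dxdx_apply, n12, n13, n13.symm, n23.symm]

theorem coords_theta {μ : ℕ} (j i : ℕ) (hi : 1 ≤ i) :
    coords hd μ (theta d hd j) i = if i = j then 1 else 0 := by
  have n12 := i₁_ne_i₂ hd
  have n13 := i₁_ne_i₃ hd
  have n23 := i₂_ne_i₃ hd
  simp only [coords, (coef_theta hd j).1, (coef_theta hd j).2.1, (coef_theta hd j).2.2]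
  match j, i, hi with
  | 0, 1, _ | 0, 2, _ | 0, 3, _ | 0, 4, _ | 0, k + 5, _
  | 1, 1, _ | 1, 2, _ | 1, 3, _ | 1, 4, _
  | 2, 1, _ | 2, 2, _ | 2, 3, _ | 2, 4, _
  | 3, 1, _ | 3, 2, _ | 3, 3, _ | 3, 4, _
  | 4, 1, _ | 4, 2, _ | 4, 3, _ | 4, 4, _
  | l + 5, 1, _ | l + 5, 2, _ | l + 5, 3, _ | l + 5, 4, _ =>
    simp [crd, thetaCoef₁₂, thetaCoef₁₃, thetaCoef₂₃, pd_coord]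
  | 1, k + 5, _ | 2, k + 5, _ | 3, k + 5, _ | 4, k + 5, _ =>
    simp [crd, thetaCoef₁₂, thetaCoef₁₃, n23, pd_coord, PowerSeries.coeff_one]
  | l + 5, k + 5, _ =>
    simp [crd, thetaCoef₁₂, thetaCoef₁₃, T_coord, PowerSeries.coeff_X_pow]

theorem theta_mem_closedForms (i : ℕ) : theta d hd i ∈ closedForms d := by
  refine Filter.Eventually.of_forall fun x => ?_
  have hdiff : DifferentiableAt ℝ (theta d hd i).1 x :=
    (contDiff_thetaFun d hd i).differentiable (by simp) x
  ext v
  rw [extDeriv_apply hdiff, Fin.sum_univ_three]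
  have hc (j : Fin d) : HasFDerivAt (fun y : E d => y j)
      (ContinuousLinearMap.proj (R := ℝ) (φ := fun _ : Fin d => ℝ) j) x := hasFDerivAt_apply j x
  match i with
  | 0 | 1 | 2 | 3 => simp [theta, thetaFun]
  | 4 =>
    have h (u : Fin 2 → E d) : fderiv ℝ (fun y => (theta d hd 4).1 y u) x =
        (dxdx (i₁ d hd) (i₂ d hd) u) •
          (ContinuousLinearMap.proj (R := ℝ) (φ := fun _ : Fin d => ℝ) (i₃ d hd)) -
        (dxdx (i₂ d hd) (i₃ d hd) u) •
          (ContinuousLinearMap.proj (R := ℝ) (φ := fun _ : Fin d => ℝ) (i₁ d hd)) :=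
      (((hc (i₃ d hd)).mul_const _).sub ((hc (i₁ d hd)).mul_const _)).fderiv
    simp only [h]
    simp [dxdx_apply, Fin.removeNth, Fin.succAbove, Fin.tail]
    ring
  | k + 5 =>
    have h (u : Fin 2 → E d) : fderiv ℝ (fun y => (theta d hd (k + 5)).1 y u) x =
        (dxdx (i₁ d hd) (i₃ d hd) u) • ((k + 1 : ℕ) • x (i₃ d hd) ^ k) •
          (ContinuousLinearMap.proj (R := ℝ) (φ := fun _ : Fin d => ℝ) (i₃ d hd)) :=
      (((hc (i₃ d hd)).pow (k + 1)).mul_const _).fderiv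
    simp only [h]
    simp [dxdx_apply, Fin.removeNth, Fin.succAbove, Fin.tail]
    ring

/-- The form `∑ c_i θ_i`. -/
def comb (μ : ℕ) (c : ℕ → ℝ) : SmoothForm d 2 := ∑ i ∈ Finset.Icc 1 μ, c i • theta d hd i

variable {μ : ℕ}

theorem comb_mem_closedForms (c : ℕ → ℝ) : comb hd μ c ∈ closedForms d :=
  sum_mem fun i _ => Submodule.smul_mem _ _ (theta_mem_closedForms hd i)

/-- The coordinates as linear maps. -/
def coordsₗ (μ i : ℕ) : SmoothForm d 2 →ₗ[ℝ] ℝ where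
  toFun η := coords hd μ η i
  map_add' η η' := coords_add η η' i
  map_smul' t η := coords_smul t η i

theorem coords_comb (c : ℕ → ℝ) {i : ℕ} (hi : i ∈ Finset.Icc 1 μ) :
    coords hd μ (comb hd μ c) i = c i := by
  change coordsₗ hd μ i (comb hd μ c) = c i
  rw [comb, map_sum, Finset.sum_eq_single i]
  · rw [map_smul]
    change c i • coords hd μ (theta d hd i) i = c i
    rw [coords_theta hd i i (Finset.mem_Icc.1 hi).1]
    simp
  · intro j _ hj
    rw [map_smul]
    change c j • coords hd μ (theta d hd j) i = 0
    rw [coords_theta hd j i (Finset.mem_Icc.1 hi).1, if_neg hj.symm, smul_zero]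
  · exact fun h => absurd hi h

theorem sum_Icc_eq {M : Type*} [AddCommMonoid M] (hμ : 5 < μ) (f : ℕ → M) :
    ∑ i ∈ Finset.Icc 1 μ, f i =
      f 1 + f 2 + f 3 + f 4 + ∑ k ∈ Finset.range (μ - 4), f (k + 5) := by
  obtain ⟨k, rfl⟩ : ∃ k, μ = k + 4 := ⟨μ - 4, by omega⟩
  have h : Finset.Icc 1 (k + 4) = (Finset.range (k + 4)).map ⟨(· + 1), add_left_injective 1⟩ := by
    ext i
    simp only [Finset.mem_Icc, Finset.mem_map, Finset.mem_range, Function.Embedding.coeFn_mk]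
    constructor
    · exact fun hi => ⟨i - 1, by omega, by omega⟩
    · rintro ⟨j, hj, rfl⟩; omega
  rw [h, Finset.sum_map, Nat.add_sub_cancel]
  simp only [Function.Embedding.coeFn_mk]
  rw [Finset.sum_range_succ', Finset.sum_range_succ', Finset.sum_range_succ',
    Finset.sum_range_succ']
  abel

theorem closed_relation {η : SmoothForm d 2} (hη : η ∈ closedForms d) (i j k : Fin d) :
    pd i (coef j k η) - pd j (coef i k η) + pd k (coef i j η) = 0 := by
  simp only [coef_apply, pd_germ]
  rw [germ_sub, germ_add, ← germ_zero, germ_eq_iff]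
  filter_upwards [show ∀ᶠ x in 𝓝 (0 : E d), extDeriv η.1 x = 0 from hη, η.differentiableAt]
    with x hx h1
  have h := extDeriv_apply h1 ![bv i, bv j, bv k]
  have e0 : (0 : Fin 3).removeNth ![(bv i : E d), bv j, bv k] = ![bv j, bv k] := by
    ext a : 1; fin_cases a <;> rfl
  have e1 : (1 : Fin 3).removeNth ![(bv i : E d), bv j, bv k] = ![bv i, bv k] := by
    ext a : 1; fin_cases a <;> rfl
  have e2 : (2 : Fin 3).removeNth ![(bv i : E d), bv j, bv k] = ![bv i, bv j] := by
    ext a : 1; fin_cases a <;> rfl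
  rw [hx, Fin.sum_univ_three, e0, e1, e2] at h
  simp at h
  linarith

/-- Every closed form has the algebraic restriction of a combination of `θ₁, …, θ_μ`. -/
theorem restr_eq_comb (hμ : 5 < μ) {η : SmoothForm d 2} (hη : η ∈ closedForms d) :
    restr (curve d hd μ) η = restr (curve d hd μ) (comb hd μ (coords hd μ η)) := by
  have hth (i : ℕ) := restr_eq_three hd μ (theta d hd i)
  simp only [(coef_theta hd _).1, (coef_theta hd _).2.1, (coef_theta hd _).2.2] at hth
  -- Closedness makes the coefficients of x₂ dx₁∧dx₃ and x₁ dx₂∧dx₃ equal. The restriction of θ₄ is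
  -- minus the sum of these two, so θ₄ alone accounts for both.
  have hcl : ev (∂₂ (coef (i₁ d hd) (i₃ d hd) η)) - ev (∂₃ (coef (i₁ d hd) (i₂ d hd) η)) =
      ev (∂₁ (coef (i₂ d hd) (i₃ d hd) η)) := by
    have := congrArg ev (closed_relation hη (i₁ d hd) (i₂ d hd) (i₃ d hd))
    rw [map_add, map_sub, map_zero] at this
    linarith
  have h4 : w (curve d hd μ) (i₁ d hd) (i₂ d hd) x₃ = -w (curve d hd μ) (i₁ d hd) (i₃ d hd) x₂ := by
    have := w₁₂_x₃ hd μ 1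
    rwa [mul_one, mul_one] at this
  rw [comb, map_sum, sum_Icc_eq hμ, restr_eq hd hμ, hcl]
  simp only [map_smul, hth, thetaCoef₁₂, thetaCoef₁₃, thetaCoef₂₃, map_zero, zero_add, add_zero,
    map_neg, h4]
  rw [show μ - 3 = (μ - 4) + 1 by omega, Finset.sum_range_succ']
  have hs : ∑ k ∈ Finset.range (μ - 4), coords hd μ η (k + 5) •
        w (curve d hd μ) (i₁ d hd) (i₃ d hd) (x₃ ^ (k + 1)) =
      ∑ k ∈ Finset.range (μ - 4), PowerSeries.coeff (k + 1) (T hd (coef (i₁ d hd) (i₃ d hd) η)) •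
        w (curve d hd μ) (i₁ d hd) (i₃ d hd) (x₃ ^ (k + 1)) -
      (((μ - 3 : ℕ) / 2 : ℝ) * ev (∂₂ (coef (i₁ d hd) (i₂ d hd) η))) •
        w (curve d hd μ) (i₁ d hd) (i₃ d hd) (x₃ ^ (μ - 4)) := by
    obtain ⟨k, rfl⟩ : ∃ k, μ = k + 5 := ⟨μ - 5, by omega⟩
    rw [show k + 5 - 4 = k + 1 by omega, Finset.sum_range_succ, Finset.sum_range_succ,
      Finset.sum_congr rfl (g := fun j => PowerSeries.coeff (j + 1)
        (T hd (coef (i₁ d hd) (i₃ d hd) η)) •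
        w (curve d hd (k + 5)) (i₁ d hd) (i₃ d hd) (x₃ ^ (j + 1)))]
    · simp only [coords, crd, if_true]
      module
    · intro j hj
      have : j < k := Finset.mem_range.1 hj
      simp only [coords, crd]
      rw [if_neg (by omega), sub_zero]
  rw [hs, show (μ - 4 + 1 : ℕ) = μ - 3 by omega]
  simp only [coords, crd, pow_zero, PowerSeries.coeff_zero_eq_constantCoeff_apply, constantCoeff_T]
  module

end

end SMu

namespace SMu

/-! ## Pullback by symmetries -/

section
variable {d : ℕ} {N : Set (E d)} {Φ : E d → E d}

theorem IsSymmetry.tendsto (hΦ : IsSymmetry N Φ) : Filter.Tendsto Φ (𝓝 0) (𝓝 0) := by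
  have := hΦ.smooth.self_of_nhds.continuousAt.tendsto
  rwa [hΦ.map_zero] at this

theorem IsSymmetry.isSm_comp (hΦ : IsSymmetry N Φ) {f : E d → ℝ} (hf : IsSm f) :
    IsSm fun x => f (Φ x) := by
  filter_upwards [hΦ.smooth, hΦ.tendsto.eventually hf] with x h1 h2 using h2.comp x h1

theorem IsSymmetry.isSm (hΦ : IsSymmetry N Φ) (i : Fin d) : IsSm fun x => Φ x i :=
  hΦ.isSm_comp (isSm_coord i)

/-- The `i`-th component of a symmetry. -/
def IsSymmetry.comp (hΦ : IsSymmetry N Φ) (i : Fin d) : Gm d := germ (fun x => Φ x i) (hΦ.isSm i)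

theorem fderiv_component {x : E d} (h : DifferentiableAt ℝ Φ x) (v : E d) (i : Fin d) :
    fderiv ℝ Φ x v i = fderiv ℝ (fun y => Φ y i) x v :=
  ((hasFDerivAt_apply (𝕜 := ℝ) i (Φ x)).comp x h.hasFDerivAt).fderiv ▸ rfl

theorem IsSymmetry.differentiableAt (hΦ : IsSymmetry N Φ) :
    ∀ᶠ x in 𝓝 (0 : E d), DifferentiableAt ℝ Φ x := by
  filter_upwards [hΦ.smooth] with x hx using hx.differentiableAt (by simp)

theorem pullback_apply (η : E d → E d [⋀^Fin 2]→L[ℝ] ℝ) (x v w : E d) :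
    pullback Φ η x ![v, w] = η (Φ x) ![fderiv ℝ Φ x v, fderiv ℝ Φ x w] := by
  rw [pullback, ContinuousAlternatingMap.compContinuousLinearMap_apply]
  congr 1
  ext k : 1
  fin_cases k <;> rfl

/-- The pullback of a smooth form by a symmetry. -/
def IsSymmetry.pull (hΦ : IsSymmetry N Φ) (η : SmoothForm d 2) : SmoothForm d 2 :=
  ⟨pullback Φ η.1, by
    refine contDiffAt_of_coef fun i j => ?_
    have h : IsSm fun x => ∑ k, ∑ l, 2⁻¹ * η.1 (Φ x) ![bv k, bv l] *
        (fderiv ℝ (fun y => Φ y k) x (bv i) * fderiv ℝ (fun y => Φ y l) x (bv j) -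
          fderiv ℝ (fun y => Φ y k) x (bv j) * fderiv ℝ (fun y => Φ y l) x (bv i)) :=
      isSm_sum fun k _ => isSm_sum fun l _ =>
        ((isSm_const _).mul (hΦ.isSm_comp (isSm_form_apply η _))).mul
          ((((hΦ.isSm k).fderiv_apply _).mul ((hΦ.isSm l).fderiv_apply _)).sub
            (((hΦ.isSm k).fderiv_apply _).mul ((hΦ.isSm l).fderiv_apply _)))
    filter_upwards [h, hΦ.differentiableAt.eventually_nhds] with x hx hd
    refine hx.congr_of_eventuallyEq ?_
    filter_upwards [hd] with y hy
    rw [pullback_apply, form_apply_eq_sum]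
    simp only [fderiv_component hy]
    exact Finset.sum_congr rfl fun k _ => Finset.sum_congr rfl fun l _ => by ring⟩

theorem IsSymmetry.pull_val (hΦ : IsSymmetry N Φ) (η : SmoothForm d 2) :
    (hΦ.pull η).1 = pullback Φ η.1 := rfl

/-- The pullback as a linear map. -/
def IsSymmetry.pullₗ (hΦ : IsSymmetry N Φ) : SmoothForm d 2 →ₗ[ℝ] SmoothForm d 2 where
  toFun := hΦ.pull
  map_add' _ _ := rfl
  map_smul' _ _ := rfl

theorem form₁_eq_sum (ζ : E d [⋀^Fin 1]→L[ℝ] ℝ) : ζ = ∑ i, ζ ![bv i] • dxi i := by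
  apply ContinuousAlternatingMap.toAlternatingMap_injective
  refine Module.Basis.ext_alternating (Pi.basisFun ℝ (Fin d)) fun v _ => ?_
  have hv : (fun i => Pi.basisFun ℝ (Fin d) (v i)) = ![bv (v 0)] := by
    ext k : 1
    fin_cases k; simp
  rw [hv]
  change ζ ![bv (v 0)] = (∑ i, ζ ![bv i] • dxi i) ![bv (v 0)]
  simp [ContinuousAlternatingMap.sum_apply, dxi_apply, Pi.single_apply]

theorem contDiffAt_of_coef₁ {η : E d → E d [⋀^Fin 1]→L[ℝ] ℝ}
    (h : ∀ i, IsSm fun x => η x ![bv i]) : ∀ᶠ x in 𝓝 (0 : E d), ContDiffAt ℝ ∞ η x := by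
  have h' : ∀ᶠ x in 𝓝 (0 : E d), ∀ i, ContDiffAt ℝ ∞ (fun x => η x ![bv i]) x :=
    Filter.eventually_all.2 h
  filter_upwards [h'] with x hx
  have e : η = fun x => ∑ i, η x ![bv i] • dxi i := funext fun x => form₁_eq_sum _
  rw [e]
  exact ContDiffAt.sum fun i _ => (hx i).smul contDiffAt_const

theorem form₁_apply_eq_sum (ζ : E d [⋀^Fin 1]→L[ℝ] ℝ) (v : Fin 1 → E d) :
    ζ v = ∑ i, ζ ![bv i] * v 0 i := by
  conv_lhs => rw [form₁_eq_sum ζ]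
  simp [ContinuousAlternatingMap.sum_apply, dxi_apply]

/-- The pullback of a smooth `1`-form by a symmetry. -/
def IsSymmetry.pull₁ (hΦ : IsSymmetry N Φ) (β : SmoothForm d 1) : SmoothForm d 1 :=
  ⟨fun x => (β.1 (Φ x)).compContinuousLinearMap (fderiv ℝ Φ x), by
    refine contDiffAt_of_coef₁ fun i => ?_
    have h : IsSm fun x => ∑ k, β.1 (Φ x) ![bv k] * fderiv ℝ (fun y => Φ y k) x (bv i) :=
      isSm_sum fun k _ => (hΦ.isSm_comp (isSm_form_apply β _)).mul ((hΦ.isSm k).fderiv_apply _)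
    filter_upwards [h, hΦ.differentiableAt.eventually_nhds] with x hx hd
    refine hx.congr_of_eventuallyEq ?_
    filter_upwards [hd] with y hy
    rw [ContinuousAlternatingMap.compContinuousLinearMap_apply, form₁_apply_eq_sum]
    simp only [Function.comp_apply, Matrix.cons_val_fin_one, fderiv_component hy]⟩

/-- Pullback commutes with d, and Φ maps points of N to points of N, so both α and β keep vanishing
there. The action on algebraic restrictions is thereby well defined. -/
theorem IsSymmetry.pull_mem_zeroRestr (hΦ : IsSymmetry N Φ) {η : SmoothForm d 2}
    (h : η ∈ zeroRestr N) : hΦ.pull η ∈ zeroRestr N := by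
  obtain ⟨α, β, h1, h2, h3⟩ := h
  refine ⟨hΦ.pull α, hΦ.pull₁ β, ?_, ?_, ?_⟩
  · filter_upwards [hΦ.tendsto.eventually h1, hΦ.preserves] with x hx hp hN
    rw [pull_val, pullback, hx (hp.2 hN)]
    rfl
  · filter_upwards [hΦ.tendsto.eventually h2, hΦ.preserves] with x hx hp hN
    simp only [pull₁]
    rw [hx (hp.2 hN)]
    rfl
  · filter_upwards [hΦ.tendsto.eventually h3, hΦ.tendsto.eventually β.differentiableAt,
      hΦ.smooth] with x hx hb hs
    rw [pull_val, pull_val, pullback, pullback, hx]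
    simp only [pull₁]
    rw [extDeriv_pullback hb hs (r := ∞) (by
      simp only [minSmoothness_of_isRCLikeNormedField]
      exact WithTop.coe_le_coe.2 le_top)]
    rfl

theorem IsSymmetry.restr_pull_congr (hΦ : IsSymmetry N Φ) {η η' : SmoothForm d 2}
    (h : restr N η = restr N η') : restr N (hΦ.pull η) = restr N (hΦ.pull η') := by
  have h1 : η - η' ∈ zeroRestr N := (Submodule.Quotient.eq _).1 h
  have h2 := hΦ.pull_mem_zeroRestr h1
  exact (Submodule.Quotient.eq _).2 h2

/-- The representatives in `Diffeomorphic` can be fixed in advance, since the pullback descends to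
restrictions. -/
theorem diffeomorphic_iff {η η' : SmoothForm d 2} :
    Diffeomorphic (restr N η) (restr N η') ↔
      ∃ (Φ : E d → E d) (hΦ : IsSymmetry N Φ), restr N (hΦ.pull η) = restr N η' := by
  constructor
  · rintro ⟨Φ, ζ, ζ', hΦ, h1, h2, h3⟩
    refine ⟨Φ, hΦ, ?_⟩
    rw [← hΦ.restr_pull_congr h1, ← h2]
    exact (restr_congr N h3).symm
  · rintro ⟨Φ, hΦ, h⟩
    exact ⟨Φ, η, hΦ.pull η, hΦ, rfl, h, Filter.EventuallyEq.refl _ _⟩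

theorem Diffeomorphic.trans {a b c : AlgRestr N} (h1 : Diffeomorphic a b)
    (h2 : Diffeomorphic b c) : Diffeomorphic a c := by
  obtain ⟨η₁, rfl⟩ := (zeroRestr N).mkQ_surjective a
  obtain ⟨η₂, rfl⟩ := (zeroRestr N).mkQ_surjective b
  obtain ⟨η₃, rfl⟩ := (zeroRestr N).mkQ_surjective c
  change Diffeomorphic (restr N η₁) (restr N η₂) at h1
  change Diffeomorphic (restr N η₂) (restr N η₃) at h2
  change Diffeomorphic (restr N η₁) (restr N η₃)
  obtain ⟨Φ, hΦ, e1⟩ := diffeomorphic_iff.1 h1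
  obtain ⟨Ψ, hΨ, e2⟩ := diffeomorphic_iff.1 h2
  have hd : ∀ᶠ x in 𝓝 (0 : E d), DifferentiableAt ℝ (fun x => Φ (Ψ x)) x ∧
      fderiv ℝ (fun x => Φ (Ψ x)) x = (fderiv ℝ Φ (Ψ x)).comp (fderiv ℝ Ψ x) := by
    filter_upwards [hΨ.differentiableAt, hΨ.tendsto.eventually hΦ.differentiableAt] with x h3 h4
    exact ⟨h4.comp x h3, fderiv_comp x h4 h3⟩
  have hΦΨ : IsSymmetry N (fun x => Φ (Ψ x)) := by
    refine ⟨by rw [hΨ.map_zero, hΦ.map_zero], ?_, ?_, ?_⟩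
    · filter_upwards [hΨ.smooth, hΨ.tendsto.eventually hΦ.smooth] with x h3 h4 using h4.comp x h3
    · rw [hd.self_of_nhds.2, hΨ.map_zero]
      exact hΦ.invertible.comp hΨ.invertible
    · filter_upwards [hΨ.preserves, hΨ.tendsto.eventually hΦ.preserves] with x h3 h4
      rw [h4, h3]
  refine diffeomorphic_iff.2 ⟨_, hΦΨ, ?_⟩
  rw [← e2, ← hΨ.restr_pull_congr e1]
  refine restr_congr N ?_
  filter_upwards [hd] with x hx
  simp only [IsSymmetry.pull_val, pullback]
  rw [hx.2]
  rfl

theorem isSymmetry_id (N : Set (E d)) : IsSymmetry N (fun x : E d => x) := by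
  refine ⟨rfl, Filter.Eventually.of_forall fun x => contDiffAt_id, ?_,
    Filter.Eventually.of_forall fun x => Iff.rfl⟩
  rw [fderiv_fun_id]
  exact ⟨ContinuousLinearEquiv.refl ℝ _, rfl⟩

theorem pull_id_val (η : SmoothForm d 2) : ((isSymmetry_id N).pull η).1 = η.1 := by
  funext x
  refine form_ext fun i j => ?_
  rw [IsSymmetry.pull_val, pullback_apply]
  simp

theorem Diffeomorphic.refl (a : AlgRestr N) : Diffeomorphic a a := by
  obtain ⟨η, rfl⟩ := (zeroRestr N).mkQ_surjective a
  exact diffeomorphic_iff.2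
    ⟨_, isSymmetry_id N, restr_congr N (Filter.EventuallyEq.of_eq (pull_id_val η))⟩

theorem IsSymmetry.van_comp (hΦ : IsSymmetry N Φ) {f : E d → ℝ} (hf : IsSm f)
    (h : ∀ᶠ x in 𝓝 (0 : E d), x ∈ N → f x = 0) :
    Van N (germ (fun x => f (Φ x)) (hΦ.isSm_comp hf)) := by
  refine ⟨_, _, rfl, ?_⟩
  filter_upwards [hΦ.tendsto.eventually h, hΦ.preserves] with x hx hp hN using hx (hp.2 hN)

/-- The coefficient of `dx_i ∧ dx_j` in `dφ_a ∧ dφ_b`. -/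
def minor (u v : Gm d) (i j : Fin d) : Gm d := pd i u * pd j v - pd i v * pd j u

theorem IsSymmetry.coef_pull_theta (hd : 3 ≤ d) (hΦ : IsSymmetry N Φ) (i j : Fin d) (k : ℕ) :
    coef i j (hΦ.pull (theta d hd k)) = match k with
      | 0 => 0
      | 1 => minor (hΦ.comp (i₁ d hd)) (hΦ.comp (i₃ d hd)) i j
      | 2 => minor (hΦ.comp (i₂ d hd)) (hΦ.comp (i₃ d hd)) i j
      | 3 => minor (hΦ.comp (i₁ d hd)) (hΦ.comp (i₂ d hd)) i j
      | 4 => hΦ.comp (i₃ d hd) * minor (hΦ.comp (i₁ d hd)) (hΦ.comp (i₂ d hd)) i j -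
          hΦ.comp (i₁ d hd) * minor (hΦ.comp (i₂ d hd)) (hΦ.comp (i₃ d hd)) i j
      | k + 5 => hΦ.comp (i₃ d hd) ^ (k + 1) *
          minor (hΦ.comp (i₁ d hd)) (hΦ.comp (i₃ d hd)) i j := by
  rw [coef_apply]
  match k with
  | 0 => exact germ_eq_iff.2 (Filter.Eventually.of_forall fun x => rfl)
  | 1 | 2 | 3 =>
    simp only [minor, comp, pd_germ, germ_mul, germ_sub]
    rw [germ_eq_iff]
    filter_upwards [hΦ.differentiableAt] with x hx
    rw [pull_val, pullback_apply]
    simp only [theta, thetaFun, dxdx_apply, Matrix.cons_val_zero, Matrix.cons_val_one,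
      fderiv_component hx]
  | 4 =>
    simp only [minor, comp, pd_germ, germ_mul, germ_sub]
    rw [germ_eq_iff]
    filter_upwards [hΦ.differentiableAt] with x hx
    rw [pull_val, pullback_apply]
    simp [theta, thetaFun, dxdx_apply, fderiv_component hx]
  | k + 5 =>
    simp only [minor, comp, pd_germ, germ_mul, germ_sub, germ_pow]
    rw [germ_eq_iff]
    filter_upwards [hΦ.differentiableAt] with x hx
    rw [pull_val, pullback_apply]
    simp [theta, thetaFun, dxdx_apply, fderiv_component hx]

end

end SMu

namespace SMu

/-! ## Jets of symmetries -/

open PowerSeries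

/-- The linear part of a symmetry is diagonal. -/
theorem linear_part_diagonal {a₁ a₂ a₃ b₁ b₂ b₃ c₁ c₂ c₃ : ℝ}
    (hdet : a₁ * (b₂ * c₃ - b₃ * c₂) - a₂ * (b₁ * c₃ - b₃ * c₁) + a₃ * (b₁ * c₂ - b₂ * c₁) ≠ 0)
    (h1 : b₁ * c₁ + b₂ * c₂ = 0) (h2 : b₁ * c₂ + b₂ * c₁ = 0) (h3 : b₃ * c₃ = 0)
    (h4 : b₁ * c₃ + b₃ * c₁ = 0) (k1 : a₁ ^ 2 - b₁ ^ 2 + (a₂ ^ 2 - b₂ ^ 2) = 0)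
    (k2 : a₁ * a₂ - b₁ * b₂ = 0) (k3 : a₃ ^ 2 - b₃ ^ 2 = 0) (k4 : a₁ * a₃ - b₁ * b₃ = 0) :
    a₂ = 0 ∧ a₃ = 0 ∧ b₁ = 0 ∧ b₃ = 0 ∧ c₁ = 0 ∧ c₂ = 0 ∧ a₁ ^ 2 = b₂ ^ 2 := by
  rcases mul_eq_zero.1 h3 with hb | hc
  · subst hb
    obtain rfl : a₃ = 0 := by simpa using k3
    have hc₃ : c₃ ≠ 0 := by rintro rfl; simp at hdet
    obtain rfl : b₁ = 0 := by simpa [hc₃] using h4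
    have hb₂ : b₂ ≠ 0 := by rintro rfl; simp at hdet
    have ha₁ : a₁ ≠ 0 := by rintro rfl; simp at hdet
    obtain rfl : c₂ = 0 := by simpa [hb₂] using h1
    obtain rfl : c₁ = 0 := by simpa [hb₂] using h2
    obtain rfl : a₂ = 0 := by simpa [ha₁] using k2
    simp at k1 ⊢
    linarith
  -- If c₃ = 0, the equations force the first column of the matrix to vanish, against the nonzero
  -- determinant.
  · subst hc
    exfalso
    have hb₃ : b₃ ≠ 0 := by
      rintro rfl
      apply hdet
      have : a₃ = 0 := by simpa using k3
      simp [this]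
    obtain rfl : c₁ = 0 := by simpa [hb₃] using h4
    have hc₂ : c₂ ≠ 0 := by rintro rfl; simp at hdet
    obtain rfl : b₁ = 0 := by simpa [hc₂] using h2
    obtain rfl : b₂ = 0 := by simpa [hc₂] using h1
    have ha₃ : a₃ ≠ 0 := by
      rintro rfl
      apply hb₃
      simpa using k3
    obtain rfl : a₁ = 0 := by simpa [ha₃] using k4
    simp at hdet

section
variable {d : ℕ} (hd : 3 ≤ d)

local notation "∂₁" => pd (i₁ d hd)
local notation "∂₂" => pd (i₂ d hd)
local notation "∂₃" => pd (i₃ d hd)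

/-- The properties of the components `u₁, u₂, u₃` of a symmetry used below. -/
structure SymJets (m : ℕ) (u₁ u₂ u₃ : Gm d) : Prop where
  ev₁ : ev u₁ = 0
  ev₃ : ev u₃ = 0
  d₁₂ : ev (∂₂ u₁) = 0
  d₁₃ : ev (∂₃ u₁) = 0
  d₂₁ : ev (∂₁ u₂) = 0
  d₂₃ : ev (∂₃ u₂) = 0
  d₃₁ : ev (∂₁ u₃) = 0
  d₃₂ : ev (∂₂ u₃) = 0
  sq₁ : ev (∂₁ u₁) ^ 2 = ev (∂₃ u₃) ^ m
  sq₂ : ev (∂₂ u₂) ^ 2 = ev (∂₃ u₃) ^ m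
  ne₂ : ev (∂₂ u₂) ≠ 0
  ne₃ : ev (∂₃ u₃) ≠ 0
  dvd₁ : X ^ m ∣ T hd u₁
  dvd₂ : X ^ m ∣ T hd u₂
  dvd₂₁ : X ^ m ∣ T hd (∂₁ u₂)
  mixed : ev (∂₁ (∂₂ u₃)) = 0
  second : coeff 1 (T hd (∂₁ u₁)) = 0 → coeff 2 (T hd u₃) = 0

variable {hd}

/-- Since m ≥ 3, the component x₁ = σt^m does not contribute to the coefficient of t². -/
theorem coeff_two_Γ {m : ℕ} (hm : m ≠ 0) (hm3 : 3 ≤ m) (σ : ℝ) (r : Gm d) :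
    coeff 2 (Γ hd hm σ r) = ev (∂₃ r) := by
  have h := X_pow_dvd_iff.1 (Γ_expansion hd hm σ 3 (by omega) r) 2 (by omega)
  have h1 : coeff 2 (expand 2 two_ne_zero (T hd r)) = coeff 1 (T hd r) :=
    coeff_expand_mul (p := 2) two_ne_zero (T hd r) 1
  rw [map_sub, map_add, map_add, map_add, h1, mul_assoc, mul_assoc, mul_assoc, coeff_C_mul,
    coeff_C_mul, coeff_C_mul, coeff_X_pow_mul', coeff_X_pow_mul', coeff_X_pow_mul',
    if_neg (by omega), if_neg (by omega), if_neg (by omega)] at h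
  rw [← coeff_one_T]
  linarith

theorem ev_pd_pd_mul (i j : Fin d) {u v : Gm d} (hu : ev u = 0) (hv : ev v = 0) :
    ev (pd i (pd j (u * v))) = ev (pd i u) * ev (pd j v) + ev (pd j u) * ev (pd i v) := by
  simp [hu, hv]
  ring

theorem ev_pd_pd_pow (i j : Fin d) {u : Gm d} (hu : ev u = 0) {n : ℕ} (hn : 3 ≤ n) :
    ev (pd i (pd j (u ^ n))) = 0 := by
  obtain ⟨k, rfl⟩ : ∃ k, n = k + 3 := ⟨n - 3, by omega⟩
  simp [Derivation.leibniz_pow, hu]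

theorem ev_pd_pd_sub (i j : Fin d) {u v w : Gm d} (hu : ev u = 0) (hv : ev v = 0) (hw : ev w = 0)
    {n : ℕ} (hn : 3 ≤ n) : ev (pd i (pd j (u ^ 2 - v ^ 2 - w ^ n))) =
      2 * (ev (pd i u) * ev (pd j u) - ev (pd i v) * ev (pd j v)) := by
  rw [map_sub, map_sub, map_sub, map_sub, map_sub, map_sub, pow_two, pow_two,
    ev_pd_pd_pow i j hw hn,
    ev_pd_pd_mul i j hu hu, ev_pd_pd_mul i j hv hv]
  ring

theorem coeff_two_T (r : Gm d) : coeff 2 (T hd r) = ev (∂₃ (∂₃ r)) / 2 := by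
  have h := coeff_one_T hd (∂₃ r)
  rw [T_pd_three, coeff_derivative] at h
  norm_num at h
  linarith

/-- The 2-jets of the two pulled-back equations determine the shape of the linear part; u₃^m has
order at least 3 and does not enter. Next, u₂u₃ is flat on every branch while only one factor can
be, so u₂ is flat on the arcs and u₃ on the lines. The quadric then relates ∂₁u₁ to u₃ along the
x₃-axis. -/
theorem symJets_of_van {m : ℕ} (hm3 : 3 ≤ m) {u₁ u₂ u₃ : Gm d} (hm : m ≠ 0)
    (e1 : ev u₁ = 0) (e2 : ev u₂ = 0) (e3 : ev u₃ = 0)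
    (hC : FlatCusp hd hm (u₂ * u₃)) (hL : FlatLine hd (u₂ * u₃))
    (hC' : FlatCusp hd hm (u₁ ^ 2 - u₂ ^ 2 - u₃ ^ m))
    (hL' : FlatLine hd (u₁ ^ 2 - u₂ ^ 2 - u₃ ^ m))
    (hdet : ev (∂₁ u₁) * (ev (∂₂ u₂) * ev (∂₃ u₃) - ev (∂₃ u₂) * ev (∂₂ u₃)) -
      ev (∂₂ u₁) * (ev (∂₁ u₂) * ev (∂₃ u₃) - ev (∂₃ u₂) * ev (∂₁ u₃)) +
      ev (∂₃ u₁) * (ev (∂₁ u₂) * ev (∂₂ u₃) - ev (∂₂ u₂) * ev (∂₁ u₃)) ≠ 0) :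
    SymJets hd m u₁ u₂ u₃ := by
  have second (r : Gm d) (hr : FlatCusp hd hm r) : ev (∂₃ (∂₃ r)) = 0 ∧ ev (∂₁ (∂₃ r)) = 0 := by
    have h1 := X_pow_dvd_iff.1 hr.dvd_T_self 2 (by omega)
    have h2 := X_pow_dvd_iff.1 hr.dvd_T_pd 1 (by omega)
    rw [coeff_two_T] at h1
    rw [coeff_one_T, pd_comm] at h2
    exact ⟨by linarith, h2⟩
  obtain ⟨a2, a3, b1, b3, c1, c2, hab⟩ := linear_part_diagonal hdet
    (by
      have := hL.ev_pd_pd.2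
      rw [ev_pd_pd_mul _ _ e2 e3, ev_pd_pd_mul _ _ e2 e3] at this
      linarith)
    (by
      have := hL.ev_pd_pd.1
      rwa [ev_pd_pd_mul _ _ e2 e3] at this)
    (by
      have := (second _ hC).1
      rw [ev_pd_pd_mul _ _ e2 e3] at this
      linarith)
    (by
      have := (second _ hC).2
      rwa [ev_pd_pd_mul _ _ e2 e3] at this)
    (by
      have := hL'.ev_pd_pd.2
      rw [ev_pd_pd_sub _ _ e1 e2 e3 hm3, ev_pd_pd_sub _ _ e1 e2 e3 hm3] at this
      linarith)
    (by
      have := hL'.ev_pd_pd.1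
      rw [ev_pd_pd_sub _ _ e1 e2 e3 hm3] at this
      linarith)
    (by
      have := (second _ hC').1
      rw [ev_pd_pd_sub _ _ e1 e2 e3 hm3] at this
      linarith)
    (by
      have := (second _ hC').2
      rw [ev_pd_pd_sub _ _ e1 e2 e3 hm3] at this
      linarith)
  have hd' : ev (∂₁ u₁) * (ev (∂₂ u₂) * ev (∂₃ u₃)) ≠ 0 := by
    intro h
    apply hdet
    rw [a2, a3, b3]
    linarith
  have n1 := left_ne_zero_of_mul hd'
  have n2 := left_ne_zero_of_mul (right_ne_zero_of_mul hd')
  have n3 := right_ne_zero_of_mul (right_ne_zero_of_mul hd')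
  -- Power series form a domain, and u₃ has the nonzero coefficient γ at t² along the arcs.
  have hC₂ : FlatCusp hd hm u₂ := by
    have hne (σ : ℝ) : Γ hd hm σ u₃ ≠ 0 := by
      intro h
      have := coeff_two_Γ (hd := hd) hm hm3 σ u₃
      rw [h, map_zero] at this
      exact n3 this.symm
    refine ⟨?_, ?_⟩
    · have := hC.pos
      rw [map_mul] at this
      exact (mul_eq_zero.1 this).resolve_right (hne _)
    · have := hC.neg
      rw [map_mul] at this
      exact (mul_eq_zero.1 this).resolve_right (hne _)
  have hL₃ : FlatLine hd u₃ := by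
    have hne (σ : ℝ) : Λ hd σ u₂ ≠ 0 := by
      intro h
      have := coeff_one_Λ (hd := hd) σ u₂
      rw [h, map_zero, b1, mul_zero, zero_add] at this
      exact n2 this.symm
    refine ⟨?_, ?_⟩
    · have := hL.pos
      rw [map_mul] at this
      exact (mul_eq_zero.1 this).resolve_left (hne _)
    · have := hL.neg
      rw [map_mul] at this
      exact (mul_eq_zero.1 this).resolve_left (hne _)
  have dvd₂ := hC₂.dvd_T_self
  have dvd₂₁ := hC₂.dvd_T_pd
  have hB : X ∣ T hd u₃ := X_dvd_iff.2 (by rw [constantCoeff_T, e3])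
  have hB' : X ∣ T hd (∂₁ u₃) := X_dvd_iff.2 (by rw [constantCoeff_T, c1])
  obtain ⟨k, hk⟩ : ∃ k, m = k + 3 := ⟨m - 3, by omega⟩
  -- On the axis ∂₁ of the pulled-back quadric is 2 u₁ ∂₁u₁ up to multiples of X^m, and ∂₁u₁ is a
  -- unit there.
  have dvd₁ : X ^ m ∣ T hd u₁ := by
    have h := hC'.dvd_T_pd
    have e : T hd (∂₁ (u₁ ^ 2 - u₂ ^ 2 - u₃ ^ m)) = T hd u₁ * (2 * T hd (∂₁ u₁)) -
        (2 * T hd u₂ * T hd (∂₁ u₂) + ((k + 3 : ℕ) : PowerSeries ℝ) *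
          (T hd u₃ ^ (k + 2) * T hd (∂₁ u₃))) := by
      rw [hk]
      simp [Derivation.leibniz_pow, map_ofNat]
      ring
    rw [e, dvd_sub_left] at h
    · refine (IsUnit.dvd_mul_right ?_).1 h
      rw [isUnit_iff_constantCoeff, map_mul, constantCoeff_T, map_ofNat]
      exact (mul_ne_zero two_ne_zero n1).isUnit
    · refine dvd_add ((dvd₂.mul_left 2).mul_right _) (Dvd.dvd.mul_left ?_ _)
      rw [hk, pow_succ]
      exact mul_dvd_mul (pow_dvd_pow_of_dvd hB _) hB'
  obtain ⟨B, hBe⟩ := hB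
  have hBc : constantCoeff B = ev (∂₃ u₃) := by
    rw [← coeff_one_T, hBe, show coeff (R := ℝ) 1 = coeff (0 + 1) from rfl, coeff_succ_X_mul,
      coeff_zero_eq_constantCoeff_apply]
  -- With u₃ = X B on the axis, `dvd_T` for the quadric reduces modulo X^(m+2) to X^m ((∂₁u₁)² -
  -- B^m). The constant term gives α² = γ^m. The linear term ties the first-order part of ∂₁u₁ to
  -- that of B, which is the field `second`.
  have key : X ^ 2 ∣ T hd (∂₁ u₁) ^ 2 - B ^ m := by
    have h := (pow_dvd_pow (X : PowerSeries ℝ) (by omega : m + 2 ≤ 2 * m)).trans hC'.dvd_T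
    have e : T hd (u₁ ^ 2 - u₂ ^ 2 - u₃ ^ m) + (C (1 / 2 : ℝ) : PowerSeries ℝ) * X ^ m *
          T hd (∂₁ (∂₁ (u₁ ^ 2 - u₂ ^ 2 - u₃ ^ m))) =
        X ^ m * (T hd (∂₁ u₁) ^ 2 - B ^ m) + (T hd u₁ * T hd u₁ - T hd u₂ * T hd u₂ +
          T hd u₁ * (X ^ m * T hd (∂₁ (∂₁ u₁))) -
          T hd u₂ * (X ^ m * T hd (∂₁ (∂₁ u₂))) - X ^ m * (T hd (∂₁ u₂) * T hd (∂₁ u₂)) -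
          (C (1 / 2 : ℝ) : PowerSeries ℝ) * ((k + 3 : ℕ) : PowerSeries ℝ) *
            (X ^ m * (T hd u₃ ^ (k + 1) * T hd (∂₁ u₃)) *
            (((k + 2 : ℕ) : PowerSeries ℝ) * T hd (∂₁ u₃)) +
            X ^ m * T hd u₃ ^ (k + 2) * T hd (∂₁ (∂₁ u₃)))) := by
      have e0 : (C (1 / 2 : ℝ) : PowerSeries ℝ) * 2 = 1 := by
        rw [← map_ofNat C 2, ← map_mul]; norm_num
      rw [hk]
      simp only [map_sub, map_mul, map_pow, Derivation.leibniz_pow, Derivation.leibniz,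
        smul_eq_mul, nsmul_eq_mul, map_add, map_natCast, Derivation.map_natCast, mul_zero,
        add_zero]
      have e4 : T hd u₃ ^ (k + 3) = X ^ (k + 3) * B ^ (k + 3) := by rw [hBe, mul_pow]
      rw [e4]
      simp only [show k + 3 - 1 = k + 2 from rfl, show k + 2 - 1 = k + 1 from rfl,
        show 2 - 1 = 1 from rfl, show 1 - 1 = 0 from rfl, pow_one, pow_zero]
      push_cast
      linear_combination (X ^ (k + 3) * (T hd (∂₁ u₁) ^ 2 + T hd u₁ * T hd (∂₁ (∂₁ u₁)) -
        T hd (∂₁ u₂) ^ 2 - T hd u₂ * T hd (∂₁ (∂₁ u₂)))) * e0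
    have h2 : (X : PowerSeries ℝ) ^ (m + 2) ∣ X ^ m * X ^ m := by
      rw [← pow_add]; exact pow_dvd_pow _ (by omega)
    have hB0 : X ∣ T hd u₃ := ⟨B, hBe⟩
    rw [e, dvd_add_left] at h
    · rw [pow_add] at h
      exact (mul_dvd_mul_iff_left (pow_ne_zero _ X_ne_zero)).1 h
    · refine dvd_sub (dvd_sub (dvd_sub (dvd_add (dvd_sub ?_ ?_) ?_) ?_) ?_)
        (Dvd.dvd.mul_left (dvd_add ?_ ?_) _)
      · exact h2.trans (mul_dvd_mul dvd₁ dvd₁)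
      · exact h2.trans (mul_dvd_mul dvd₂ dvd₂)
      · exact h2.trans (mul_dvd_mul dvd₁ (dvd_mul_right _ _))
      · exact h2.trans (mul_dvd_mul dvd₂ (dvd_mul_right _ _))
      · exact h2.trans (mul_dvd_mul_left _ (dvd₂₁.mul_right _))
      · refine Dvd.dvd.mul_right ?_ _
        rw [pow_add]
        refine mul_dvd_mul_left _ ?_
        exact (pow_dvd_pow X (by omega : 2 ≤ k + 1 + 1)).trans
          (by rw [pow_succ]; exact mul_dvd_mul (pow_dvd_pow_of_dvd hB0 _) hB')
      · refine Dvd.dvd.mul_right ?_ _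
        rw [pow_add]
        exact mul_dvd_mul_left _ ((pow_dvd_pow X (by omega : 2 ≤ k + 2)).trans
          (pow_dvd_pow_of_dvd hB0 _))
  have sq₁ : ev (∂₁ u₁) ^ 2 = ev (∂₃ u₃) ^ m := by
    have := X_pow_dvd_iff.1 key 0 (by omega)
    rw [coeff_zero_eq_constantCoeff_apply, map_sub, map_pow, map_pow, constantCoeff_T, hBc] at this
    linarith
  refine ⟨e1, e3, a2, a3, b1, b3, c1, c2, sq₁, by rw [← hab, sq₁], n2, n3, dvd₁, dvd₂,
    dvd₂₁, hL₃.ev_pd_pd.1, fun h => ?_⟩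
  have h1 := X_pow_dvd_iff.1 key 1 (by omega)
  have hder (p : PowerSeries ℝ) (n : ℕ) :
      coeff 1 (p ^ n) = n * constantCoeff p ^ (n - 1) * coeff 1 p := by
    have h2 (q : PowerSeries ℝ) : coeff 1 q = constantCoeff (PowerSeries.derivative ℝ q) := by
      rw [← coeff_zero_eq_constantCoeff_apply, coeff_derivative]; simp
    rw [h2, h2, Derivation.leibniz_pow]
    simp [mul_assoc]
  rw [map_sub, hder, hder, h, hBc, mul_zero, zero_sub, neg_eq_zero] at h1
  have h3 : coeff 1 B = 0 := by
    refine (mul_eq_zero.1 h1).resolve_left (mul_ne_zero ?_ (pow_ne_zero _ n3))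
    exact_mod_cast hm
  rw [hBe, show coeff (R := ℝ) 2 = coeff (1 + 1) from rfl, coeff_succ_X_mul, h3]

/-- The 3 × 3 block of the differential at 0 is invertible: the components Φ_j with j ≥ 4 vanish on
the curve, so their first derivatives along x₁, x₂, x₃ are zero, and a kernel vector of the block
would be a kernel vector of the whole differential. -/
theorem IsSymmetry.symJets {μ : ℕ} (hμ : 5 < μ) {Φ : E d → E d}
    (hΦ : IsSymmetry (curve d hd μ) Φ) :
    SymJets hd (μ - 3) (hΦ.comp (i₁ d hd)) (hΦ.comp (i₂ d hd)) (hΦ.comp (i₃ d hd)) := by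
  have hm : μ - 3 ≠ 0 := by omega
  have ev0 (i : Fin d) : ev (hΦ.comp i) = 0 := by
    rw [comp, ev_germ, hΦ.map_zero]; rfl
  have v1 : Van (curve d hd μ) (hΦ.comp (i₂ d hd) * hΦ.comp (i₃ d hd)) :=
    hΦ.van_comp ((isSm_coord _).mul (isSm_coord _))
      (Filter.Eventually.of_forall fun x hx => hx.2.1)
  have v2 : Van (curve d hd μ) (hΦ.comp (i₁ d hd) ^ 2 - hΦ.comp (i₂ d hd) ^ 2 -
      hΦ.comp (i₃ d hd) ^ (μ - 3)) :=
    hΦ.van_comp ((((isSm_coord _).pow 2).sub ((isSm_coord _).pow 2)).sub ((isSm_coord _).pow _))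
      (Filter.Eventually.of_forall fun x hx => hx.1)
  refine symJets_of_van (by omega) hm (ev0 _) (ev0 _) (ev0 _) (v1.flatCusp hd hm)
    (v1.flatLine hd hμ) (v2.flatCusp hd hm) (v2.flatLine hd hμ) ?_
  intro hdet
  let M : Matrix (Fin 3) (Fin 3) ℝ := ![![ev (∂₁ (hΦ.comp (i₁ d hd))),
      ev (∂₂ (hΦ.comp (i₁ d hd))), ev (∂₃ (hΦ.comp (i₁ d hd)))],
    ![ev (∂₁ (hΦ.comp (i₂ d hd))), ev (∂₂ (hΦ.comp (i₂ d hd))), ev (∂₃ (hΦ.comp (i₂ d hd)))],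
    ![ev (∂₁ (hΦ.comp (i₃ d hd))), ev (∂₂ (hΦ.comp (i₃ d hd))), ev (∂₃ (hΦ.comp (i₃ d hd)))]]
  have hM : M.det = 0 := by
    rw [Matrix.det_fin_three]
    simp only [M, Matrix.cons_val_zero, Matrix.cons_val_one, Matrix.cons_val]
    linarith
  obtain ⟨v, hv, hMv⟩ := Matrix.exists_mulVec_eq_zero_iff.2 hM
  have m0 := congrFun hMv 0
  have m1 := congrFun hMv 1
  have m2 := congrFun hMv 2
  simp [Matrix.mulVec, dotProduct, Fin.sum_univ_three, M] at m0 m1 m2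
  let V : E d := v 0 • bv (i₁ d hd) + v 1 • bv (i₂ d hd) + v 2 • bv (i₃ d hd)
  have hV (j : Fin d) : fderiv ℝ Φ 0 V j = v 0 * ev (∂₁ (hΦ.comp j)) + v 1 * ev (∂₂ (hΦ.comp j)) +
      v 2 * ev (∂₃ (hΦ.comp j)) := by
    simp only [V, map_add, map_smul, smul_eq_mul,
      fderiv_component hΦ.differentiableAt.self_of_nhds]
    rfl
  have hV0 : fderiv ℝ Φ 0 V = 0 := by
    ext j
    rw [hV]
    by_cases hj : 3 ≤ (j : ℕ)
    · have vj : Van (curve d hd μ) (hΦ.comp j) :=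
        hΦ.van_comp (isSm_coord j) (Filter.Eventually.of_forall fun x hx => hx.2.2 j hj)
      have h1 := (vj.flatLine hd hμ).ev_pd
      have h2 : ev (∂₃ (hΦ.comp j)) = 0 := by
        rw [← coeff_one_T]
        exact X_pow_dvd_iff.1 (vj.flatCusp hd hm).dvd_T_self 1 (by omega)
      simp [h1.1, h1.2, h2]
    · rcases eq_of_val_lt_three hd (not_le.1 hj) with rfl | rfl | rfl
      · simp only [Pi.zero_apply]; linarith
      · simp only [Pi.zero_apply]; linarith
      · simp only [Pi.zero_apply]; linarith
  obtain ⟨e, he⟩ := hΦ.invertible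
  have hV1 : V = 0 := by
    rw [← he] at hV0
    exact e.map_eq_zero_iff.1 hV0
  apply hv
  have n12 := i₁_ne_i₂ hd
  have n13 := i₁_ne_i₃ hd
  have n23 := i₂_ne_i₃ hd
  ext k
  fin_cases k
  · simpa [V, n12, n13] using congrFun hV1 (i₁ d hd)
  · simpa [V, n12.symm, n23] using congrFun hV1 (i₂ d hd)
  · simpa [V, n13.symm, n23.symm] using congrFun hV1 (i₃ d hd)

end

end SMu

namespace SMu

/-! ## The action of symmetries in coordinates -/

open PowerSeries

/-- The coefficient of `θ` in the family `θ₁, θ₅, θ₆, …`, that is `x₃^k dx₁∧dx₃`. -/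
def slot (c : ℕ → ℝ) (k : ℕ) : ℝ := if k = 0 then c 1 else c (k + 4)

/-- The polynomial with coefficients `slot c k` for `k < m`. -/
def slotPoly {A : Type*} [CommRing A] [Algebra ℝ A] (m : ℕ) (c : ℕ → ℝ) (u : A) : A :=
  ∑ k ∈ Finset.range m, slot c k • u ^ k

/-- The coefficients of the pullback of `∑ c_i θ_i` under a map with components `u₁, u₂, u₃`. -/
def pulledCoef {d : ℕ} (m : ℕ) (c : ℕ → ℝ) (u₁ u₂ u₃ : Gm d) (i j : Fin d) : Gm d :=
  slotPoly m c u₃ * minor u₁ u₃ i j + (c 2 • 1 - c 4 • u₁) * minor u₂ u₃ i j +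
    (c 3 • 1 + c 4 • u₃) * minor u₁ u₂ i j

section
variable {d : ℕ} {hd : 3 ≤ d}

local notation "∂₁" => pd (i₁ d hd)
local notation "∂₂" => pd (i₂ d hd)
local notation "∂₃" => pd (i₃ d hd)

theorem slotPoly_succ {A : Type*} [CommRing A] [Algebra ℝ A] (m : ℕ) (c : ℕ → ℝ) (u : A) :
    slotPoly (m + 1) c u = c 1 • 1 + ∑ k ∈ Finset.range m, c (k + 5) • u ^ (k + 1) := by
  rw [slotPoly, Finset.sum_range_succ', add_comm]
  simp [slot]

theorem map_slotPoly {A B : Type*} [CommRing A] [Algebra ℝ A] [CommRing B] [Algebra ℝ B]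
    (f : A →ₐ[ℝ] B) (m : ℕ) (c : ℕ → ℝ) (u : A) : f (slotPoly m c u) = slotPoly m c (f u) := by
  simp [slotPoly]

theorem IsSymmetry.coef_pull_comb {μ : ℕ} (hμ : 5 < μ) {N : Set (E d)} {Φ : E d → E d}
    (hΦ : IsSymmetry N Φ) (c : ℕ → ℝ) (i j : Fin d) :
    coef i j (hΦ.pull (comb hd μ c)) =
      pulledCoef (μ - 3) c (hΦ.comp (i₁ d hd)) (hΦ.comp (i₂ d hd)) (hΦ.comp (i₃ d hd)) i j := by
  have h : coef i j (hΦ.pull (comb hd μ c)) =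
      ∑ k ∈ Finset.Icc 1 μ, c k • coef i j (hΦ.pull (theta d hd k)) := by
    change (coef i j ∘ₗ hΦ.pullₗ) (comb hd μ c) = _
    rw [comb, map_sum]
    simp only [map_smul]
    rfl
  rw [h, sum_Icc_eq hμ]
  simp only [coef_pull_theta hd]
  obtain ⟨k, rfl⟩ : ∃ k, μ = k + 4 := ⟨μ - 4, by omega⟩
  rw [pulledCoef, show k + 4 - 3 = k + 1 from rfl, slotPoly_succ, Nat.add_sub_cancel]
  simp only [add_mul, Finset.sum_mul, smul_mul_assoc, one_mul, sub_mul, smul_sub]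
  abel

variable {m : ℕ} {u₁ u₂ u₃ : Gm d}

theorem ev_slotPoly {u : Gm d} (hu : ev u = 0) (hm : m ≠ 0) (c : ℕ → ℝ) :
    ev (slotPoly m c u) = c 1 := by
  obtain ⟨k, rfl⟩ : ∃ k, m = k + 1 := ⟨m - 1, by omega⟩
  rw [slotPoly_succ]
  simp [hu]

variable (hd) in
/-- The terms of the transformation law that involve the second derivatives of the symmetry and
do not come from its restriction to the axis. -/
def extraTerm (m : ℕ) (c : ℕ → ℝ) (u₁ u₂ u₃ : Gm d) : ℝ :=
  -(m / 2) * ev (∂₁ u₁) * ev (∂₂ (∂₂ u₃)) * c 1 +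
    (ev (∂₁ u₁) * m * coeff m (T hd u₂) - m / 2 * (ev (∂₂ u₂) * ev (∂₂ (∂₁ u₁)) +
      ev (∂₁ u₁) * ev (∂₂ (∂₂ u₂)))) * c 3

/-- On the axis u₁, u₂ and ∂₁u₂ are divisible by X^m and ∂₁u₃ by X. Below degree m this leaves the
substitution of u₃ in the part with dx₁∧dx₃ and the product c₃ ∂₁u₁ ∂₃u₂, which starts only in
degree m - 1. -/
theorem SymJets.T_pulledCoef (h : SymJets hd m u₁ u₂ u₃) (c : ℕ → ℝ) {k : ℕ} (hk : k + 1 < m) :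
    coeff (k + 1) (T hd (pulledCoef m c u₁ u₂ u₃ (i₁ d hd) (i₃ d hd))) =
      coeff (k + 1) (slotPoly m c (T hd u₃) * (T hd (∂₁ u₁) * derivative ℝ (T hd u₃))) +
        if k + 2 = m then ev (∂₁ u₁) * m * coeff m (T hd u₂) * c 3 else 0 := by
  obtain ⟨n, rfl⟩ : ∃ n, m = n + 1 := ⟨m - 1, by omega⟩
  have hP := h.dvd₁
  have hder {p : PowerSeries ℝ} (hp : X ^ (n + 1) ∣ p) : X ^ n ∣ derivative ℝ p := by
    rw [X_pow_dvd_iff] at hp ⊢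
    intro i hi
    rw [coeff_derivative, hp _ (by omega), zero_mul]
  have hC : X ∣ T hd (∂₁ u₃) := X_dvd_iff.2 (by rw [constantCoeff_T, h.d₃₁])
  have e : T hd (pulledCoef (n + 1) c u₁ u₂ u₃ (i₁ d hd) (i₃ d hd)) =
      slotPoly (n + 1) c (T hd u₃) * (T hd (∂₁ u₁) * derivative ℝ (T hd u₃)) +
      (C (c 3) + c 4 • T hd u₃) * (T hd (∂₁ u₁) * derivative ℝ (T hd u₂)) +
      (-(slotPoly (n + 1) c (T hd u₃) * (T hd (∂₁ u₃) * derivative ℝ (T hd u₁))) +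
      (c 2 • 1 - c 4 • T hd u₁) *
        (T hd (∂₁ u₂) * derivative ℝ (T hd u₃) - T hd (∂₁ u₃) * derivative ℝ (T hd u₂)) -
      (C (c 3) + c 4 • T hd u₃) * (T hd (∂₁ u₂) * derivative ℝ (T hd u₁))) := by
    simp only [pulledCoef, minor, map_add, map_mul, map_sub, map_slotPoly, T_pd_three, map_smul,
      map_one, smul_eq_C_mul]
    ring
  have hXn {p q : PowerSeries ℝ} (hp : X ∣ p) (hq : X ^ n ∣ q) : X ^ (n + 1) ∣ p * q := by
    rw [pow_succ']; exact mul_dvd_mul hp hq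
  -- A derivative along the axis lowers the divisibility to X^(m-1); where that happens, the factor
  -- ∂₁u₃ restores the missing X.
  have hz : X ^ (n + 1) ∣
      -(slotPoly (n + 1) c (T hd u₃) * (T hd (∂₁ u₃) * derivative ℝ (T hd u₁))) +
      (c 2 • 1 - c 4 • T hd u₁) *
        (T hd (∂₁ u₂) * derivative ℝ (T hd u₃) - T hd (∂₁ u₃) * derivative ℝ (T hd u₂)) -
      (C (c 3) + c 4 • T hd u₃) * (T hd (∂₁ u₂) * derivative ℝ (T hd u₁)) :=
    dvd_sub (dvd_add (dvd_neg.2 ((hXn hC (hder h.dvd₁)).mul_left _))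
      ((dvd_sub (h.dvd₂₁.mul_right _) (hXn hC (hder h.dvd₂))).mul_left _))
      ((h.dvd₂₁.mul_right _).mul_left _)
  rw [e, map_add, map_add, X_pow_dvd_iff.1 hz _ (by omega), add_zero]
  congr 1
  obtain ⟨q, hq⟩ := hder h.dvd₂
  rw [hq, show (C (c 3) + c 4 • T hd u₃) * (T hd (∂₁ u₁) * (X ^ n * q)) =
    X ^ n * ((C (c 3) + c 4 • T hd u₃) * (T hd (∂₁ u₁) * q)) by ring, coeff_X_pow_mul']
  split_ifs with h1 h2 h2
  · obtain rfl : n = k + 1 := by omega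
    rw [Nat.sub_self, coeff_zero_eq_constantCoeff_apply]
    have h3 : coeff (k + 1) (derivative ℝ (T hd u₂)) = constantCoeff q := by
      rw [hq, coeff_X_pow_mul', if_pos le_rfl, Nat.sub_self, coeff_zero_eq_constantCoeff_apply]
    rw [coeff_derivative] at h3
    simp only [map_mul, map_add, ← h3, constantCoeff_T, constantCoeff_C, smul_eq_C_mul, h.ev₃]
    push_cast
    ring
  · omega
  · omega
  · rfl

/-- A diagonal linear part reduces the minors at 0 to products of its entries. Second derivatives
transverse to the axis enter only the coordinates 4 and μ, the two that differentiate a coefficient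
in a transverse direction. -/
theorem SymJets.crd_pulledCoef {μ : ℕ} (hμ : 5 < μ) (h : SymJets hd (μ - 3) u₁ u₂ u₃)
    (c : ℕ → ℝ) {c' : ℕ → ℝ}
    (hc' : c' = crd hd μ (pulledCoef (μ - 3) c u₁ u₂ u₃ (i₁ d hd) (i₂ d hd))
      (pulledCoef (μ - 3) c u₁ u₂ u₃ (i₁ d hd) (i₃ d hd))
      (pulledCoef (μ - 3) c u₁ u₂ u₃ (i₂ d hd) (i₃ d hd))) :
    c' 1 = ev (∂₁ u₁) * ev (∂₃ u₃) * c 1 ∧ c' 2 = ev (∂₂ u₂) * ev (∂₃ u₃) * c 2 ∧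
    c' 3 = ev (∂₁ u₁) * ev (∂₂ u₂) * c 3 ∧
    c' 4 = ev (∂₁ u₁) * ev (∂₂ u₂) * ev (∂₃ u₃) * c 4 +
      ev (∂₂ u₂) * coeff 1 (T hd (∂₁ u₁)) * c 3 - ev (∂₃ u₃) * ev (∂₁ (∂₂ u₁)) * c 1 -
      (ev (∂₃ u₃) * ev (∂₁ (∂₂ u₂)) + ev (∂₂ u₂) * ev (∂₁ (∂₃ u₃))) * c 2 ∧
    ∀ k, k + 1 < μ - 3 → c' (k + 5) =
      coeff (k + 1) (slotPoly (μ - 3) c (T hd u₃) * (T hd (∂₁ u₁) * derivative ℝ (T hd u₃))) +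
      if k + 5 = μ then extraTerm hd (μ - 3) c u₁ u₂ u₃ else 0 := by
  have hm : μ - 3 ≠ 0 := by omega
  have hd₃₂' := h.mixed
  rw [pd_comm] at hd₃₂'
  subst hc'
  refine ⟨?_, ?_, ?_, ?_, fun k hk => ?_⟩
  · simp [crd, pulledCoef, minor, ev_slotPoly h.ev₃ hm, h.ev₁, h.ev₃, h.d₁₃, h.d₂₁, h.d₂₃,
      h.d₃₁]
    ring
  · simp [crd, pulledCoef, minor, ev_slotPoly h.ev₃ hm, h.ev₁, h.ev₃, h.d₁₃, h.d₁₂, h.d₂₃,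
      h.d₃₂]
    ring
  · simp [crd, pulledCoef, minor, ev_slotPoly h.ev₃ hm, h.ev₁, h.ev₃, h.d₁₂, h.d₂₁,
      h.d₃₁, h.d₃₂]
    ring
  · rw [coeff_one_T, pd_comm (i₃ d hd)]
    simp [crd, pulledCoef, minor, ev_slotPoly h.ev₃ hm, h.ev₁, h.ev₃, h.d₁₂, h.d₁₃,
      h.d₂₃, h.d₃₁, h.d₃₂, h.mixed]
    ring
  · rw [crd, h.T_pulledCoef c hk]
    by_cases hk' : k + 5 = μ
    · rw [if_pos hk', if_pos hk', if_pos (by omega)]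
      simp [extraTerm, pulledCoef, minor, ev_slotPoly h.ev₃ hm, h.ev₁, h.ev₃, h.d₁₂, h.d₂₁, h.d₃₁,
        h.d₃₂, hd₃₂']
      ring
    · rw [if_neg hk', if_neg hk', if_neg (by omega), add_zero, sub_zero]

/-- Terms with j > k have too high an order, so only the first nonzero slot contributes. -/
theorem coeff_slotPoly_mul {c : ℕ → ℝ} {k : ℕ} (hk : k < m) (h0 : ∀ j < k, slot c j = 0)
    (b q : PowerSeries ℝ) :
    coeff k (slotPoly m c (X * b) * q) = slot c k * (constantCoeff b ^ k * constantCoeff q) := by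
  rw [slotPoly, Finset.sum_mul, map_sum, Finset.sum_eq_single k]
  · rw [smul_mul_assoc, map_smul, mul_pow, mul_assoc, coeff_X_pow_mul', if_pos le_rfl,
      Nat.sub_self, coeff_zero_eq_constantCoeff_apply, map_mul, map_pow, smul_eq_mul]
  · intro j _ hj
    rcases lt_or_gt_of_ne hj with h | h
    · rw [h0 j h, zero_smul, zero_mul, map_zero]
    · rw [smul_mul_assoc, map_smul, mul_pow, mul_assoc, coeff_X_pow_mul', if_neg (by omega),
        smul_zero]
  · intro h
    exact absurd (Finset.mem_range.2 hk) h

theorem coeff_one_mul' (p q : PowerSeries ℝ) :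
    coeff 1 (p * q) = constantCoeff p * coeff 1 q + coeff 1 p * constantCoeff q := by
  rw [coeff_mul, Finset.Nat.antidiagonal_succ]
  simp

theorem coeff_one_pow_eq_zero {b : PowerSeries ℝ} (hb : coeff 1 b = 0) (n : ℕ) :
    coeff 1 (b ^ n) = 0 := by
  induction n with
  | zero => simp [coeff_one]
  | succ n ih => rw [pow_succ, coeff_one_mul', hb, ih]; simp

/-- Slot k could reach degree k + 1 only through the linear terms of b and q, which are absent. -/
theorem coeff_succ_slotPoly_mul {c : ℕ → ℝ} {k : ℕ} (hk : k + 1 < m) (h0 : ∀ j < k, slot c j = 0)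
    {b q : PowerSeries ℝ} (hb : coeff 1 b = 0) (hq : coeff 1 q = 0) :
    coeff (k + 1) (slotPoly m c (X * b) * q) =
      slot c (k + 1) * (constantCoeff b ^ (k + 1) * constantCoeff q) := by
  rw [slotPoly, Finset.sum_mul, map_sum, Finset.sum_eq_single (k + 1)]
  · rw [smul_mul_assoc, map_smul, mul_pow, mul_assoc, coeff_X_pow_mul', if_pos le_rfl,
      Nat.sub_self, coeff_zero_eq_constantCoeff_apply, map_mul, map_pow, smul_eq_mul]
  · intro j _ hj
    rcases lt_trichotomy j k with h | rfl | h
    · rw [h0 j h, zero_smul, zero_mul, map_zero]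
    · rw [smul_mul_assoc, map_smul, mul_pow, mul_assoc, coeff_X_pow_mul', if_pos (by omega),
        Nat.add_sub_cancel_left, coeff_one_mul', coeff_one_pow_eq_zero hb, hq]
      simp
    · rw [smul_mul_assoc, map_smul, mul_pow, mul_assoc, coeff_X_pow_mul', if_neg (by omega),
        smul_zero]
  · intro h
    exact absurd (Finset.mem_range.2 hk) h

/-- The relation between the coordinates of an algebraic restriction and those of its pullback
under a symmetry with linear part `diag(α, a, γ)`. -/
structure Transforms (m : ℕ) (α a γ : ℝ) (c c' : ℕ → ℝ) : Prop where
  sq_left : α ^ 2 = γ ^ m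
  sq_right : a ^ 2 = γ ^ m
  ne_zero : γ ≠ 0
  one : c' 1 = α * γ * c 1
  two : c' 2 = a * γ * c 2
  three : c' 3 = α * a * c 3
  four : c 1 = 0 → c 2 = 0 → c 3 = 0 → c' 4 = α * a * γ * c 4
  lead : ∀ k < m, (k + 1 < m ∨ c 1 = 0 ∧ c 3 = 0) → (∀ j < k, slot c j = 0) →
    slot c' k = α * γ ^ (k + 1) * slot c k
  next : c 1 = 0 → c 2 = 0 → c 3 ≠ 0 → c 4 = 0 → c' 4 = 0 → ∀ k, k + 2 < m →
    (∀ j < k, slot c j = 0) → slot c' (k + 1) = α * γ ^ (k + 2) * slot c (k + 1)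

/-- The clause `lead` needs its alternative because the last slot, θ_μ, also receives `extraTerm`, a
combination of c₁ and c₃. -/
theorem IsSymmetry.transforms {μ : ℕ} (hμ : 5 < μ) {Φ : E d → E d}
    (hΦ : IsSymmetry (curve d hd μ) Φ) (c : ℕ → ℝ) :
    ∃ α a γ, Transforms (μ - 3) α a γ c (coords hd μ (hΦ.pull (comb hd μ c))) := by
  have h := hΦ.symJets hμ
  obtain ⟨h1, h2, h3, h4, h5⟩ := h.crd_pulledCoef hμ c
    (c' := coords hd μ (hΦ.pull (comb hd μ c))) (by simp only [coords, hΦ.coef_pull_comb hμ])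
  set u₁ := hΦ.comp (i₁ d hd)
  set u₂ := hΦ.comp (i₂ d hd)
  set u₃ := hΦ.comp (i₃ d hd)
  set c' := coords hd μ (hΦ.pull (comb hd μ c))
  obtain ⟨b, hb⟩ : X ∣ T hd u₃ := X_dvd_iff.2 (by rw [constantCoeff_T, h.ev₃])
  have hbc (n : ℕ) : coeff (n + 1) (T hd u₃) = coeff n b := by rw [hb, coeff_succ_X_mul]
  have hb0 : constantCoeff b = ev (∂₃ u₃) := by
    rw [← coeff_one_T, ← coeff_zero_eq_constantCoeff_apply, ← hbc]
  have hq : constantCoeff (T hd (∂₁ u₁) * derivative ℝ (T hd u₃)) = ev (∂₁ u₁) * ev (∂₃ u₃) := by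
    rw [map_mul, ← T_pd_three, constantCoeff_T, constantCoeff_T]
  refine ⟨ev (∂₁ u₁), ev (∂₂ u₂), ev (∂₃ u₃), h.sq₁, h.sq₂, h.ne₃, h1, h2, h3, ?_, ?_, ?_⟩
  · intro e1 e2 e3
    rw [h4, e1, e2, e3]
    ring
  · intro k hk hor h0
    rcases k with _ | k
    · simp [slot, h1]
    · rw [slot, if_neg (by omega), h5 k hk, hb, coeff_slotPoly_mul hk h0, ← hb, hq, hb0]
      have : (if k + 5 = μ then extraTerm hd (μ - 3) c u₁ u₂ u₃ else 0) = 0 := by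
        split_ifs with hk'
        · rcases hor with h | ⟨e1, e3⟩
          · omega
          · simp [extraTerm, e1, e3]
        · rfl
      rw [this]
      ring
  · intro e1 e2 e3 e4 e4' k hk h0
    rw [h4, e1, e2, e4] at e4'
    -- Under these hypotheses c'₄ is a nonzero multiple of c₃ times the coefficient of x₃ in ∂₁u₁. A
    -- symmetry that keeps θ₄ absent thus has no such term; by `second` the coefficient of x₃² in u₃
    -- is zero too, and the slot after the first nonzero one is merely rescaled.
    have hA : coeff 1 (T hd (∂₁ u₁)) = 0 := by
      simpa [h.ne₂, e3] using e4'
    have hB := h.second hA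
    rw [slot, if_neg (by omega), h5 k (by omega), if_neg (by omega), hb,
      coeff_succ_slotPoly_mul (by omega) h0, ← hb, hq, hb0]
    · ring
    · rw [← hbc, hB]
    · rw [← hb, coeff_one_mul', hA, coeff_derivative, hB]
      simp

end

end SMu

namespace SMu

/-! ## The tangent spaces to the orbits -/

open PowerSeries

section
variable {d : ℕ}

theorem curryLeft_eq_sum (ζ : E d [⋀^Fin 2]→L[ℝ] ℝ) (v w : E d) :
    ContinuousAlternatingMap.curryLeft (n := 1) ζ v ![w] = ∑ k, v k * ζ ![bv k, w] := by
  have h : v = ∑ k, v k • bv k := by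
    ext j
    simp [Finset.sum_apply, Pi.single_apply]
  let f : E d →ₗ[ℝ] ℝ :=
    { toFun := fun u => ContinuousAlternatingMap.curryLeft (n := 1) ζ u ![w]
      map_add' := fun u u' => by simp only [map_add]; rfl
      map_smul' := fun c u => by simp only [map_smul]; rfl }
  change f v = _
  conv_lhs => rw [h, map_sum]
  simp only [map_smul]
  rfl

/-- The `1`-form `V ⌟ η`. -/
def contract {V : E d → E d} (hV : ∀ k, IsSm fun x => V x k) (η : SmoothForm d 2) :
    SmoothForm d 1 :=
  ⟨fun x => ContinuousAlternatingMap.curryLeft (n := 1) (η.1 x) (V x), by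
    refine contDiffAt_of_coef₁ fun j => ?_
    have h : IsSm fun x => ∑ k, V x k * η.1 x ![bv k, bv j] :=
      isSm_sum fun k _ => (hV k).mul (isSm_form_apply η _)
    simpa only [curryLeft_eq_sum] using h⟩

theorem coef₁_contract {V : E d → E d} (hV : ∀ k, IsSm fun x => V x k) (η : SmoothForm d 2)
    (j : Fin d) : coef₁ (contract hV η) j = ∑ k, germ (fun x => V x k) (hV k) * coef k j η := by
  simp only [coef_apply, germ_mul]
  rw [germ_sum, coef₁, germ_eq_iff]
  exact Filter.Eventually.of_forall fun x => curryLeft_eq_sum _ _ _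

theorem coef_of_eq_lieClosed {V : E d → E d} (hV : ∀ k, IsSm fun x => V x k)
    {η τ : SmoothForm d 2} (h : τ.1 =ᶠ[𝓝 0] lieClosed V η.1) (i j : Fin d) :
    coef i j τ = pd i (∑ k, germ (fun x => V x k) (hV k) * coef k j η) -
      pd j (∑ k, germ (fun x => V x k) (hV k) * coef k i η) := by
  rw [← coef₁_contract, ← coef₁_contract, ← coef_dForm]
  exact coef_congr h i j

theorem IsTangentField.isSm {N : Set (E d)} {V : E d → E d} (hV : IsTangentField N V)
    (k : Fin d) : IsSm fun x => V x k := by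
  filter_upwards [hV.1] with x hx
  exact contDiffAt_pi.1 hx k

theorem IsTangentField.van {N : Set (E d)} {V : E d → E d} (hV : IsTangentField N V)
    {r : Gm d} (hr : Van N r) : Van N (∑ k, germ (fun x => V x k) (hV.isSm k) * pd k r) := by
  obtain ⟨f, hf, rfl, h⟩ := hr
  have hs : ∑ k, germ (fun x => V x k) (hV.isSm k) * pd k (germ f hf) =
      germ (fun x => ∑ k, V x k * fderiv ℝ f x (bv k))
        (isSm_sum fun k _ => (hV.isSm k).mul (hf.fderiv_apply _)) := by
    simp only [pd_germ, germ_mul]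
    rw [germ_sum]
  refine ⟨_, _, hs, ?_⟩
  filter_upwards [hV.2 f hf h] with x hx hN
  rw [← hx hN]
  have h : V x = ∑ k, V x k • bv k := by
    ext j
    simp [Finset.sum_apply, Pi.single_apply]
  conv_rhs => rw [h, map_sum]
  simp

theorem Van.add {N : Set (E d)} {r s : Gm d} (hr : Van N r) (hs : Van N s) : Van N (r + s) := by
  obtain ⟨f, hf, rfl, h⟩ := hr
  obtain ⟨g, hg, rfl, h'⟩ := hs
  refine ⟨_, _, germ_add _ _, ?_⟩
  filter_upwards [h, h'] with x hx hx' hN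
  rw [hx hN, hx' hN, add_zero]

theorem Van.sum {N : Set (E d)} {ι : Type*} (s : Finset ι) {r : ι → Gm d}
    (h : ∀ i, Van N (r i)) : Van N (∑ i ∈ s, r i) := by
  classical
  induction s using Finset.induction_on with
  | empty => exact ⟨fun _ => 0, isSm_const 0, rfl, Filter.Eventually.of_forall fun _ _ => rfl⟩
  | insert a s ha ih => rw [Finset.sum_insert ha]; exact (h a).add ih

end

/-! ### Jets of vector fields tangent to S_μ and their action on the coordinates. -/

section
variable {d : ℕ} {hd : 3 ≤ d}

local notation "x₁" => coord (i₁ d hd)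
local notation "x₂" => coord (i₂ d hd)
local notation "x₃" => coord (i₃ d hd)
local notation "∂₁" => pd (i₁ d hd)
local notation "∂₂" => pd (i₂ d hd)
local notation "∂₃" => pd (i₃ d hd)

theorem coef_comb {μ : ℕ} (hμ : 5 < μ) (c : ℕ → ℝ) (i j : Fin d) :
    coef i j (comb hd μ c) = pulledCoef (μ - 3) c x₁ x₂ x₃ i j := by
  rw [← coef_congr (Filter.EventuallyEq.of_eq (pull_id_val (N := Set.univ) (comb hd μ c))),
    IsSymmetry.coef_pull_comb hμ]
  rfl

theorem coef_comb_of_three_le {μ : ℕ} (hμ : 5 < μ) (c : ℕ → ℝ) {i : Fin d} (hi : 3 ≤ (i : ℕ))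
    (j : Fin d) : coef i j (comb hd μ c) = 0 := by
  obtain ⟨h1, h2, h3⟩ := ne_of_three_le hd hi
  simp [coef_comb hμ, pulledCoef, minor, pd_coord, h1, h2, h3]

/-- The coefficients of `V ⌟ ∑ c_i θ_i`, where `V` has components `v₁, v₂, v₃, …`. -/
theorem sum_mul_coef_comb {μ : ℕ} (hμ : 5 < μ) (c : ℕ → ℝ) (v : Fin d → Gm d) :
    ∑ k, v k * coef k (i₁ d hd) (comb hd μ c) =
      -(v (i₂ d hd) * (c 3 • 1 + c 4 • x₃)) - v (i₃ d hd) * slotPoly (μ - 3) c x₃ ∧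
    ∑ k, v k * coef k (i₂ d hd) (comb hd μ c) =
      v (i₁ d hd) * (c 3 • 1 + c 4 • x₃) - v (i₃ d hd) * (c 2 • 1 - c 4 • x₁) ∧
    ∑ k, v k * coef k (i₃ d hd) (comb hd μ c) =
      v (i₁ d hd) * slotPoly (μ - 3) c x₃ + v (i₂ d hd) * (c 2 • 1 - c 4 • x₁) := by
  have n12 := i₁_ne_i₂ hd
  have n13 := i₁_ne_i₃ hd
  have n23 := i₂_ne_i₃ hd
  have h (j : Fin d) : ∑ k ∈ Finset.univ.filter (fun k : Fin d => 3 ≤ (k : ℕ)),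
      v k * coef k j (comb hd μ c) = 0 :=
    Finset.sum_eq_zero fun k hk => by
      rw [coef_comb_of_three_le hμ c (Finset.mem_filter.1 hk).2, mul_zero]
  refine ⟨?_, ?_, ?_⟩ <;> rw [sum_fin_eq hd, h] <;>
    simp [coef_comb hμ, pulledCoef, minor, pd_coord, n12, n13, n23, n12.symm, n13.symm,
      n23.symm] <;> ring

theorem pd_two (i : Fin d) : pd i (2 : Gm d) = 0 := Derivation.map_natCast (pd i) 2

theorem pd_three (i : Fin d) : pd i (3 : Gm d) = 0 := Derivation.map_natCast (pd i) 3

/-- The properties of the components `v₁, v₂, v₃` of a vector field tangent to `S_μ`. -/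
structure FieldJets (hd : 3 ≤ d) (m : ℕ) (v₁ v₂ v₃ : Gm d) : Prop where
  ev₁ : ev v₁ = 0
  ev₂ : ev v₂ = 0
  ev₃ : ev v₃ = 0
  d₁₂ : ev (pd (i₂ d hd) v₁) = 0
  d₁₃ : ev (pd (i₃ d hd) v₁) = 0
  d₂₁ : ev (pd (i₁ d hd) v₂) = 0
  d₂₂ : ev (pd (i₂ d hd) v₂) = ev (pd (i₁ d hd) v₁)
  d₂₃ : ev (pd (i₃ d hd) v₂) = 0
  d₃₁ : ev (pd (i₁ d hd) v₃) = 0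
  d₃₂ : ev (pd (i₂ d hd) v₃) = 0
  rel : m * ev (pd (i₃ d hd) v₃) = 2 * ev (pd (i₁ d hd) v₁)
  dvd₂ : X ^ m ∣ T hd v₂
  dvd₂₁ : X ^ m ∣ T hd (pd (i₁ d hd) v₂)
  mixed : ev (pd (i₁ d hd) (pd (i₂ d hd) v₃)) = 0
  second : m * coeff 2 (T hd v₃) = 2 * coeff 1 (T hd (pd (i₁ d hd) v₁))

/-- This is the linearisation of `symJets_of_van`. Since x₂ = 0 and x₃ = t² on the arcs, v₂ is flat
there; since x₃ = 0 and x₂ = t on the lines, v₃ is flat there. That the field vanishes at 0 is a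
consequence, not an assumption. -/
theorem fieldJets_of_van {m : ℕ} (hm3 : 3 ≤ m) (hm : m ≠ 0) {v₁ v₂ v₃ : Gm d}
    (hC : FlatCusp hd hm (v₂ * x₃ + v₃ * x₂)) (hL : FlatLine hd (v₂ * x₃ + v₃ * x₂))
    (hC' : FlatCusp hd hm (2 * x₁ * v₁ - 2 * x₂ * v₂ - (m : Gm d) * x₃ ^ (m - 1) * v₃))
    (hL' : FlatLine hd (2 * x₁ * v₁ - 2 * x₂ * v₂ - (m : Gm d) * x₃ ^ (m - 1) * v₃)) :
    FieldJets hd m v₁ v₂ v₃ := by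
  have n12 := i₁_ne_i₂ hd
  have n13 := i₁_ne_i₃ hd
  have n23 := i₂_ne_i₃ hd
  obtain ⟨k, hk⟩ : ∃ k, m = k + 3 := ⟨m - 3, by omega⟩
  have hC₂ : FlatCusp hd hm v₂ := by
    refine ⟨?_, ?_⟩
    · simpa [Γ_coord, n12.symm, n23, n13.symm] using hC.pos
    · simpa [Γ_coord, n12.symm, n23, n13.symm] using hC.neg
  have hL₃ : FlatLine hd v₃ := by
    refine ⟨?_, ?_⟩
    · simpa [Λ_coord, n12.symm, n23.symm, n13.symm] using hL.pos
    · simpa [Λ_coord, n12.symm, n23.symm, n13.symm] using hL.neg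
  have dvd₂ := hC₂.dvd_T_self
  have dvd₂₁ := hC₂.dvd_T_pd
  have ev3 := hL₃.ev_eq_zero
  have hX3 : X ∣ T hd (∂₁ v₃) := X_dvd_iff.2 (by rw [constantCoeff_T, hL₃.ev_pd.1])
  have dvd₁ : X ^ m ∣ T hd v₁ := by
    have h := hC'.dvd_T_pd
    have e : T hd (∂₁ (2 * x₁ * v₁ - 2 * x₂ * v₂ - (m : Gm d) * x₃ ^ (m - 1) * v₃)) =
        T hd v₁ * 2 - X ^ (m - 1) * T hd (∂₁ v₃) * (m : PowerSeries ℝ) := by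
      rw [hk]
      simp [Derivation.leibniz_pow, pd_two, pd_three, pd_coord, T_coord, n12, n13, n23, map_ofNat]
      ring
    rw [e, dvd_sub_left] at h
    · refine (IsUnit.dvd_mul_right ?_).1 h
      rw [isUnit_iff_constantCoeff, map_ofNat]
      exact two_ne_zero.isUnit
    · refine Dvd.dvd.mul_right ?_ _
      have : X ^ m = (X : PowerSeries ℝ) ^ (m - 1) * X := by
        rw [← pow_succ]; congr 1; omega
      rw [this]
      exact mul_dvd_mul_left _ hX3
  -- Taken modulo X^(2m-1), `dvd_T` allows cancelling the factor X^(m-1). The coefficients of X and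
  -- X² then give the fields `rel` and `second`.
  have key : X ^ m ∣ T hd (∂₁ v₁) * X * 2 - T hd v₃ * (m : PowerSeries ℝ) := by
    have h := (pow_dvd_pow (X : PowerSeries ℝ) (by omega : m - 1 + m ≤ 2 * m)).trans hC'.dvd_T
    have e : T hd (2 * x₁ * v₁ - 2 * x₂ * v₂ - (m : Gm d) * x₃ ^ (m - 1) * v₃) +
        (C (1 / 2 : ℝ) : PowerSeries ℝ) * X ^ m *
          T hd (∂₁ (∂₁ (2 * x₁ * v₁ - 2 * x₂ * v₂ - (m : Gm d) * x₃ ^ (m - 1) * v₃))) =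
        X ^ (m - 1) * (T hd (∂₁ v₁) * X * 2 - T hd v₃ * (m : PowerSeries ℝ)) -
          C (1 / 2 : ℝ) * (X ^ (m - 1) * X ^ m) * T hd (∂₁ (∂₁ v₃)) * (m : PowerSeries ℝ) := by
      have e0 : (C (1 / 2 : ℝ) : PowerSeries ℝ) * 2 = 1 := by
        rw [← map_ofNat C 2, ← map_mul]; norm_num
      rw [hk]
      simp [Derivation.leibniz_pow, pd_two, pd_three, pd_coord, T_coord, n12, n13, n23, map_ofNat]
      rw [one_div] at e0
      linear_combination (X ^ (k + 3) * T hd (∂₁ v₁) * 2) * e0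
    rw [e, dvd_sub_left] at h
    · rw [pow_add] at h
      exact (mul_dvd_mul_iff_left (pow_ne_zero _ X_ne_zero)).1 h
    · rw [pow_add, mul_assoc, mul_assoc]
      exact ((dvd_mul_right _ _).mul_left _)
  have hkey (n : ℕ) (hn : n + 1 < m) :
      coeff n (T hd (∂₁ v₁)) * 2 - coeff (n + 1) (T hd v₃) * m = 0 := by
    have := X_pow_dvd_iff.1 key (n + 1) hn
    rwa [map_sub, ← map_natCast C, coeff_mul_C, ← map_ofNat C 2, coeff_mul_C, coeff_succ_mul_X]
      at this
  have l1 := hL'.ev_pd_pd.1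
  have l2 := hL'.ev_pd_pd.2
  rw [hk] at l1 l2
  simp [Derivation.leibniz_pow, pd_two, pd_three, pd_coord, n12, n13, n23, n12.symm,
    map_ofNat] at l1 l2
  have c1 : coeff 1 (T hd v₁) = 0 := X_pow_dvd_iff.1 dvd₁ 1 (by omega)
  have c2 : coeff 1 (T hd v₂) = 0 := X_pow_dvd_iff.1 dvd₂ 1 (by omega)
  have c3 : coeff 0 (T hd (∂₁ v₂)) = 0 := X_pow_dvd_iff.1 dvd₂₁ 0 (by omega)
  have c4 : coeff 0 (T hd v₁) = 0 := X_pow_dvd_iff.1 dvd₁ 0 (by omega)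
  have c5 : coeff 0 (T hd v₂) = 0 := X_pow_dvd_iff.1 dvd₂ 0 (by omega)
  rw [coeff_one_T] at c1 c2
  rw [coeff_zero_eq_constantCoeff_apply, constantCoeff_T] at c3 c4 c5
  refine ⟨c4, c5, ev3, ?_, c1, c3, ?_, c2, hL₃.ev_pd.1, hL₃.ev_pd.2, ?_, dvd₂, dvd₂₁,
    hL₃.ev_pd_pd.1, ?_⟩
  · rw [c3] at l1
    linarith
  · linarith
  · have := hkey 0 (by omega)
    rw [zero_add, coeff_one_T, coeff_zero_eq_constantCoeff_apply, constantCoeff_T] at this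
    linarith
  · linarith [hkey 1 (by omega)]

theorem IsTangentField.fieldJets {μ : ℕ} (hμ : 5 < μ) {V : E d → E d}
    (hV : IsTangentField (curve d hd μ) V) :
    FieldJets hd (μ - 3) (germ (fun x => V x (i₁ d hd)) (hV.isSm _))
      (germ (fun x => V x (i₂ d hd)) (hV.isSm _)) (germ (fun x => V x (i₃ d hd)) (hV.isSm _)) := by
  have hm : μ - 3 ≠ 0 := by omega
  have n12 := i₁_ne_i₂ hd
  have n13 := i₁_ne_i₃ hd
  have n23 := i₂_ne_i₃ hd
  have v1 : Van (curve d hd μ) (x₂ * x₃) := ⟨_, _, germ_mul _ _,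
    Filter.Eventually.of_forall fun x hx => hx.2.1⟩
  have v2 : Van (curve d hd μ) (x₁ ^ 2 - x₂ ^ 2 - x₃ ^ (μ - 3)) :=
    ⟨fun x => x (i₁ d hd) ^ 2 - x (i₂ d hd) ^ 2 - x (i₃ d hd) ^ (μ - 3),
      (((isSm_coord _).pow 2).sub ((isSm_coord _).pow 2)).sub ((isSm_coord _).pow _), rfl,
      Filter.Eventually.of_forall fun x hx => hx.1⟩
  have w1 := hV.van v1
  have w2 := hV.van v2
  have hz {f : Fin d → Gm d} (hf : ∀ j : Fin d, 3 ≤ (j : ℕ) → f j = 0) :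
      ∑ j ∈ Finset.univ.filter (fun j : Fin d => 3 ≤ (j : ℕ)), f j = 0 :=
    Finset.sum_eq_zero fun j hj => hf j (Finset.mem_filter.1 hj).2
  rw [sum_fin_eq hd, hz fun j hj => by
    obtain ⟨h1, h2, h3⟩ := ne_of_three_le hd hj
    simp [pd_coord, h2, h3]] at w1
  rw [sum_fin_eq hd, hz fun j hj => by
    obtain ⟨h1, h2, h3⟩ := ne_of_three_le hd hj
    simp [pd_coord, h1, h2, h3, Derivation.leibniz_pow]] at w2
  have e1 : ∀ v₁ v₂ v₃ : Gm d, v₁ * ∂₁ (x₂ * x₃) + v₂ * ∂₂ (x₂ * x₃) + v₃ * ∂₃ (x₂ * x₃) + 0 =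
      v₂ * x₃ + v₃ * x₂ := fun v₁ v₂ v₃ => by
    simp [pd_coord, n12, n13, n23, n23.symm]
  have e2 : ∀ v₁ v₂ v₃ : Gm d, v₁ * ∂₁ (x₁ ^ 2 - x₂ ^ 2 - x₃ ^ (μ - 3)) +
      v₂ * ∂₂ (x₁ ^ 2 - x₂ ^ 2 - x₃ ^ (μ - 3)) + v₃ * ∂₃ (x₁ ^ 2 - x₂ ^ 2 - x₃ ^ (μ - 3)) + 0 =
      2 * x₁ * v₁ - 2 * x₂ * v₂ - ((μ - 3 : ℕ) : Gm d) * x₃ ^ (μ - 3 - 1) * v₃ :=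
    fun v₁ v₂ v₃ => by
    simp [pd_coord, n12, n13, n23, n12.symm, n13.symm, n23.symm, Derivation.leibniz_pow,
      nsmul_eq_mul, -Nat.cast_sub]
    ring
  rw [e1] at w1
  rw [e2] at w2
  exact fieldJets_of_van (by omega) hm (w1.flatCusp hd hm) (w1.flatLine hd hμ)
    (w2.flatCusp hd hm) (w2.flatLine hd hμ)

/-- The relation between the coordinates of an algebraic restriction `a` and those of `L_V a` for
a tangent vector field `V` with linear part `diag(l₁, l₁, l₃)`. -/
structure Varies (m : ℕ) (l₁ l₃ : ℝ) (c c' : ℕ → ℝ) : Prop where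
  rel : m * l₃ = 2 * l₁
  one : c' 1 = (l₁ + l₃) * c 1
  two : c' 2 = (l₁ + l₃) * c 2
  three : c' 3 = 2 * l₁ * c 3
  four : c 1 = 0 → c 2 = 0 → c 3 = 0 → c' 4 = (2 * l₁ + l₃) * c 4
  lead : ∀ k < m, (k + 1 < m ∨ c 1 = 0 ∧ c 3 = 0) → (∀ j < k, slot c j = 0) →
    slot c' k = (l₁ + (k + 1) * l₃) * slot c k
  next : c 1 = 0 → c 2 = 0 → c 3 ≠ 0 → c' 4 = (2 * l₁ + l₃) * c 4 → ∀ k, k + 2 < m →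
    (∀ j < k, slot c j = 0) → slot c' (k + 1) = (l₁ + (k + 2) * l₃) * slot c (k + 1)

theorem pd_slotPoly (i : Fin d) (m : ℕ) (c : ℕ → ℝ) {u : Gm d} (hu : pd i u = 0) :
    pd i (slotPoly m c u) = 0 := by
  simp [slotPoly, Derivation.leibniz_pow, hu]

/-- The germs n₁, n₂, n₃ are the coefficients of V ⌟ ∑ c_i θ_i, so the coordinates are those of its
exterior derivative. The estimates parallel those for symmetries. -/
theorem FieldJets.varies {μ : ℕ} (hμ : 5 < μ) {v₁ v₂ v₃ : Gm d}
    (h : FieldJets hd (μ - 3) v₁ v₂ v₃) (c : ℕ → ℝ) {n₁ n₂ n₃ : Gm d}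
    (hn₁ : n₁ = -(v₂ * (c 3 • 1 + c 4 • x₃)) - v₃ * slotPoly (μ - 3) c x₃)
    (hn₂ : n₂ = v₁ * (c 3 • 1 + c 4 • x₃) - v₃ * (c 2 • 1 - c 4 • x₁))
    (hn₃ : n₃ = v₁ * slotPoly (μ - 3) c x₃ + v₂ * (c 2 • 1 - c 4 • x₁)) :
    Varies (μ - 3) (ev (∂₁ v₁)) (ev (∂₃ v₃)) c
      (crd hd μ (∂₁ n₂ - ∂₂ n₁) (∂₁ n₃ - ∂₃ n₁) (∂₂ n₃ - ∂₃ n₂)) := by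
  have hm : μ - 3 ≠ 0 := by omega
  have n12 := i₁_ne_i₂ hd
  have n13 := i₁_ne_i₃ hd
  have n23 := i₂_ne_i₃ hd
  have eF : ev (slotPoly (μ - 3) c x₃) = c 1 := ev_slotPoly (ev_coord _) hm c
  have F1 : ∂₁ (slotPoly (μ - 3) c x₃) = 0 := pd_slotPoly _ _ _ (by simp [pd_coord, n13])
  have F2 : ∂₂ (slotPoly (μ - 3) c x₃) = 0 := pd_slotPoly _ _ _ (by simp [pd_coord, n23])
  have mixed' := h.mixed
  rw [pd_comm] at mixed'
  set c' := crd hd μ (∂₁ n₂ - ∂₂ n₁) (∂₁ n₃ - ∂₃ n₁) (∂₂ n₃ - ∂₃ n₂) with hc'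
  have four : c' 4 = (2 * ev (∂₁ v₁) + ev (∂₃ v₃)) * c 4 + coeff 1 (T hd (∂₁ v₁)) * c 3 -
      (ev (∂₁ (∂₂ v₁)) * c 1 + (ev (∂₁ (∂₂ v₂)) + ev (∂₁ (∂₃ v₃))) * c 2) := by
    rw [coeff_one_T, pd_comm (i₃ d hd)]
    simp [hc', crd, hn₂, hn₃, eF, F1, F2, pd_coord, h.d₂₂, n13, n12.symm, n13.symm]
    ring
  have slots : ∀ k, k + 1 < μ - 3 → (k + 2 < μ - 3 ∨ c 1 = 0 ∧ c 3 = 0) → c' (k + 5) =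
      coeff (k + 1) (slotPoly (μ - 3) c X * T hd (∂₁ v₁)) +
        (k + 2) * coeff (k + 2) (slotPoly (μ - 3) c X * T hd v₃) := by
    intro k hk hor
    have hx₁ : ∂₁ x₁ = 1 := by simp [pd_coord]
    have e : T hd (∂₁ n₃ - ∂₃ n₁) = slotPoly (μ - 3) c X * T hd (∂₁ v₁) +
        (T hd (∂₁ v₂) * C (c 2) - T hd v₂ * C (c 4)) +
        derivative ℝ (T hd v₂ * (C (c 3) + C (c 4) * X) + slotPoly (μ - 3) c X * T hd v₃) := by
      simp only [hn₁, hn₃, map_sub, map_add, map_neg, T_pd_three, Derivation.leibniz, F1, map_mul,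
        map_slotPoly, T_coord, smul_eq_mul, map_smul, smul_eq_C_mul, map_one,
        if_neg n13, map_zero, Derivation.map_one_eq_zero]
      simp [hx₁, smul_eq_C_mul]
      ring
    have h1 : coeff (k + 1) (T hd (∂₁ v₂) * C (c 2) - T hd v₂ * C (c 4)) = 0 :=
      X_pow_dvd_iff.1 (dvd_sub (h.dvd₂₁.mul_right _) (h.dvd₂.mul_right _)) _ (by omega)
    have h2 : coeff (k + 2) (T hd v₂ * (C (c 3) + C (c 4) * X)) = 0 := by
      rcases hor with h' | h'
      · exact X_pow_dvd_iff.1 (h.dvd₂.mul_right _) _ h'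
      · rw [h'.2, map_zero, zero_add, mul_comm (C (c 4)), ← mul_assoc, coeff_mul_C,
          coeff_succ_mul_X, X_pow_dvd_iff.1 h.dvd₂ _ (by omega), zero_mul]
    have h3 : (if k + 5 = μ then ((μ - 3 : ℕ) / 2 : ℝ) * ev (∂₂ (∂₁ n₂ - ∂₂ n₁)) else 0) = 0 := by
      split_ifs with hk'
      · rcases hor with h' | h'
        · omega
        · simp [hn₁, hn₂, F2, eF, h'.1, h'.2, pd_coord, h.d₃₂, mixed',
            n13, n23, n12.symm]
      · rfl
    rw [hc', crd, h3, sub_zero, e, map_add, map_add, h1, coeff_derivative, map_add, h2]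
    push_cast
    ring
  obtain ⟨b, hb⟩ : X ∣ T hd v₃ := X_dvd_iff.2 (by rw [constantCoeff_T, h.ev₃])
  have hbc (n : ℕ) : coeff (n + 1) (T hd v₃) = coeff n b := by rw [hb, coeff_succ_X_mul]
  have hb0 : constantCoeff b = ev (∂₃ v₃) := by
    rw [← coeff_one_T, ← coeff_zero_eq_constantCoeff_apply, ← hbc]
  have hGb (n : ℕ) : coeff (n + 2) (slotPoly (μ - 3) c X * T hd v₃) =
      coeff (n + 1) (slotPoly (μ - 3) c X * b) := by
    rw [hb, show slotPoly (μ - 3) c X * (X * b) = X * (slotPoly (μ - 3) c X * b) by ring,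
      coeff_succ_X_mul]
  have one : c' 1 = (ev (∂₁ v₁) + ev (∂₃ v₃)) * c 1 := by
    simp [hc', crd, hn₁, hn₃, eF, F1, pd_coord, h.ev₂, h.ev₃, h.d₂₁, h.d₂₃]
    ring
  refine ⟨h.rel, one, ?_, ?_, ?_, ?_, ?_⟩
  · simp [hc', crd, hn₂, hn₃, F2, pd_coord, h.ev₁, h.d₁₂, h.d₁₃, h.d₂₂, n12.symm, n13.symm]
    ring
  · simp [hc', crd, hn₁, hn₂, F2, pd_coord, h.ev₃, h.d₂₂, h.d₃₁, h.d₃₂, n13, n23]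
    ring
  · intro e1 e2 e3
    rw [four, e1, e2, e3]
    ring
  · intro k hk hor h0
    rcases k with _ | k
    · simp [slot, one]
    · rw [slot, if_neg (by omega), slots k hk hor, hGb, ← mul_one (X : PowerSeries ℝ),
        coeff_slotPoly_mul hk h0, coeff_slotPoly_mul hk h0, hb0, constantCoeff_T, map_one,
        one_pow]
      push_cast
      ring
  · intro e1 e2 e3 e4 k hk h0
    rw [four, e1, e2] at e4
    -- The assumed value of c'₄ cancels the c₄ terms and leaves c₃ times this coefficient.
    have hA : coeff 1 (T hd (∂₁ v₁)) = 0 := by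
      have : coeff 1 (T hd (∂₁ v₁)) * c 3 = 0 := by linarith
      exact (mul_eq_zero.1 this).resolve_right e3
    have hB : coeff 1 b = 0 := by
      have := h.second
      rw [hA, mul_zero] at this
      rw [← hbc]
      exact (mul_eq_zero.1 this).resolve_left (by exact_mod_cast hm)
    have h1 : coeff 1 (1 : PowerSeries ℝ) = 0 := by simp [coeff_one]
    rw [slot, if_neg (by omega), slots k (by omega) (Or.inl hk), hGb, ← mul_one (X : PowerSeries ℝ),
      coeff_succ_slotPoly_mul (by omega) h0 h1 hA, coeff_succ_slotPoly_mul (by omega) h0 h1 hB,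
      hb0, constantCoeff_T, map_one, one_pow]
    ring

/-- The closed form in `orbitTangent` is an arbitrary representative; replacing it by ∑ c_i θ_i
changes L_V only by a form with zero restriction. -/
theorem varies_of_mem_orbitTangent {μ : ℕ} (hμ : 5 < μ) {c : ℕ → ℝ} {τ : SmoothForm d 2}
    (h : restr (curve d hd μ) τ ∈ orbitTangent (restr (curve d hd μ) (comb hd μ c))) :
    ∃ l₁ l₃ c', Varies (μ - 3) l₁ l₃ c c' ∧ ∀ i ≤ μ, coords hd μ τ i = c' i := by
  obtain ⟨V, η, τ', hV, -, hη, hτ, hL⟩ := h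
  set v : Fin d → Gm d := fun k => germ (fun x => V x k) (hV.isSm k) with hv
  obtain ⟨h1, h2, h3⟩ := sum_mul_coef_comb (hd := hd) hμ c v
  have hη' : η - comb hd μ c ∈ zeroRestr (curve d hd μ) := (Submodule.Quotient.eq _).1 hη
  obtain ⟨α, β, hα, hβ, hαβ⟩ := hη'
  have hcoef (k j : Fin d) : coef k j η = coef k j (comb hd μ c) +
      (coef k j α + (pd k (coef₁ β j) - pd j (coef₁ β k))) := by
    rw [← coef_of_eq_add_extDeriv hαβ k j, map_sub]
    ring
  -- For η = ∑ c_i θ_i + α + dβ, the j-th coefficient of V ⌟ dβ is V(β_j) + ∑ ∂_j v_k β_k minus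
  -- ∂_j(∑ v_k β_k). The first two terms and V ⌟ α vanish on the curve and form s; the last is exact
  -- and is killed by d.
  obtain ⟨s, hs'⟩ : ∃ s : Fin d → Gm d, ∀ j, s j = ∑ k, v k * coef k j α +
    ∑ k, v k * pd k (coef₁ β j) + ∑ k, pd j (v k) * coef₁ β k := ⟨_, fun _ => rfl⟩
  have hs (j : Fin d) : Van (curve d hd μ) (s j) := by
    rw [hs']
    exact ((Van.sum _ fun k => (van_coef hα k j).mul_left _).add (hV.van (van_coef₁ hβ j))).add
      (Van.sum _ fun k => (van_coef₁ hβ k).mul_left _)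
  have hN (j : Fin d) : ∑ k, v k * coef k j η =
      ∑ k, v k * coef k j (comb hd μ c) + s j - pd j (∑ k, v k * coef₁ β k) := by
    simp only [hs', hcoef, map_sum, Derivation.leibniz, smul_eq_mul, ← Finset.sum_add_distrib,
      ← Finset.sum_sub_distrib]
    refine Finset.sum_congr rfl fun k _ => ?_
    ring
  have hd' (i j : Fin d) : coef i j τ' = (pd i (∑ k, v k * coef k j (comb hd μ c)) -
      pd j (∑ k, v k * coef k i (comb hd μ c))) + (pd i (s j) - pd j (s i)) := by
    rw [coef_of_eq_lieClosed hV.isSm hL, hN, hN, map_sub, map_sub, map_add, map_add, pd_comm i j]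
    ring
  refine ⟨_, _, _, (hV.fieldJets hμ).varies hμ c h1 h2 h3, fun i hi => ?_⟩
  rw [← coords_eq_of_restr_eq hμ hτ hi, coords, hd', hd', hd', crd_add,
    crd_of_extDeriv hμ (hs _) (hs _) (hs _) hi, add_zero]

end

end SMu

namespace SMu

/-! ## Reduction to normal forms -/

open PowerSeries

section
variable {d : ℕ}

theorem IsSymmetry.pull_mem_closedForms {N : Set (E d)} {Φ : E d → E d} (hΦ : IsSymmetry N Φ)
    {η : SmoothForm d 2} (h : η ∈ closedForms d) : hΦ.pull η ∈ closedForms d := by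
  have hd : ∀ᶠ x in 𝓝 (0 : E d), DifferentiableAt ℝ η.1 x := η.differentiableAt
  filter_upwards [hΦ.tendsto.eventually h, hΦ.tendsto.eventually hd, hΦ.smooth] with x hx hb hs
  rw [pull_val]
  change extDeriv (fun x => (η.1 (Φ x)).compContinuousLinearMap (fderiv ℝ Φ x)) x = 0
  rw [extDeriv_pullback hb hs (r := ∞) (by
      simp only [minSmoothness_of_isRCLikeNormedField]
      exact WithTop.coe_le_coe.2 le_top), hx]
  rfl

end

/-! ### Weighted scalings and their effect on the coordinates. -/

section
variable {d : ℕ} (hd : 3 ≤ d)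

local notation "x₁" => coord (i₁ d hd)
local notation "x₂" => coord (i₂ d hd)
local notation "x₃" => coord (i₃ d hd)
local notation "∂₁" => pd (i₁ d hd)
local notation "∂₂" => pd (i₂ d hd)
local notation "∂₃" => pd (i₃ d hd)

/-- The factors of the weighted scaling `quasiScaling`. -/
def scalingFactor (m : ℕ) (s₁ s₂ : ℝ) (f : E d → ℝ) (i : Fin d) (x : E d) : ℝ :=
  if i = i₁ d hd then s₁ * f x ^ m else if i = i₂ d hd then s₂ * f x ^ m else
    if i = i₃ d hd then f x ^ 2 else 1

/-- The map `x ↦ (s₁ f(x)^m x₁, s₂ f(x)^m x₂, f(x)² x₃, x₄, …)`. -/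
def quasiScaling (m : ℕ) (s₁ s₂ : ℝ) (f : E d → ℝ) (x : E d) : E d :=
  fun i => scalingFactor hd m s₁ s₂ f i x * x i

variable {hd}

/-- The equations are quasi-homogeneous for the weights (m, m, 2): the map multiplies them by f^(2m)
and s₂ f^(m+2), which do not vanish near 0. The differential at 0 is diagonal because each
coordinate is multiplied by a function. -/
theorem isSymmetry_quasiScaling {μ : ℕ} {s₁ s₂ : ℝ} (h₁ : s₁ ^ 2 = 1) (h₂ : s₂ ^ 2 = 1)
    {f : E d → ℝ} (hf : ContDiff ℝ ∞ f) (h0 : f 0 ≠ 0) :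
    IsSymmetry (curve d hd μ) (quasiScaling hd (μ - 3) s₁ s₂ f) := by
  have n12 := i₁_ne_i₂ hd
  have n13 := i₁_ne_i₃ hd
  have n23 := i₂_ne_i₃ hd
  have hg (i : Fin d) : ContDiff ℝ ∞ (scalingFactor hd (μ - 3) s₁ s₂ f i) := by
    unfold scalingFactor
    split_ifs <;> fun_prop
  have hΦ : ContDiff ℝ ∞ (quasiScaling hd (μ - 3) s₁ s₂ f) := by
    refine contDiff_pi.2 fun i => ?_
    exact (hg i).mul (contDiff_apply ℝ ℝ i)
  have hs₁ : s₁ ≠ 0 := by rintro rfl; norm_num at h₁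
  have hs₂ : s₂ ≠ 0 := by rintro rfl; norm_num at h₂
  have hg0 (i : Fin d) : scalingFactor hd (μ - 3) s₁ s₂ f i 0 ≠ 0 := by
    unfold scalingFactor
    split_ifs
    · exact mul_ne_zero hs₁ (pow_ne_zero _ h0)
    · exact mul_ne_zero hs₂ (pow_ne_zero _ h0)
    · exact pow_ne_zero _ h0
    · exact one_ne_zero
  refine ⟨?_, Filter.Eventually.of_forall fun x => hΦ.contDiffAt, ?_, ?_⟩
  · ext i
    simp [quasiScaling]
  · refine ⟨ContinuousLinearEquiv.piCongrRight fun i =>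
      ContinuousLinearEquiv.smulLeft (Units.mk0 _ (hg0 i)), ?_⟩
    ext v i
    have hD : DifferentiableAt ℝ (quasiScaling hd (μ - 3) s₁ s₂ f) 0 :=
      hΦ.contDiffAt.differentiableAt (by simp)
    rw [fderiv_component hD]
    have h1 : HasFDerivAt (fun y : E d => y i)
        (ContinuousLinearMap.proj (R := ℝ) (φ := fun _ : Fin d => ℝ) i) 0 :=
      (ContinuousLinearMap.proj (R := ℝ) (φ := fun _ : Fin d => ℝ) i).hasFDerivAt
    have h2 := (((hg i).contDiffAt (x := 0)).differentiableAt (by simp)).hasFDerivAt.mul h1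
    have h3 : (fun y => quasiScaling hd (μ - 3) s₁ s₂ f y i) =
      (fun y => scalingFactor hd (μ - 3) s₁ s₂ f i y * y i) := rfl
    rw [h3]
    change _ = fderiv ℝ (scalingFactor hd (μ - 3) s₁ s₂ f i * fun y : E d => y i) 0 v
    rw [h2.fderiv]
    simp
  · filter_upwards [hf.continuous.continuousAt.eventually_ne h0] with x hx
    have e₁ : quasiScaling hd (μ - 3) s₁ s₂ f x (i₁ d hd) = s₁ * f x ^ (μ - 3) * x (i₁ d hd) := by
      simp [quasiScaling, scalingFactor]
    have e₂ : quasiScaling hd (μ - 3) s₁ s₂ f x (i₂ d hd) = s₂ * f x ^ (μ - 3) * x (i₂ d hd) := by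
      simp [quasiScaling, scalingFactor, n12.symm]
    have e₃ : quasiScaling hd (μ - 3) s₁ s₂ f x (i₃ d hd) = f x ^ 2 * x (i₃ d hd) := by
      simp [quasiScaling, scalingFactor, n13.symm, n23.symm]
    have e₄ (j : Fin d) (hj : 3 ≤ (j : ℕ)) : quasiScaling hd (μ - 3) s₁ s₂ f x j = x j := by
      obtain ⟨k1, k2, k3⟩ := ne_of_three_le hd hj
      simp [quasiScaling, scalingFactor, k1, k2, k3]
    refine and_congr ?_ (and_congr ?_ (forall_congr' fun j => forall_congr' fun hj => by
      rw [e₄ j hj]))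
    · rw [e₁, e₂, e₃, show (s₁ * f x ^ (μ - 3) * x (i₁ d hd)) ^ 2 -
        (s₂ * f x ^ (μ - 3) * x (i₂ d hd)) ^ 2 - (f x ^ 2 * x (i₃ d hd)) ^ (μ - 3) =
        (f x ^ (μ - 3)) ^ 2 * (s₁ ^ 2 * x (i₁ d hd) ^ 2 - s₂ ^ 2 * x (i₂ d hd) ^ 2 -
          x (i₃ d hd) ^ (μ - 3)) by ring, h₁, h₂, one_mul, one_mul, mul_eq_zero]
      exact or_iff_right (pow_ne_zero _ (pow_ne_zero _ hx))
    · rw [e₂, e₃, show s₂ * f x ^ (μ - 3) * x (i₂ d hd) * (f x ^ 2 * x (i₃ d hd)) =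
        (s₂ * f x ^ (μ - 3) * f x ^ 2) * (x (i₂ d hd) * x (i₃ d hd)) by ring, mul_eq_zero]
      exact or_iff_right (mul_ne_zero (mul_ne_zero hs₂ (pow_ne_zero _ hx)) (pow_ne_zero _ hx))

variable (hd) in
/-- The algebraic restriction of `∑ c_i θ_i` can be brought to that of `∑ c'_i θ_i`. -/
def Reaches (μ : ℕ) (c c' : ℕ → ℝ) : Prop :=
  Diffeomorphic (restr (curve d hd μ) (comb hd μ c)) (restr (curve d hd μ) (comb hd μ c'))

theorem comb_congr {μ : ℕ} {c c' : ℕ → ℝ} (h : ∀ i ∈ Finset.Icc 1 μ, c i = c' i) :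
    comb hd μ c = comb hd μ c' :=
  Finset.sum_congr rfl fun i hi => by rw [h i hi]

theorem Reaches.refl (μ : ℕ) (c : ℕ → ℝ) : Reaches hd μ c c := Diffeomorphic.refl _

theorem Reaches.trans {μ : ℕ} {c c' c'' : ℕ → ℝ} (h : Reaches hd μ c c')
    (h' : Reaches hd μ c' c'') : Reaches hd μ c c'' := Diffeomorphic.trans h h'

theorem reaches_coords_pull {μ : ℕ} (hμ : 5 < μ) {Φ : E d → E d}
    (hΦ : IsSymmetry (curve d hd μ) Φ) (c : ℕ → ℝ) :
    Reaches hd μ c (coords hd μ (hΦ.pull (comb hd μ c))) := by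
  rw [Reaches, diffeomorphic_iff]
  exact ⟨Φ, hΦ, restr_eq_comb hd hμ (hΦ.pull_mem_closedForms (comb_mem_closedForms hd c))⟩

/-- The transformation law for the symmetries `quasiScaling`. -/
theorem exists_reaches {μ : ℕ} (hμ : 5 < μ) {s₁ s₂ : ℝ} (h₁ : s₁ ^ 2 = 1) (h₂ : s₂ ^ 2 = 1)
    {f : E d → ℝ} (hf : ContDiff ℝ ∞ f) (h0 : f 0 ≠ 0) {L : Gm d}
    (hL : L = germ f (IsSm.of_contDiff hf)) (c : ℕ → ℝ) :
    ∃ c', Reaches hd μ c c' ∧ c' 1 = s₁ * ev L ^ (μ - 3) * ev L ^ 2 * c 1 ∧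
    c' 2 = s₂ * ev L ^ (μ - 3) * ev L ^ 2 * c 2 ∧
    c' 3 = s₁ * ev L ^ (μ - 3) * (s₂ * ev L ^ (μ - 3)) * c 3 ∧
    c' 4 = s₁ * ev L ^ (μ - 3) * (s₂ * ev L ^ (μ - 3)) * ev L ^ 2 * c 4 +
      s₂ * ev L ^ (μ - 3) * s₁ * coeff 1 (T hd L ^ (μ - 3)) * c 3 -
      ev L ^ 2 * s₁ * ev (∂₂ (L ^ (μ - 3))) * c 1 -
      (ev L ^ 2 * s₂ * ev (∂₁ (L ^ (μ - 3))) + s₂ * ev L ^ (μ - 3) * ev (∂₁ (L ^ 2))) * c 2 ∧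
    ∀ k, k + 1 < μ - 3 → c' (k + 5) =
      coeff (k + 1) (slotPoly (μ - 3) c (T hd L ^ 2 * X) *
        (C s₁ * T hd L ^ (μ - 3) * derivative ℝ (T hd L ^ 2 * X))) -
      if k + 5 = μ then 3 * ((μ - 3 : ℕ) / 2 : ℝ) * s₁ * s₂ * ev L ^ (μ - 3) *
        ev (∂₂ (L ^ (μ - 3))) * c 3 else 0 := by
  have n12 := i₁_ne_i₂ hd
  have n13 := i₁_ne_i₃ hd
  have n23 := i₂_ne_i₃ hd
  have hΦ := isSymmetry_quasiScaling (hd := hd) (μ := μ) h₁ h₂ hf h0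
  refine ⟨_, reaches_coords_pull hμ hΦ c, ?_⟩
  obtain ⟨k1, k2, k3, k4, k5⟩ := (hΦ.symJets hμ).crd_pulledCoef hμ c
    (c' := coords hd μ (hΦ.pull (comb hd μ c))) (by simp only [coords, hΦ.coef_pull_comb hμ])
  set c' := coords hd μ (hΦ.pull (comb hd μ c))
  have e₁ : hΦ.comp (i₁ d hd) = s₁ • (L ^ (μ - 3) * x₁) := by
    rw [hL, coord, germ_pow, germ_mul, smul_germ, IsSymmetry.comp]
    refine germ_eq_of_forall _ _ fun x => ?_
    simp [quasiScaling, scalingFactor, mul_assoc]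
  have e₂ : hΦ.comp (i₂ d hd) = s₂ • (L ^ (μ - 3) * x₂) := by
    rw [hL, coord, germ_pow, germ_mul, smul_germ, IsSymmetry.comp]
    refine germ_eq_of_forall _ _ fun x => ?_
    simp [quasiScaling, scalingFactor, mul_assoc, n12.symm]
  have e₃ : hΦ.comp (i₃ d hd) = L ^ 2 * x₃ := by
    rw [hL, coord, germ_pow, germ_mul, IsSymmetry.comp]
    refine germ_eq_of_forall _ _ fun x => ?_
    simp [quasiScaling, scalingFactor, n13.symm, n23.symm]
  obtain ⟨M, hM⟩ : ∃ M, M = L ^ (μ - 3) := ⟨_, rfl⟩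
  obtain ⟨K, hK⟩ : ∃ K, K = L ^ 2 := ⟨_, rfl⟩
  rw [← hM] at e₁ e₂
  rw [← hK] at e₃
  have d₁ : T hd (∂₁ (hΦ.comp (i₁ d hd))) = C s₁ * T hd M := by
    rw [e₁]
    simp [pd_coord, T_coord, n13, smul_eq_C_mul]
  have a₁ : ev (∂₁ (hΦ.comp (i₁ d hd))) = s₁ * ev M := by rw [e₁]; simp [pd_coord]
  have a₂ : ev (∂₂ (hΦ.comp (i₂ d hd))) = s₂ * ev M := by rw [e₂]; simp [pd_coord]
  have a₃ : ev (∂₃ (hΦ.comp (i₃ d hd))) = ev K := by rw [e₃]; simp [pd_coord]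
  have b₁ : T hd (hΦ.comp (i₃ d hd)) = T hd K * X := by rw [e₃]; simp [T_coord]
  have b₂ : T hd (hΦ.comp (i₂ d hd)) = 0 := by rw [e₂]; simp [T_coord, n23]
  have f₁ : ev (∂₁ (∂₂ (hΦ.comp (i₁ d hd)))) = s₁ * ev (∂₂ M) := by
    rw [e₁]; simp [pd_coord, n12.symm]
  have f₂ : ev (∂₁ (∂₂ (hΦ.comp (i₂ d hd)))) = s₂ * ev (∂₁ M) := by
    rw [e₂]; simp [pd_coord, n12]
  have f₃ : ev (∂₁ (∂₃ (hΦ.comp (i₃ d hd)))) = ev (∂₁ K) := by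
    rw [e₃]; simp [pd_coord, n13]
  have f₄ : ev (∂₂ (∂₂ (hΦ.comp (i₃ d hd)))) = 0 := by rw [e₃]; simp [pd_coord, n23]
  have f₅ : ev (∂₂ (∂₂ (hΦ.comp (i₂ d hd)))) = 2 * s₂ * ev (∂₂ M) := by
    rw [e₂]; simp [pd_coord]; ring
  have f₆ : ev (∂₂ (∂₁ (hΦ.comp (i₁ d hd)))) = s₁ * ev (∂₂ M) := by rw [pd_comm, f₁]
  simp only [← map_pow, ← hM, ← hK]
  refine ⟨?_, ?_, ?_, ?_, fun k hk => ?_⟩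
  · rw [k1, a₁, a₃]
  · rw [k2, a₂, a₃]
  · rw [k3, a₁, a₂]
  · rw [k4, a₁, a₂, a₃, d₁, f₁, f₂, f₃, coeff_C_mul]
    ring
  · rw [k5 k hk, b₁, d₁, sub_eq_add_neg]
    congr 1
    split_ifs
    -- The factor 3 arises because ∂₂M (where M = L^m) occurs once in ∂₂∂₁u₁ and twice in ∂₂∂₂u₂;
    -- the other summands of `extraTerm` are zero.
    · rw [extraTerm, a₁, a₂, b₂, f₄, f₅, f₆, map_zero]
      ring
    · exact neg_zero.symm

theorem reaches_of_eqOn {μ : ℕ} {c c' c'' : ℕ → ℝ} (h : Reaches hd μ c c')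
    (h' : ∀ i ∈ Finset.Icc 1 μ, c' i = c'' i) : Reaches hd μ c c'' := by
  rw [Reaches, ← comb_congr h']
  exact h

theorem mem_Icc_cases {μ i : ℕ} (hi : i ∈ Finset.Icc 1 μ) :
    i = 1 ∨ i = 2 ∨ i = 3 ∨ i = 4 ∨ ∃ k, k + 1 < μ - 3 ∧ i = k + 5 := by
  obtain ⟨h1, h2⟩ := Finset.mem_Icc.1 hi
  by_cases h : i < 5
  · omega
  · exact Or.inr (Or.inr (Or.inr (Or.inr ⟨i - 5, by omega, by omega⟩)))

theorem coeff_slotPoly_C_mul_X {m k : ℕ} (hk : k < m) (c : ℕ → ℝ) (r : ℝ) :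
    coeff k (slotPoly m c (C r * X : PowerSeries ℝ)) = r ^ k * slot c k := by
  rw [slotPoly, map_sum, Finset.sum_eq_single k]
  · rw [map_smul, mul_pow, ← map_pow, coeff_C_mul, coeff_X_pow, if_pos rfl, smul_eq_mul]
    ring
  · intro j _ hj
    rw [map_smul, mul_pow, ← map_pow, coeff_C_mul, coeff_X_pow, if_neg hj.symm, mul_zero,
      smul_zero]
  · intro h
    exact absurd (Finset.mem_range.2 hk) h

theorem exists_reaches_scale {μ : ℕ} (hμ : 5 < μ) {s₁ s₂ t : ℝ} (h₁ : s₁ ^ 2 = 1)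
    (h₂ : s₂ ^ 2 = 1) (ht : t ≠ 0) (c : ℕ → ℝ) :
    ∃ c', Reaches hd μ c c' ∧ c' 1 = s₁ * t ^ (μ - 1) * c 1 ∧ c' 2 = s₂ * t ^ (μ - 1) * c 2 ∧
    c' 3 = s₁ * s₂ * t ^ (2 * (μ - 3)) * c 3 ∧ c' 4 = s₁ * s₂ * t ^ (2 * (μ - 3) + 2) * c 4 ∧
    ∀ k, k + 1 < μ - 3 → c' (k + 5) = s₁ * t ^ (μ + 2 * k + 1) * c (k + 5) := by
  obtain ⟨c', hc', k1, k2, k3, k4, k5⟩ := exists_reaches (hd := hd) hμ h₁ h₂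
    (f := fun _ => t) contDiff_const ht (L := algebraMap ℝ _ t) rfl c
  obtain ⟨m, rfl⟩ : ∃ m, μ = m + 3 := ⟨μ - 3, by omega⟩
  have hz (i : Fin d) (n : ℕ) : pd i (algebraMap ℝ (Gm d) t ^ n) = 0 := by
    rw [← map_pow]
    exact Derivation.map_algebraMap _ _
  have hT : T hd (algebraMap ℝ (Gm d) t) = C t := AlgHom.commutes _ _
  simp only [hz, hT, map_zero, mul_zero, zero_mul, ite_self, sub_zero, ← map_pow C] at k4 k5
  refine ⟨c', hc', ?_, ?_, ?_, ?_, fun k hk => ?_⟩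
  · rw [k1, AlgHom.commutes]
    simp only [Algebra.algebraMap_self, RingHom.id_apply]
    rw [show m + 3 - 1 = m + 2 from rfl, Nat.add_sub_cancel, pow_add]
    ring
  · rw [k2, AlgHom.commutes]
    simp only [Algebra.algebraMap_self, RingHom.id_apply]
    rw [show m + 3 - 1 = m + 2 from rfl, Nat.add_sub_cancel, pow_add]
    ring
  · rw [k3, AlgHom.commutes]
    simp only [Algebra.algebraMap_self, RingHom.id_apply]
    ring
  · rw [k4, AlgHom.commutes, coeff_C, if_neg one_ne_zero]
    simp only [Algebra.algebraMap_self, RingHom.id_apply]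
    ring
  · rw [k5 k hk]
    have e : C s₁ * C (t ^ (m + 3 - 3)) * derivative ℝ (C (t ^ 2) * X) =
        C (s₁ * t ^ (m + 3 - 3) * t ^ 2) := by
      simp [Derivation.leibniz, map_mul]
    rw [e, coeff_mul_C, coeff_slotPoly_C_mul_X hk, slot, if_neg (by omega), Nat.add_sub_cancel]
    ring

theorem ev_one_add_smul (κ : ℝ) {r : Gm d} (hr : ev r = 0) : ev (1 + κ • r) = 1 := by
  simp [hr]

theorem ev_pd_one_add_smul_pow (i : Fin d) (κ : ℝ) {r : Gm d} (hr : ev r = 0) (n : ℕ) :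
    ev (pd i ((1 + κ • r) ^ n)) = n * κ * ev (pd i r) := by
  simp [Derivation.leibniz_pow, hr]
  ring

theorem exists_reaches_one_add_smul {μ : ℕ} (hμ : 5 < μ) (κ : ℝ) {f : E d → ℝ}
    (hf : ContDiff ℝ ∞ f) (h0 : f 0 = 0) {r : Gm d} (hr : r = germ f (IsSm.of_contDiff hf))
    (c : ℕ → ℝ) :
    ∃ c', Reaches hd μ c c' ∧ c' 1 = c 1 ∧ c' 2 = c 2 ∧ c' 3 = c 3 ∧
    c' 4 = c 4 + (μ - 3 : ℕ) * κ * ev (∂₃ r) * c 3 - (μ - 3 : ℕ) * κ * ev (∂₂ r) * c 1 -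
      ((μ - 3 : ℕ) + 2) * κ * ev (∂₁ r) * c 2 ∧
    ∀ k, k + 1 < μ - 3 → c' (k + 5) =
      coeff (k + 1) (slotPoly (μ - 3) c (T hd (1 + κ • r) ^ 2 * X) *
        (T hd (1 + κ • r) ^ (μ - 3) * derivative ℝ (T hd (1 + κ • r) ^ 2 * X))) -
      if k + 5 = μ then 3 * ((μ - 3 : ℕ) / 2 : ℝ) * ((μ - 3 : ℕ) * κ * ev (∂₂ r)) * c 3 else 0 := by
  have hev : ev r = 0 := by rw [hr, ev_germ, h0]
  obtain ⟨c', hc', k1, k2, k3, k4, k5⟩ := exists_reaches (hd := hd) hμ (s₁ := 1) (s₂ := 1)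
    (one_pow 2) (one_pow 2) (f := fun x => 1 + κ * f x) (contDiff_const.add (contDiff_const.mul hf))
    (by simp [h0]) (L := 1 + κ • r) (by rw [hr, smul_germ]; rfl) c
  rw [← map_pow (T hd), coeff_one_T, ev_pd_one_add_smul_pow _ _ hev, ev_pd_one_add_smul_pow _ _ hev,
    ev_pd_one_add_smul_pow _ _ hev, ev_pd_one_add_smul_pow _ _ hev, ev_one_add_smul _ hev] at k4
  rw [ev_one_add_smul _ hev] at k1 k2 k3
  refine ⟨c', hc', by rw [k1]; ring, by rw [k2]; ring, by rw [k3]; ring, ?_, fun k hk => ?_⟩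
  · rw [k4]
    push_cast
    ring
  · rw [k5 k hk, ev_pd_one_add_smul_pow _ _ hev, ev_one_add_smul _ hev, map_one, one_mul]
    congr 2
    ring

theorem coeff_slotPoly_one {m k : ℕ} (hk : k + 1 < m) (c : ℕ → ℝ) :
    coeff (k + 1) (slotPoly m c ((1 : PowerSeries ℝ) ^ 2 * X) *
      (1 ^ m * derivative ℝ ((1 : PowerSeries ℝ) ^ 2 * X))) = c (k + 5) := by
  rw [one_pow, one_pow, one_mul, one_mul, derivative_X, mul_one, ← one_mul (X : PowerSeries ℝ),
    ← map_one C, coeff_slotPoly_C_mul_X hk, one_pow, one_mul, slot, if_neg (by omega)]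

/-- The symmetry of factor `1 + κ x₁` only changes the coefficient of `θ₄`. -/
theorem reaches_update_four {μ : ℕ} (hμ : 5 < μ) {c : ℕ → ℝ} (h : c 2 ≠ 0) :
    Reaches hd μ c (Function.update c 4 0) := by
  have n12 := i₁_ne_i₂ hd
  have n13 := i₁_ne_i₃ hd
  have hm : ((μ - 3 : ℕ) : ℝ) + 2 ≠ 0 := by positivity
  obtain ⟨c', hc', k1, k2, k3, k4, k5⟩ := exists_reaches_one_add_smul (hd := hd) hμ
    (c 4 / (((μ - 3 : ℕ) + 2) * c 2)) (f := fun x => x (i₁ d hd)) (contDiff_apply ℝ ℝ _) rfl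
    (r := x₁) rfl c
  refine reaches_of_eqOn hc' fun i hi => ?_
  rcases mem_Icc_cases hi with rfl | rfl | rfl | rfl | ⟨k, hk, rfl⟩
  · simpa using k1
  · simpa using k2
  · simpa using k3
  · rw [k4, Function.update_self]
    simp [pd_coord, n12.symm, n13.symm]
    field_simp
    ring
  · rw [k5 k hk, Function.update_of_ne (by omega)]
    have e : T hd (1 + (c 4 / (((μ - 3 : ℕ) + 2) * c 2)) • x₁) = 1 := by simp [T_coord, n13]
    rw [e, coeff_slotPoly_one hk]
    simp [pd_coord, n12.symm]

/-- The symmetry of factor `1 + κ x₂` only changes the coefficients of `θ₄` and `θ_μ`. -/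
theorem exists_reaches_x₂ {μ : ℕ} (hμ : 5 < μ) (κ : ℝ) (c : ℕ → ℝ) :
    Reaches hd μ c (Function.update (Function.update c 4 (c 4 - (μ - 3 : ℕ) * κ * c 1)) μ
      (c μ - 3 * ((μ - 3 : ℕ) / 2 : ℝ) * ((μ - 3 : ℕ) * κ) * c 3)) := by
  have n12 := i₁_ne_i₂ hd
  have n23 := i₂_ne_i₃ hd
  obtain ⟨c', hc', k1, k2, k3, k4, k5⟩ := exists_reaches_one_add_smul (hd := hd) hμ
    κ (f := fun x => x (i₂ d hd)) (contDiff_apply ℝ ℝ _) rfl (r := x₂) rfl c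
  refine reaches_of_eqOn hc' fun i hi => ?_
  rcases mem_Icc_cases hi with rfl | rfl | rfl | rfl | ⟨k, hk, rfl⟩
  · rw [k1, Function.update_of_ne (by omega), Function.update_of_ne (by omega)]
  · rw [k2, Function.update_of_ne (by omega), Function.update_of_ne (by omega)]
  · rw [k3, Function.update_of_ne (by omega), Function.update_of_ne (by omega)]
  · rw [k4, Function.update_of_ne (by omega), Function.update_self]
    simp [pd_coord, n12, n23.symm]
  · have e : T hd (1 + κ • x₂) = 1 := by simp [T_coord, n23]
    rw [k5 k hk, e, coeff_slotPoly_one hk]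
    by_cases hk' : k + 5 = μ
    · rw [if_pos hk', hk', Function.update_self]
      simp [pd_coord]
    · rw [if_neg hk', Function.update_of_ne hk', Function.update_of_ne (by omega), sub_zero]

theorem X_pow_dvd_one_add_pow {j : ℕ} (hj : 1 ≤ j) (κ : ℝ) (n : ℕ) :
    X ^ (j + 1) ∣ (1 + C κ * X ^ j) ^ n - (1 + (n : PowerSeries ℝ) * C κ * X ^ j) := by
  induction n with
  | zero => simp
  | succ n ih =>
    obtain ⟨q, hq⟩ := ih
    obtain ⟨i, rfl⟩ : ∃ i, j = i + 1 := ⟨j - 1, by omega⟩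
    refine ⟨q * (1 + C κ * X ^ (i + 1)) + (n : PowerSeries ℝ) * C κ ^ 2 * X ^ i, ?_⟩
    rw [sub_eq_iff_eq_add] at hq
    rw [pow_succ, hq]
    push_cast
    ring

/-- With l = 1 + κX^j, the linear part in κ collects 2n from (l²X)^n, m from l^m and 2 + 2j from the
derivative of l²X. This is the image of the term x₃^n dx₁∧dx₃ along the axis. -/
theorem coeff_X_pow_mul_one_add {j : ℕ} (hj : 1 ≤ j) (κ : ℝ) (m n : ℕ) {i : ℕ} (hi : i ≤ n + j) :
    coeff i (((1 + C κ * X ^ j) ^ 2 * X) ^ n *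
      ((1 + C κ * X ^ j) ^ m * derivative ℝ ((1 + C κ * X ^ j) ^ 2 * X))) =
      if i = n then 1 else if i = n + j then κ * (2 * n + m + 2 + 2 * j) else 0 := by
  have e : ((1 + C κ * X ^ j) ^ 2 * X) ^ n *
      ((1 + C κ * X ^ j) ^ m * derivative ℝ ((1 + C κ * X ^ j) ^ 2 * X)) =
      X ^ n * ((1 + C κ * X ^ j) ^ (2 * n + m + 2) +
        2 * (j : PowerSeries ℝ) * C κ * X ^ j * (1 + C κ * X ^ j) ^ (2 * n + m + 1)) := by
    obtain ⟨l, hl⟩ : ∃ l : PowerSeries ℝ, l = 1 + C κ * X ^ j := ⟨_, rfl⟩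
    have hX : X * derivative ℝ l = (j : PowerSeries ℝ) * C κ * X ^ j := by
      obtain ⟨i, rfl⟩ : ∃ i, j = i + 1 := ⟨j - 1, by omega⟩
      rw [hl, map_add, Derivation.leibniz, Derivation.leibniz_pow, derivative_X, derivative_C,
        Derivation.map_one_eq_zero]
      simp
      ring
    rw [← hl, Derivation.leibniz, Derivation.leibniz_pow, derivative_X]
    simp only [smul_eq_mul, nsmul_eq_mul, mul_pow, ← pow_mul]
    push_cast
    linear_combination (2 * X ^ n * l ^ (2 * n + m + 1)) * hX
  obtain ⟨q, hq⟩ := X_pow_dvd_one_add_pow hj κ (2 * n + m + 2)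
  obtain ⟨q', hq'⟩ := X_pow_dvd_one_add_pow hj κ (2 * n + m + 1)
  rw [sub_eq_iff_eq_add] at hq hq'
  have e2 : (1 + C κ * X ^ j) ^ (2 * n + m + 2) +
        2 * (j : PowerSeries ℝ) * C κ * X ^ j * (1 + C κ * X ^ j) ^ (2 * n + m + 1) =
      1 + C (κ * (2 * n + m + 2 + 2 * j)) * X ^ j + X ^ (j + 1) * (q +
        2 * (j : PowerSeries ℝ) * C κ * (X ^ j * q' + ((2 * n + m + 1 : ℕ) : PowerSeries ℝ) *
          C κ * X ^ (j - 1))) := by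
    have : (X : PowerSeries ℝ) ^ (j + 1) * X ^ (j - 1) = X ^ j * X ^ j := by
      rw [← pow_add, ← pow_add]; congr 1; omega
    rw [hq, hq']
    simp only [map_mul, map_add, map_natCast, map_ofNat]
    push_cast
    linear_combination (-2 * (j : PowerSeries ℝ) * C κ ^ 2 *
      (2 * (n : PowerSeries ℝ) + (m : PowerSeries ℝ) + 1)) * this
  rw [e, e2, mul_add, map_add, mul_add, map_add, mul_one, ← mul_assoc, mul_comm (X ^ n) (C _),
    mul_assoc, coeff_C_mul, ← pow_add, ← mul_assoc, ← pow_add, coeff_X_pow, coeff_X_pow,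
    coeff_X_pow_mul', if_neg (by omega : ¬ n + (j + 1) ≤ i)]
  split_ifs <;> first | omega | simp

/-- The factor is 1 + κx₃^j. It changes slot k + j by κ times a positive multiple of the first
nonzero slot k, so that slot can be given any value; for j = 1 it also moves θ₄ in proportion to c₃.
-/
theorem exists_reaches_x₃ {μ : ℕ} (hμ : 5 < μ) {j : ℕ} (hj : 1 ≤ j) (κ : ℝ) (c : ℕ → ℝ) :
    ∃ c', Reaches hd μ c c' ∧ c' 1 = c 1 ∧ c' 2 = c 2 ∧ c' 3 = c 3 ∧
    c' 4 = c 4 + (if j = 1 then (μ - 3 : ℕ) * κ * c 3 else 0) ∧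
    ∀ k, (∀ i < k, slot c i = 0) →
      (∀ i < μ - 3, i < k + j → slot c' i = slot c i) ∧
      (k + j < μ - 3 → slot c' (k + j) =
        slot c (k + j) + slot c k * (κ * (2 * k + (μ - 3 : ℕ) + 2 + 2 * j))) := by
  have n13 := i₁_ne_i₃ hd
  have n23 := i₂_ne_i₃ hd
  obtain ⟨c', hc', k1, k2, k3, k4, k5⟩ := exists_reaches_one_add_smul (hd := hd) hμ κ
    (f := fun x => x (i₃ d hd) ^ j) ((contDiff_apply ℝ ℝ _).pow j)
    (by simp; omega) (r := x₃ ^ j) rfl c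
  have e : T hd (1 + κ • x₃ ^ j) = 1 + C κ * X ^ j := by simp [T_coord, smul_eq_C_mul]
  refine ⟨c', hc', k1, k2, k3, ?_, fun k h0 => ?_⟩
  · rw [k4]
    obtain ⟨i, rfl⟩ : ∃ i, j = i + 1 := ⟨j - 1, by omega⟩
    rcases i with _ | i <;> simp [pd_coord, n13, n23, Derivation.leibniz_pow]
  have hs : ∀ i < μ - 3, slot c' i = ∑ n ∈ Finset.range (μ - 3), slot c n *
      coeff i (((1 + C κ * X ^ j) ^ 2 * X) ^ n *
      ((1 + C κ * X ^ j) ^ (μ - 3) * derivative ℝ ((1 + C κ * X ^ j) ^ 2 * X))) := by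
    intro i hi
    rcases i with _ | i
    · rw [Finset.sum_eq_single 0]
      · rw [coeff_X_pow_mul_one_add hj _ _ _ (by omega), if_pos rfl, mul_one, slot, slot,
          if_pos rfl, if_pos rfl, k1]
      · intro n _ hn
        rw [coeff_X_pow_mul_one_add hj _ _ _ (by omega), if_neg hn.symm, if_neg (by omega),
          mul_zero]
      · intro h
        exact absurd (Finset.mem_range.2 hi) h
    · rw [slot, if_neg (by omega), k5 i hi, e]
      have : ev (∂₂ (x₃ ^ j)) = 0 := by simp [pd_coord, n23, Derivation.leibniz_pow]
      rw [this, mul_zero, mul_zero, zero_mul, ite_self, sub_zero, slotPoly, Finset.sum_mul, map_sum]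
      simp only [smul_mul_assoc, map_smul, smul_eq_mul]
  refine ⟨fun i hi hik => ?_, fun hk => ?_⟩
  · rw [hs i hi, Finset.sum_eq_single i]
    · rw [coeff_X_pow_mul_one_add hj _ _ _ (by omega), if_pos rfl, mul_one]
    · intro n _ hn
      by_cases hnk : n < k
      · rw [h0 n hnk, zero_mul]
      · rw [coeff_X_pow_mul_one_add hj _ _ _ (by omega), if_neg hn.symm, if_neg (by omega),
          mul_zero]
    · intro h
      exact absurd (Finset.mem_range.2 hi) h
  · rw [hs _ hk, Finset.sum_eq_add (k + j) k (by omega)]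
    · rw [coeff_X_pow_mul_one_add hj _ _ _ (by omega), if_pos rfl, mul_one,
        coeff_X_pow_mul_one_add hj _ _ _ le_rfl, if_neg (by omega), if_pos rfl]
    · rintro n _ ⟨hn, hn'⟩
      by_cases hnk : n < k
      · rw [h0 n hnk, zero_mul]
      · rw [coeff_X_pow_mul_one_add hj _ _ _ (by omega), if_neg hn.symm, if_neg (by omega),
          mul_zero]
    · intro h
      exact absurd (Finset.mem_range.2 hk) h
    · intro h
      exact absurd (Finset.mem_range.2 (by omega)) h

/-- If `x₃^k dx₁∧dx₃` is the first nonzero term of its kind, all terms from `x₃^(k+j) dx₁∧dx₃` on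
can be removed. -/
theorem exists_reaches_truncate {μ : ℕ} (hμ : 5 < μ) {k j : ℕ} (hj : 1 ≤ j) {c : ℕ → ℝ}
    (h0 : ∀ i < k, slot c i = 0) (hk : slot c k ≠ 0) :
    ∃ c', Reaches hd μ c c' ∧ c' 1 = c 1 ∧ c' 2 = c 2 ∧ c' 3 = c 3 ∧
    (j ≠ 1 ∨ c 3 = 0 → c' 4 = c 4) ∧ (∀ i < μ - 3, i < k + j → slot c' i = slot c i) ∧
    ∀ i < μ - 3, k + j ≤ i → slot c' i = 0 := by
  have key (n : ℕ) : ∃ c', Reaches hd μ c c' ∧ c' 1 = c 1 ∧ c' 2 = c 2 ∧ c' 3 = c 3 ∧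
      (j ≠ 1 ∨ c 3 = 0 → c' 4 = c 4) ∧ (∀ i < μ - 3, i < k + j → slot c' i = slot c i) ∧
      ∀ i < μ - 3, k + j ≤ i → i < k + j + n → slot c' i = 0 := by
    induction n with
    | zero => exact ⟨c, Reaches.refl _ _, rfl, rfl, rfl, fun _ => rfl, fun _ _ _ => rfl,
        fun i _ _ _ => by omega⟩
    | succ n ih =>
      obtain ⟨c', hc', k1, k2, k3, k4, k5, k6⟩ := ih
      by_cases hn : k + j + n < μ - 3
      · obtain ⟨c'', hc'', l1, l2, l3, l4, l5⟩ := exists_reaches_x₃ (hd := hd) hμ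
          (j := j + n) (by omega)
          -- This κ cancels slot k + j + n; slots are cleared in increasing order, and earlier ones
          -- stay untouched.
          (-slot c' (k + j + n) / (slot c k * (2 * k + (μ - 3 : ℕ) + 2 + 2 * (j + n : ℕ)))) c'
        obtain ⟨l6, l7⟩ := l5 k fun i hi => by rw [k5 i (by omega) (by omega), h0 i hi]
        refine ⟨c'', hc'.trans hc'', l1.trans k1, l2.trans k2, l3.trans k3, fun h => ?_,
          fun i hi hik => ?_, fun i hi hik hin => ?_⟩
        · rw [l4, k4 h, k3]
          rcases h with h | h
          · rw [if_neg (by omega), add_zero]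
          · rw [h, mul_zero, ite_self, add_zero]
        · rw [l6 i hi (by omega), k5 i hi hik]
        · by_cases h : i < k + j + n
          · rw [l6 i hi (by omega), k6 i hi hik h]
          · obtain rfl : i = k + j + n := by omega
            rw [add_assoc, l7 (by omega), k5 k (by omega) (by omega), ← add_assoc]
            have : (2 * k + (μ - 3 : ℕ) + 2 + 2 * (j + n : ℕ) : ℝ) ≠ 0 := by positivity
            field_simp
            ring
      · exact ⟨c', hc', k1, k2, k3, k4, k5, fun i hi hik hin => k6 i hi hik (by omega)⟩
  obtain ⟨c', hc', k1, k2, k3, k4, k5, k6⟩ := key (μ - 3)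
  exact ⟨c', hc', k1, k2, k3, k4, k5, fun i hi hik => k6 i hi hik (by omega)⟩

end

end SMu

namespace SMu

/-! ## The singularity classes in coordinates -/

theorem slot_zero (c : ℕ → ℝ) : slot c 0 = c 1 := if_pos rfl

theorem slot_succ (c : ℕ → ℝ) (k : ℕ) : slot c (k + 1) = c (k + 5) := if_neg (by omega)

theorem slot_eq (c : ℕ → ℝ) {k : ℕ} (hk : 1 ≤ k) : slot c k = c (4 + k) := by
  rw [slot, if_neg (by omega), add_comm]

namespace Label

/-- The conditions on the coordinates that define the singularity class of a family. -/
def InClass (μ : ℕ) : Label → (ℕ → ℝ) → Prop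
  | zero, c => c 1 ≠ 0
  | two k, c => (∀ j < k, slot c j = 0) ∧ c 2 ≠ 0 ∧ slot c k ≠ 0
  | twoTop, c => (∀ j < μ - 4, slot c j = 0) ∧ c 2 ≠ 0
  | r k, c => (∀ j < k, slot c j = 0) ∧ c 2 = 0 ∧ c 3 ≠ 0 ∧ slot c k ≠ 0
  | rTop, c => (∀ j < μ - 5, slot c j = 0) ∧ c 2 = 0 ∧ c 3 ≠ 0
  | threeOne, c => (∀ j < 1, slot c j = 0) ∧ c 2 = 0 ∧ c 3 = 0 ∧ slot c 1 ≠ 0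
  | one k, c => (∀ j < k, slot c j = 0) ∧ c 2 = 0 ∧ c 3 = 0 ∧ c 4 ≠ 0 ∧
      (k ≤ μ - 5 → slot c k ≠ 0)
  | iso k, c => (∀ j < k, slot c j = 0) ∧ c 2 = 0 ∧ c 3 = 0 ∧ c 4 = 0 ∧ slot c k ≠ 0
  | top, c => (∀ j < μ - 3, slot c j = 0) ∧ c 2 = 0 ∧ c 3 = 0 ∧ c 4 = 0

theorem exists_first_slot (c : ℕ → ℝ) (n : ℕ) :
    (∃ k < n, (∀ j < k, slot c j = 0) ∧ slot c k ≠ 0) ∨ ∀ j < n, slot c j = 0 := by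
  by_cases h : ∃ k, k < n ∧ slot c k ≠ 0
  · classical
    refine Or.inl ⟨Nat.find h, (Nat.find_spec h).1, fun j hj => ?_, (Nat.find_spec h).2⟩
    have h1 := Nat.find_min h hj
    have h2 := (Nat.find_spec h).1
    by_contra h3
    exact h1 ⟨hj.trans h2, h3⟩
  · push Not at h
    exact Or.inr h

theorem exists_inClass {μ : ℕ} (hμ : 5 < μ) (c : ℕ → ℝ) :
    ∃ l : Label, l.Valid μ ∧ l.InClass μ c := by
  by_cases h1 : c 1 = 0
  swap
  · exact ⟨zero, trivial, h1⟩
  have hk0 : ∀ k, slot c k ≠ 0 → 1 ≤ k := by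
    intro k hk
    rcases Nat.eq_zero_or_pos k with rfl | h
    · exact absurd h1 hk
    · exact h
  by_cases h2 : c 2 = 0
  swap
  · rcases exists_first_slot c (μ - 4) with ⟨k, hk, h⟩ | h
    · exact ⟨two k, ⟨hk0 k h.2, by omega⟩, h.1, h2, h.2⟩
    · exact ⟨twoTop, trivial, h, h2⟩
  by_cases h3 : c 3 = 0
  swap
  · rcases exists_first_slot c (μ - 5) with ⟨k, hk, h⟩ | h
    · exact ⟨r k, ⟨hk0 k h.2, by omega⟩, h.1, h2, h3, h.2⟩
    · exact ⟨rTop, trivial, h, h2, h3⟩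
  by_cases h5 : slot c 1 = 0
  swap
  · exact ⟨threeOne, trivial, fun j hj => by rw [Nat.lt_one_iff.1 hj, slot_zero, h1], h2, h3, h5⟩
  have hk1 : ∀ k, slot c k ≠ 0 → 2 ≤ k := by
    intro k hk
    have := hk0 k hk
    by_contra h
    obtain rfl : k = 1 := by omega
    exact hk h5
  by_cases h4 : c 4 = 0
  swap
  · rcases exists_first_slot c (μ - 4) with ⟨k, hk, h⟩ | h
    · exact ⟨one k, ⟨hk1 k h.2, by omega⟩, h.1, h2, h3, h4, fun _ => h.2⟩
    · exact ⟨one (μ - 4), ⟨by omega, le_rfl⟩, h, h2, h3, h4, fun h => by omega⟩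
  rcases exists_first_slot c (μ - 3) with ⟨k, hk, h⟩ | h
  · exact ⟨iso k, ⟨hk1 k h.2, by omega⟩, h.1, h2, h3, h4, h.2⟩
  · exact ⟨top, trivial, h, h2, h3, h4⟩

theorem InClass.unique {μ : ℕ} (hμ : 5 < μ) {l l' : Label} {c : ℕ → ℝ} (hl : l.Valid μ)
    (hl' : l'.Valid μ) (h : l.InClass μ c) (h' : l'.InClass μ c) : l = l' := by
  have h0 := slot_zero c
  cases l <;> cases l' <;> simp only [InClass, Valid] at hl hl' h h' <;> grind

/-- Each condition concerns a coordinate that, given the preceding ones, is multiplied by a monomial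
in α, a, γ, and these are nonzero by α² = a² = γ^m. -/
theorem InClass.of_transforms {μ : ℕ} (hμ : 5 < μ) {l : Label} {α a γ : ℝ} {c c' : ℕ → ℝ}
    (hl : l.Valid μ) (h : l.InClass μ c) (ht : Transforms (μ - 3) α a γ c c') :
    l.InClass μ c' := by
  have hα : α ≠ 0 := by
    rintro rfl
    have := ht.sq_left
    rw [zero_pow two_ne_zero] at this
    exact pow_ne_zero _ ht.ne_zero this.symm
  have ha : a ≠ 0 := by
    rintro rfl
    have := ht.sq_right
    rw [zero_pow two_ne_zero] at this
    exact pow_ne_zero _ ht.ne_zero this.symm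
  have hγ := ht.ne_zero
  have z1 : c 1 ≠ 0 → c' 1 ≠ 0 := fun h => by rw [ht.one]; positivity
  have z2 : c 2 ≠ 0 → c' 2 ≠ 0 := fun h => by rw [ht.two]; positivity
  have z2' : c 2 = 0 → c' 2 = 0 := fun h => by rw [ht.two, h, mul_zero]
  have z3 : c 3 ≠ 0 → c' 3 ≠ 0 := fun h => by rw [ht.three]; positivity
  have z3' : c 3 = 0 → c' 3 = 0 := fun h => by rw [ht.three, h, mul_zero]
  have z4 : c 1 = 0 → c 2 = 0 → c 3 = 0 → c 4 ≠ 0 → c' 4 ≠ 0 := fun h1 h2 h3 h4 => by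
    rw [ht.four h1 h2 h3]; positivity
  have z4' : c 1 = 0 → c 2 = 0 → c 3 = 0 → c 4 = 0 → c' 4 = 0 := fun h1 h2 h3 h4 => by
    rw [ht.four h1 h2 h3, h4, mul_zero]
  have zs (k : ℕ) (hk : k < μ - 3) (h : k + 1 < μ - 3 ∨ c 1 = 0 ∧ c 3 = 0)
      (h0 : ∀ j < k, slot c j = 0) (hs : slot c k ≠ 0) : slot c' k ≠ 0 := by
    rw [ht.lead k hk h h0]; positivity
  have zs' (k : ℕ) (hk : k ≤ μ - 3) (h : k < μ - 3 ∨ c 1 = 0 ∧ c 3 = 0)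
      (h0 : ∀ j < k, slot c j = 0) : ∀ j < k, slot c' j = 0 := by
    intro j hj
    rw [ht.lead j (by omega) (h.imp (fun h => by omega) id) fun i hi => h0 i (by omega), h0 j hj,
      mul_zero]
  have h0 := slot_zero c
  cases l with
  | zero => exact z1 h
  | two k =>
    obtain ⟨hk, hk'⟩ := hl
    exact ⟨zs' k (by omega) (by omega) h.1, z2 h.2.1, zs k (by omega) (by omega) h.1 h.2.2⟩
  | twoTop => exact ⟨zs' _ (by omega) (by omega) h.1, z2 h.2⟩
  | r k =>
    obtain ⟨hk, hk'⟩ := hl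
    exact ⟨zs' k (by omega) (by omega) h.1, z2' h.2.1, z3 h.2.2.1,
      zs k (by omega) (by omega) h.1 h.2.2.2⟩
  | rTop => exact ⟨zs' _ (by omega) (by omega) h.1, z2' h.2.1, z3 h.2.2⟩
  | threeOne =>
    exact ⟨zs' 1 (by omega) (by omega) h.1, z2' h.2.1, z3' h.2.2.1,
      zs 1 (by omega) (by omega) h.1 h.2.2.2⟩
  | one k =>
    obtain ⟨hk, hk'⟩ := hl
    have h1 : c 1 = 0 := h0 ▸ h.1 0 (by omega)
    exact ⟨zs' k (by omega) (by omega) h.1, z2' h.2.1, z3' h.2.2.1,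
      z4 h1 h.2.1 h.2.2.1 h.2.2.2.1, fun hk2 => zs k (by omega) (by omega) h.1 (h.2.2.2.2 hk2)⟩
  | iso k =>
    obtain ⟨hk, hk'⟩ := hl
    have h1 : c 1 = 0 := h0 ▸ h.1 0 (by omega)
    exact ⟨zs' k (by omega) (by omega) h.1, z2' h.2.1, z3' h.2.2.1,
      z4' h1 h.2.1 h.2.2.1 h.2.2.2.1, zs k (by omega) (Or.inr ⟨h1, h.2.2.1⟩) h.1 h.2.2.2.2⟩
  | top =>
    have h1 : c 1 = 0 := h0 ▸ h.1 0 (by omega)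
    exact ⟨zs' _ le_rfl (Or.inr ⟨h1, h.2.2.1⟩) h.1, z2' h.2.1, z3' h.2.2.1,
      z4' h1 h.2.1 h.2.2.1 h.2.2.2⟩

/-- The index `i` of the form `θ_i` that has coefficient `1` in the normal forms of a family. -/
def leadIndex : Label → ℕ
  | zero => 1
  | two _ | twoTop => 2
  | r _ | rTop => 3
  | threeOne => 5
  | one _ => 4
  | iso k => 4 + k
  -- The index 0 lies outside 1, …, μ, so this family has no coefficient equal to 1.
  | top => 0

/-- The coordinates of the normal forms. -/
def normalCoeff (μ : ℕ) (l : Label) (c : ℕ → ℝ) (i : ℕ) : ℝ :=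
  if i = l.leadIndex then 1 else if i ∈ l.params μ then c i else 0

theorem params_subset {μ : ℕ} (hμ : 5 < μ) {l : Label} (hl : l.Valid μ) :
    l.params μ ⊆ Finset.Icc 1 μ := by
  intro i hi
  rw [Finset.mem_Icc]
  cases l <;> simp [params, Valid] at hi hl <;> omega

theorem leadIndex_notMem_params {μ : ℕ} (hμ : 5 < μ) {l : Label} (hl : l.Valid μ) :
    l.leadIndex ∉ l.params μ := by
  cases l <;> simp [params, Valid, leadIndex] at hl ⊢ <;> omega

theorem leadIndex_mem {μ : ℕ} (hμ : 5 < μ) {l : Label} (hl : l.Valid μ) (h : l ≠ top) :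
    l.leadIndex ∈ Finset.Icc 1 μ := by
  rw [Finset.mem_Icc]
  cases l <;> simp [Valid, leadIndex] at hl h ⊢ <;> omega

theorem inClass_normalCoeff {μ : ℕ} (hμ : 5 < μ) {l : Label} (hl : l.Valid μ) {c : ℕ → ℝ}
    (hc : l.Admissible μ c) : l.InClass μ (l.normalCoeff μ c) := by
  cases l <;> simp [InClass, Admissible, Valid, normalCoeff, leadIndex, params, slot] at hl hc ⊢ <;>
    grind

end Label

/-! ### Bringing the elements of each class to a normal form. -/

section
variable {d : ℕ} {hd : 3 ≤ d}

theorem comb_indicator {μ : ℕ} {s : Finset ℕ} (hs : s ⊆ Finset.Icc 1 μ) (v : ℕ → ℝ) :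
    comb hd μ (fun i => if i ∈ s then v i else 0) = ∑ i ∈ s, v i • theta d hd i := by
  rw [comb, ← Finset.sum_subset hs]
  · exact Finset.sum_congr rfl fun i hi => by rw [if_pos hi]
  · intro i _ hi
    rw [if_neg hi, zero_smul]

theorem comb_normalCoeff {μ : ℕ} (hμ : 5 < μ) {l : Label} (hl : l.Valid μ) (c : ℕ → ℝ) :
    comb hd μ (l.normalCoeff μ c) = l.form d hd μ c := by
  by_cases h : l = Label.top
  · subst h
    refine Finset.sum_eq_zero fun i hi => ?_
    have := (Finset.mem_Icc.1 hi).1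
    rw [Label.normalCoeff, if_neg (by simp [Label.leadIndex]; omega)]
    simp [Label.params]
  have h1 : comb hd μ (l.normalCoeff μ c) =
      comb hd μ (fun i => if i ∈ insert l.leadIndex (l.params μ) then
        (if i = l.leadIndex then 1 else c i) else 0) := by
    congr 1
    ext i
    by_cases hi : i = l.leadIndex <;> simp [Label.normalCoeff, hi]
  have h2 : insert l.leadIndex (l.params μ) ⊆ Finset.Icc 1 μ :=
    Finset.insert_subset (Label.leadIndex_mem hμ hl h) (Label.params_subset hμ hl)
  have h3 := Label.leadIndex_notMem_params hμ hl
  rw [h1, comb_indicator h2, Finset.sum_insert h3, if_pos rfl, one_smul,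
    Finset.sum_congr rfl (g := fun i => c i • theta d hd i) fun i hi => by
      rw [if_neg (by rintro rfl; exact h3 hi)]]
  cases l <;> simp only [Label.params, Label.leadIndex, Label.form, Label.Valid] at hl ⊢
  · rw [Finset.sum_pair (by omega), add_assoc]
  · rw [Finset.sum_pair (by omega), add_assoc]
  · rw [Finset.sum_pair (by omega), add_assoc]
  · rw [Finset.sum_pair (by omega), add_assoc]
  · rw [Finset.sum_singleton]
  · rw [Finset.sum_singleton, add_comm]
  · rw [Finset.sum_singleton]
  · rw [Finset.sum_empty, add_zero]
  · exact absurd rfl h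

/-- A positive n-th root adjusts the absolute value; the sign needs a reflection s, since for even n
a power t^n cannot change it. -/
theorem exists_pow_mul_eq {x : ℝ} (hx : x ≠ 0) {n : ℕ} (hn : n ≠ 0) :
    ∃ s t : ℝ, s ^ 2 = 1 ∧ t ≠ 0 ∧ s * t ^ n * x = 1 := by
  have h : 0 < |x|⁻¹ := by positivity
  have ht : (|x|⁻¹ ^ (n : ℝ)⁻¹) ^ n = |x|⁻¹ := Real.rpow_inv_natCast_pow h.le hn
  refine ⟨SignType.sign x, |x|⁻¹ ^ (n : ℝ)⁻¹, ?_, (Real.rpow_pos_of_pos h _).ne', ?_⟩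
  · rcases lt_or_gt_of_ne hx with h | h <;> simp [h]
  · rw [ht, mul_right_comm, sign_mul_self]
    exact mul_inv_cancel₀ (abs_ne_zero.2 hx)

theorem exists_reaches_eq_one {μ : ℕ} (hμ : 5 < μ) {c : ℕ → ℝ} {i : ℕ} (hi : i ∈ Finset.Icc 1 μ)
    (h : c i ≠ 0) :
    ∃ c', Reaches hd μ c c' ∧ c' i = 1 ∧ ∀ j ∈ Finset.Icc 1 μ, (c' j = 0 ↔ c j = 0) := by
  have key {s₁ s₂ t : ℝ} (h₁ : s₁ ^ 2 = 1) (h₂ : s₂ ^ 2 = 1) (ht : t ≠ 0) {c' : ℕ → ℝ}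
      (k1 : c' 1 = s₁ * t ^ (μ - 1) * c 1) (k2 : c' 2 = s₂ * t ^ (μ - 1) * c 2)
      (k3 : c' 3 = s₁ * s₂ * t ^ (2 * (μ - 3)) * c 3)
      (k4 : c' 4 = s₁ * s₂ * t ^ (2 * (μ - 3) + 2) * c 4)
      (k5 : ∀ k, k + 1 < μ - 3 → c' (k + 5) = s₁ * t ^ (μ + 2 * k + 1) * c (k + 5)) :
      ∀ j ∈ Finset.Icc 1 μ, (c' j = 0 ↔ c j = 0) := by
    have hs₁ : s₁ ≠ 0 := by rintro rfl; norm_num at h₁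
    have hs₂ : s₂ ≠ 0 := by rintro rfl; norm_num at h₂
    intro j hj
    rcases mem_Icc_cases hj with rfl | rfl | rfl | rfl | ⟨k, hk, rfl⟩
    · simp [k1, hs₁, ht]
    · simp [k2, hs₂, ht]
    · simp [k3, hs₁, hs₂, ht]
    · simp [k4, hs₁, hs₂, ht]
    · simp [k5 k hk, hs₁, ht]
  rcases mem_Icc_cases hi with rfl | rfl | rfl | rfl | ⟨k, hk, rfl⟩
  · obtain ⟨s, t, hs, ht, e⟩ := exists_pow_mul_eq h (n := μ - 1) (by omega)
    obtain ⟨c', hc', k1, k2, k3, k4, k5⟩ :=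
      exists_reaches_scale (hd := hd) hμ hs (one_pow 2) ht c
    exact ⟨c', hc', k1.trans e, key hs (one_pow 2) ht k1 k2 k3 k4 k5⟩
  · obtain ⟨s, t, hs, ht, e⟩ := exists_pow_mul_eq h (n := μ - 1) (by omega)
    obtain ⟨c', hc', k1, k2, k3, k4, k5⟩ :=
      exists_reaches_scale (hd := hd) hμ (one_pow 2) hs ht c
    exact ⟨c', hc', k2.trans e, key (one_pow 2) hs ht k1 k2 k3 k4 k5⟩
  · obtain ⟨s, t, hs, ht, e⟩ := exists_pow_mul_eq h (n := 2 * (μ - 3)) (by omega)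
    obtain ⟨c', hc', k1, k2, k3, k4, k5⟩ :=
      exists_reaches_scale (hd := hd) hμ hs (one_pow 2) ht c
    exact ⟨c', hc', by rw [k3, mul_one, e], key hs (one_pow 2) ht k1 k2 k3 k4 k5⟩
  · obtain ⟨s, t, hs, ht, e⟩ := exists_pow_mul_eq h (n := 2 * (μ - 3) + 2) (by omega)
    obtain ⟨c', hc', k1, k2, k3, k4, k5⟩ :=
      exists_reaches_scale (hd := hd) hμ hs (one_pow 2) ht c
    exact ⟨c', hc', by rw [k4, mul_one, e], key hs (one_pow 2) ht k1 k2 k3 k4 k5⟩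
  · obtain ⟨s, t, hs, ht, e⟩ := exists_pow_mul_eq h (n := μ + 2 * k + 1) (by omega)
    obtain ⟨c', hc', k1, k2, k3, k4, k5⟩ :=
      exists_reaches_scale (hd := hd) hμ hs (one_pow 2) ht c
    exact ⟨c', hc', (k5 k hk).trans e, key hs (one_pow 2) ht k1 k2 k3 k4 k5⟩

namespace Label

theorem Admissible.congr {μ : ℕ} {l : Label} {c c' : ℕ → ℝ}
    (hc : ∀ i ∈ l.params μ, (c' i = 0 ↔ c i = 0)) (h : l.Admissible μ c) : l.Admissible μ c' := by
  cases l <;> simp only [Admissible, params, Finset.mem_insert, Finset.mem_singleton,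
    forall_eq_or_imp, forall_eq, mul_eq_zero] at h hc ⊢ <;> grind

/-- Once the superfluous coordinates are zero, a constant scaling finishes. It preserves which
coordinates vanish, and admissibility depends on nothing else. -/
theorem exists_reaches_normalCoeff {μ : ℕ} (hμ : 5 < μ) {l : Label} (hl : l.Valid μ)
    (ht : l ≠ top) {c : ℕ → ℝ} (hc : l.Admissible μ c) (h1 : c l.leadIndex ≠ 0)
    (h0 : ∀ i ∈ Finset.Icc 1 μ, i ≠ l.leadIndex → i ∉ l.params μ → c i = 0) :
    ∃ p, l.Admissible μ p ∧ Reaches hd μ c (l.normalCoeff μ p) := by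
  obtain ⟨c', hc', k1, k2⟩ := exists_reaches_eq_one (hd := hd) hμ (leadIndex_mem hμ hl ht) h1
  refine ⟨c', hc.congr fun i hi => k2 i (params_subset hμ hl hi),
    reaches_of_eqOn hc' fun i hi => ?_⟩
  rw [normalCoeff]
  split_ifs with e1 e2
  · rw [e1, k1]
  · rfl
  · exact (k2 i hi).2 (h0 i hi e1 e2)

theorem InClass.exists_reaches {μ : ℕ} (hμ : 5 < μ) {l : Label} (hl : l.Valid μ) {c : ℕ → ℝ}
    (h : l.InClass μ c) : ∃ p, l.Admissible μ p ∧ Reaches hd μ c (l.normalCoeff μ p) := by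
  have h0 := slot_zero c
  suffices H : l ≠ top → ∃ c', Reaches hd μ c c' ∧ l.Admissible μ c' ∧ c' l.leadIndex ≠ 0 ∧
      ∀ i ∈ Finset.Icc 1 μ, i ≠ l.leadIndex → i ∉ l.params μ → c' i = 0 by
    by_cases ht : l = top
    · subst ht
      refine ⟨0, trivial, reaches_of_eqOn (Reaches.refl _ _) fun i hi => ?_⟩
      have h1 := slot_succ c
      rcases mem_Icc_cases hi with rfl | rfl | rfl | rfl | ⟨k, hk, rfl⟩ <;>
        simp [InClass, normalCoeff, leadIndex, params] at h ⊢ <;> grind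
    · obtain ⟨c', hc', k1, k2, k3⟩ := H ht
      obtain ⟨p, hp, hp'⟩ := exists_reaches_normalCoeff (hd := hd) hμ hl ht k1 k2 k3
      exact ⟨p, hp, hc'.trans hp'⟩
  intro ht
  have hm : ((μ - 3 : ℕ) : ℝ) ≠ 0 := by
    have : μ - 3 ≠ 0 := by omega
    exact_mod_cast this
  cases l with
  | zero =>
    simp only [InClass] at h
    -- Three moves: clearing all later slots may change θ₄; the factor 1 + κx₂ then removes θ₄
    -- because c₁ ≠ 0, but disturbs θ_μ; a truncation with j = 2 clears θ_μ again without touching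
    -- θ₄.
    obtain ⟨b, hb, b1, b2, b3, -, b5, b6⟩ := exists_reaches_truncate (hd := hd) hμ (k := 0)
      (le_refl 1) (c := c) (by simp) (by rwa [slot_zero])
    have hb' := exists_reaches_x₂ (hd := hd) hμ (b 4 / ((μ - 3 : ℕ) * c 1)) b
    have e4 : b 4 - (μ - 3 : ℕ) * (b 4 / ((μ - 3 : ℕ) * c 1)) * b 1 = 0 := by
      rw [b1]
      field_simp
      ring
    rw [e4] at hb'
    generalize b μ - _ = y at hb'
    set b' := Function.update (Function.update b 4 0) μ y with hb''
    have u (i : ℕ) (h4 : i ≠ 4) (hi : i ≠ μ) : b' i = b i := by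
      rw [hb'', Function.update_of_ne hi, Function.update_of_ne h4]
    have u4 : b' 4 = 0 := by
      rw [hb'', Function.update_of_ne (by omega), Function.update_self]
    obtain ⟨c', hc', c1, c2, c3, c4, c5, c6⟩ := exists_reaches_truncate (hd := hd) hμ (k := 0)
      one_le_two (c := b') (by simp) (by rwa [slot_zero, u 1 (by omega) (by omega), b1])
    refine ⟨c', (hb.trans hb').trans hc', trivial, ?_, fun i hi hl hp => ?_⟩
    · rw [leadIndex, c1, u 1 (by omega) (by omega), b1]
      exact h
    · rcases mem_Icc_cases hi with rfl | rfl | rfl | rfl | ⟨k, hk, rfl⟩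
      · exact absurd rfl hl
      · simp [params] at hp
      · simp [params] at hp
      · rw [c4 (Or.inl (by omega)), u4]
      · rw [← slot_succ c']
        rcases k with _ | k
        · rw [c5 _ hk (by omega), slot_succ, u _ (by omega) (by omega), ← slot_succ b,
            b6 _ hk (by omega)]
        · exact c6 _ hk (by omega)
  | two k =>
    obtain ⟨hk, hk'⟩ := hl
    obtain ⟨k1, k2, k3⟩ := h
    -- The effect of this truncation on θ₄ is harmless: c₂ ≠ 0 allows removing θ₄ afterwards without
    -- affecting anything else.
    obtain ⟨b, hb, b1, b2, b3, -, b5, b6⟩ := exists_reaches_truncate (hd := hd) hμ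
      (le_refl 1) k1 k3
    refine ⟨_, hb.trans (reaches_update_four hμ (by rwa [b2])), ?_, ?_, fun i hi hl hp => ?_⟩
    · rw [Admissible, Function.update_of_ne (by omega), ← slot_eq b hk, b5 k (by omega) (by omega)]
      exact k3
    · rw [leadIndex, Function.update_of_ne (by omega), b2]
      exact k2
    · have s1 := slot_succ b
      rcases mem_Icc_cases hi with rfl | rfl | rfl | rfl | ⟨k, hk, rfl⟩ <;>
        simp [leadIndex, params] at hl hp ⊢ <;> grind
  | twoTop =>
    obtain ⟨k1, k2⟩ := h
    have h1 : c 1 = 0 := h0 ▸ k1 0 (by omega)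
    -- If c₃ ≠ 0, the factor 1 + κx₂ removes θ_μ; this is the source of the condition c₃ c_μ = 0.
    have H : ∃ b, Reaches hd μ c b ∧ (∀ i, i ≠ 4 → i ≠ μ → b i = c i) ∧ b 3 * b μ = 0 := by
      by_cases h3 : c 3 = 0
      · exact ⟨c, Reaches.refl _ _, fun _ _ _ => rfl, by rw [h3, zero_mul]⟩
      · have hb := exists_reaches_x₂ (hd := hd) hμ
          (c μ / (3 * ((μ - 3 : ℕ) / 2) * (μ - 3 : ℕ) * c 3)) c
        refine ⟨_, hb, fun i h4 hi => ?_, ?_⟩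
        · rw [Function.update_of_ne hi, Function.update_of_ne h4]
        · rw [Function.update_self]
          field_simp
          simp
    obtain ⟨b, hb, b1, b2⟩ := H
    refine ⟨_, hb.trans (reaches_update_four hμ (by rwa [b1 2 (by omega) (by omega)])), ?_, ?_,
      fun i hi hl hp => ?_⟩
    · rw [Admissible, Function.update_of_ne (by omega), Function.update_of_ne (by omega), b2]
    · rw [leadIndex, Function.update_of_ne (by omega), b1 2 (by omega) (by omega)]
      exact k2
    · have s1 := slot_succ c
      rcases mem_Icc_cases hi with rfl | rfl | rfl | rfl | ⟨k, hk, rfl⟩ <;>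
        simp [leadIndex, params] at hl hp ⊢ <;> grind
  | r k =>
    obtain ⟨hk, hk'⟩ := hl
    obtain ⟨k1, k2, k3, k4⟩ := h
    -- The factor 1 + κx₃ is spent on removing θ₄, using c₃ ≠ 0. Only j ≥ 2 is left for the slots,
    -- so slot k + 1 stays as a second parameter.
    obtain ⟨b, hb, b1, b2, b3, b4, b5⟩ := exists_reaches_x₃ (hd := hd) hμ (le_refl 1)
      (-c 4 / ((μ - 3 : ℕ) * c 3)) c
    have h4 : b 4 = 0 := by
      rw [b4, if_pos rfl]
      field_simp
      ring
    have b6 := (b5 k k1).1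
    obtain ⟨c', hc', c1, c2, c3, c4, c5, c6⟩ := exists_reaches_truncate (hd := hd) hμ (k := k)
      one_le_two (c := b) (fun i hi => by rw [b6 i (by omega) (by omega), k1 i hi])
      (by rwa [b6 k (by omega) (by omega)])
    have c4' := c4 (Or.inl (by omega))
    refine ⟨c', hb.trans hc', ?_, ?_, fun i hi hl hp => ?_⟩
    · rw [Admissible, ← slot_eq c' hk, c5 k (by omega) (by omega), b6 k (by omega) (by omega)]
      exact k4
    · rw [leadIndex, c3, b3]
      exact k3
    · have s1 := slot_succ c'
      rcases mem_Icc_cases hi with rfl | rfl | rfl | rfl | ⟨k, hk, rfl⟩ <;>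
        simp [leadIndex, params] at hl hp ⊢ <;> grind
  | rTop =>
    obtain ⟨k1, k2, k3⟩ := h
    have h1 : c 1 = 0 := h0 ▸ k1 0 (by omega)
    obtain ⟨b, hb, b1, b2, b3, b4, b5⟩ := exists_reaches_x₃ (hd := hd) hμ (le_refl 1)
      (-c 4 / ((μ - 3 : ℕ) * c 3)) c
    have h4 : b 4 = 0 := by
      rw [b4, if_pos rfl]
      field_simp
      ring
    have b6 := (b5 _ k1).1
    -- Since c₁ = 0, this removes θ_μ and leaves θ₄ alone.
    have hb' := exists_reaches_x₂ (hd := hd) hμ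
      (b μ / (3 * ((μ - 3 : ℕ) / 2) * (μ - 3 : ℕ) * b 3)) b
    have e4 : b μ - 3 * ((μ - 3 : ℕ) / 2) * ((μ - 3 : ℕ) *
        (b μ / (3 * ((μ - 3 : ℕ) / 2) * (μ - 3 : ℕ) * b 3))) * b 3 = 0 := by
      rw [b3]
      field_simp
      ring
    rw [e4, b1, h1, mul_zero, sub_zero, h4] at hb'
    refine ⟨_, hb.trans hb', trivial, ?_, fun i hi hl hp => ?_⟩
    · rw [leadIndex, Function.update_of_ne (by omega), Function.update_of_ne (by omega), b3]
      exact k3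
    · have s1 := slot_succ b
      rcases mem_Icc_cases hi with rfl | rfl | rfl | rfl | ⟨k, hk, rfl⟩ <;>
        simp [leadIndex, params] at hl hp ⊢ <;> grind
  | threeOne =>
    obtain ⟨k1, k2, k3, k4⟩ := h
    obtain ⟨b, hb, b1, b2, b3, b4, b5, b6⟩ := exists_reaches_truncate (hd := hd) hμ
      (le_refl 1) k1 k4
    have s1 := slot_succ b
    have s2 := slot_succ c
    refine ⟨b, hb, trivial, ?_, fun i hi hl hp => ?_⟩
    · rw [leadIndex]; grind
    · rcases mem_Icc_cases hi with rfl | rfl | rfl | rfl | ⟨k, hk, rfl⟩ <;>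
        simp [leadIndex, params] at hl hp ⊢ <;> grind
  | one k =>
    obtain ⟨hk, hk'⟩ := hl
    obtain ⟨k1, k2, k3, k4, k5⟩ := h
    by_cases hk2 : k ≤ μ - 5
    · obtain ⟨b, hb, b1, b2, b3, b4, b5, b6⟩ := exists_reaches_truncate (hd := hd) hμ
        (le_refl 1) k1 (k5 hk2)
      have s1 := slot_succ b
      refine ⟨b, hb, fun _ => ?_, ?_, fun i hi hl hp => ?_⟩
      · rw [← slot_eq b (by omega : 1 ≤ k), b5 k (by omega) (by omega)]
        exact k5 hk2
      · rw [leadIndex]; grind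
      · rcases mem_Icc_cases hi with rfl | rfl | rfl | rfl | ⟨k, hk, rfl⟩ <;>
          simp [leadIndex, params] at hl hp ⊢ <;> grind
    · have s2 := slot_succ c
      refine ⟨c, Reaches.refl _ _, fun h => absurd h hk2, k4, fun i hi hl hp => ?_⟩
      rcases mem_Icc_cases hi with rfl | rfl | rfl | rfl | ⟨k, hk, rfl⟩ <;>
          simp [leadIndex, params] at hl hp ⊢ <;> grind
  | iso k =>
    obtain ⟨hk, hk'⟩ := hl
    obtain ⟨k1, k2, k3, k4, k5⟩ := h
    obtain ⟨b, hb, b1, b2, b3, b4, b5, b6⟩ := exists_reaches_truncate (hd := hd) hμ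
      (le_refl 1) k1 k5
    have s1 := slot_succ b
    refine ⟨b, hb, trivial, ?_, fun i hi hl hp => ?_⟩
    · rw [leadIndex, ← slot_eq b (by omega : 1 ≤ k), b5 k (by omega) (by omega)]
      exact k5
    · rcases mem_Icc_cases hi with rfl | rfl | rfl | rfl | ⟨k, hk, rfl⟩ <;>
        simp [leadIndex, params] at hl hp ⊢ <;> grind
  | top => exact absurd rfl ht

end Label

end

end SMu

namespace SMu

/-! ## Moduli -/

/-- A real root of unity is ±1, and γ^m = α² is nonnegative, hence equal to 1. -/
theorem Transforms.sq_eq_one {m : ℕ} {α a γ : ℝ} {c c' : ℕ → ℝ} (h : Transforms m α a γ c c')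
    {n : ℕ} (hn : n ≠ 0) (h1 : γ ^ n = 1) : α ^ 2 = 1 ∧ a ^ 2 = 1 ∧ γ ^ 2 = 1 := by
  have h2 : |γ| = 1 := by
    rw [← pow_eq_one_iff_of_nonneg (abs_nonneg γ) hn, ← abs_pow, h1, abs_one]
  have h3 : γ ^ m = 1 := by
    rw [← abs_of_nonneg (h.sq_left ▸ sq_nonneg α : 0 ≤ γ ^ m), abs_pow, h2, one_pow]
  exact ⟨h.sq_left.trans h3, h.sq_right.trans h3, by rw [← sq_abs, h2, one_pow]⟩

theorem Varies.eq_zero {m : ℕ} {l₁ l₃ : ℝ} {c c' : ℕ → ℝ} (h : Varies m l₁ l₃ c c') (hm : m ≠ 0)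
    {p q : ℝ} (hp : 0 < p) (hq : 0 ≤ q) (h0 : p * l₁ + q * l₃ = 0) : l₁ = 0 ∧ l₃ = 0 := by
  have hm' : (0 : ℝ) < m := by positivity
  have h1 : (p * m + 2 * q) * l₃ = 0 := by linear_combination p * h.rel + 2 * h0
  have h3 : l₃ = 0 := (mul_eq_zero.1 h1).resolve_left (by positivity)
  have := h.rel
  rw [h3] at this
  exact ⟨by linarith, h3⟩

theorem eq_or_eq_neg_of_sq_eq_one {w x y : ℝ} (hw : w ^ 2 = 1) (h : x = w * y) :
    x = y ∨ x = -y := by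
  rcases sq_eq_sq_iff_eq_or_eq_neg.1 (hw.trans (one_pow 2).symm) with rfl | rfl <;> simp [h]

namespace Label

/-- The leading coefficient is 1 on both sides, so its monomial factor is 1. Multiplying or squaring
with α² = a² = γ^m turns this into a positive power of γ equal to 1; all remaining factors then have
square 1. -/
theorem eq_or_eq_neg_of_transforms {μ : ℕ} (hμ : 5 < μ) {l : Label} (hl : l.Valid μ)
    {c c' : ℕ → ℝ} (hc : l.Admissible μ c) (hc' : l.Admissible μ c') {α a γ : ℝ}
    (h : Transforms (μ - 3) α a γ (l.normalCoeff μ c') (l.normalCoeff μ c)) :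
    ∀ i ∈ l.params μ, c i = c' i ∨ c i = -c' i := by
  have nk (k : ℕ) : 4 + k ≠ 1 ∧ 4 + k ≠ 2 ∧ 4 + k ≠ 3 ∧ 1 ≠ 4 + k ∧ 2 ≠ 4 + k ∧ 3 ≠ 4 + k := by
    omega
  have nμ : μ ≠ 1 ∧ μ ≠ 2 ∧ 1 ≠ μ ∧ 2 ≠ μ ∧ μ - 1 ≠ 3 ∧ 3 ≠ μ - 1 := by omega
  have hcl := inClass_normalCoeff hμ hl hc'
  have ha := h.sq_right
  have hα := h.sq_left
  have e1 := h.one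
  have e2 := h.two
  have e3 := h.three
  have e4 := h.four
  have w1 (k : ℕ) (hs : α ^ 2 = 1 ∧ a ^ 2 = 1 ∧ γ ^ 2 = 1) : (α * γ ^ k) ^ 2 = 1 := by
    rw [mul_pow, hs.1, one_mul, ← pow_mul, mul_comm, pow_mul, hs.2.2, one_pow]
  have w3 (hs : α ^ 2 = 1 ∧ a ^ 2 = 1 ∧ γ ^ 2 = 1) : (α * a) ^ 2 = 1 := by
    rw [mul_pow, hs.1, one_mul, hs.2.1]
  cases l with
  | zero =>
    simp [normalCoeff, leadIndex, params] at e1 e2 e3 ⊢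
    have hs := h.sq_eq_one (n := μ - 3 + 2) (by omega) (by
      rw [pow_add, ← hα, ← mul_pow, ← e1, one_pow])
    exact ⟨eq_or_eq_neg_of_sq_eq_one (by rw [mul_pow, hs.2.1, hs.2.2, one_mul]) e2,
      eq_or_eq_neg_of_sq_eq_one (w3 hs) e3⟩
  | two k =>
    obtain ⟨hk, hk'⟩ := hl
    have e5 := h.lead k (by omega) (by omega) hcl.1
    rw [slot_eq _ hk, slot_eq _ hk] at e5
    simp [normalCoeff, leadIndex, params, nk] at e2 e3 e5 ⊢
    have hs := h.sq_eq_one (n := μ - 3 + 2) (by omega) (by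
      rw [pow_add, ← ha, ← mul_pow, ← e2, one_pow])
    exact ⟨eq_or_eq_neg_of_sq_eq_one (w3 hs) e3, eq_or_eq_neg_of_sq_eq_one (w1 _ hs) e5⟩
  | twoTop =>
    have e5 := fun h' => h.lead (μ - 4) (by omega) (Or.inr h') hcl.1
    rw [slot_eq _ (by omega), slot_eq _ (by omega), show 4 + (μ - 4) = μ by omega] at e5
    simp [normalCoeff, leadIndex, params, nμ] at e2 e3 e5 ⊢
    have hs := h.sq_eq_one (n := μ - 3 + 2) (by omega) (by
      rw [pow_add, ← ha, ← mul_pow, ← e2, one_pow])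
    refine ⟨eq_or_eq_neg_of_sq_eq_one (w3 hs) e3, ?_⟩
    -- For c₃ ≠ 0 the law for θ_μ is unavailable, but then the condition c₃ c_μ = 0 makes c_μ zero
    -- in both normal forms.
    by_cases h3 : c' 3 = 0
    · exact eq_or_eq_neg_of_sq_eq_one (w1 _ hs) (e5 h3)
    · have h3' : c 3 ≠ 0 := by
        rw [e3]
        refine mul_ne_zero (fun h0 => ?_) h3
        have := w3 hs
        norm_num [h0] at this
      left
      rw [(mul_eq_zero.1 hc).resolve_left h3', (mul_eq_zero.1 hc').resolve_left h3]
  | r k =>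
    obtain ⟨hk, hk'⟩ := hl
    have e5 := h.lead k (by omega) (by omega) hcl.1
    -- θ₄ is absent from both normal forms, which is what `next` requires.
    have e6 := fun h1 h2 h3 h4 h4' => h.next h1 h2 h3 h4 h4' k (by omega) hcl.1
    rw [slot_eq _ hk, slot_eq _ hk] at e5
    rw [slot_succ, slot_succ] at e6
    have n5 : k + 5 ≠ 4 + k := by omega
    have n4' : k ≠ 0 := by omega
    simp [normalCoeff, leadIndex, params, nk, n5, n4', add_comm 5 k] at e3 e5 e6 ⊢
    have hs := h.sq_eq_one (n := 2 * (μ - 3)) (by omega) (by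
      rw [two_mul, pow_add]
      nth_rewrite 1 [← hα]
      rw [← ha, ← mul_pow, ← e3, one_pow])
    exact ⟨eq_or_eq_neg_of_sq_eq_one (w1 _ hs) e5, eq_or_eq_neg_of_sq_eq_one (w1 _ hs) e6⟩
  | rTop =>
    have e5 := h.lead (μ - 5) (by omega) (by omega) hcl.1
    rw [slot_eq _ (by omega), slot_eq _ (by omega), show 4 + (μ - 5) = μ - 1 by omega] at e5
    simp [normalCoeff, leadIndex, params, nμ] at e3 e5 ⊢
    have hs := h.sq_eq_one (n := 2 * (μ - 3)) (by omega) (by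
      rw [two_mul, pow_add]
      nth_rewrite 1 [← hα]
      rw [← ha, ← mul_pow, ← e3, one_pow])
    exact eq_or_eq_neg_of_sq_eq_one (w1 _ hs) e5
  | threeOne =>
    have e5 := h.lead 1 (by omega) (by omega) hcl.1
    rw [slot_succ, slot_succ] at e5
    simp [normalCoeff, leadIndex, params] at e4 e5 ⊢
    have hs := h.sq_eq_one (n := μ - 3 + 4) (by omega) (by
      rw [pow_add, ← hα]
      linear_combination (-1 - α * γ ^ 2) * e5)
    exact eq_or_eq_neg_of_sq_eq_one (by rw [mul_pow, w3 hs, hs.2.2, one_mul]) e4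
  | one k =>
    obtain ⟨hk, hk'⟩ := hl
    have e5 := fun h' => h.lead k (by omega) (Or.inr h') hcl.1
    rw [slot_eq _ (by omega), slot_eq _ (by omega)] at e5
    have n4 : k ≠ 0 := by omega
    simp [normalCoeff, leadIndex, params, nk, n4] at e4 e5 ⊢
    have hs := h.sq_eq_one (n := (μ - 3) + (μ - 3) + 2) (by omega) (by
      rw [pow_add, pow_add]
      nth_rewrite 1 [← hα]
      rw [← ha, ← mul_pow, ← mul_pow, ← e4, one_pow])
    exact eq_or_eq_neg_of_sq_eq_one (w1 _ hs) e5
  | iso k => simp [params]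
  | top => simp [params]

/-- A direction within the family does not move the leading coefficient 1. This is a relation p l₁ +
q l₃ = 0 with p > 0 and q ≥ 0, which together with m l₃ = 2 l₁ gives l₁ = l₃ = 0. -/
theorem eq_zero_of_varies {μ : ℕ} (hμ : 5 < μ) {l : Label} (hl : l.Valid μ)
    {c v c' : ℕ → ℝ} (hc : l.Admissible μ c)
    (hv : ∀ᶠ s in 𝓝 (0 : ℝ), l.Admissible μ (c + s • v)) {l₁ l₃ : ℝ}
    (h : Varies (μ - 3) l₁ l₃ (l.normalCoeff μ c) c')
    (hc' : ∀ i ∈ Finset.Icc 1 μ, c' i = if i ∈ l.params μ then v i else 0) :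
    ∀ i ∈ l.params μ, v i = 0 := by
  have nk (k : ℕ) : 4 + k ≠ 1 ∧ 4 + k ≠ 2 ∧ 4 + k ≠ 3 ∧ 1 ≠ 4 + k ∧ 2 ≠ 4 + k ∧ 3 ≠ 4 + k := by
    omega
  have nμ : μ ≠ 1 ∧ μ ≠ 2 ∧ 1 ≠ μ ∧ 2 ≠ μ ∧ μ - 1 ≠ 3 ∧ 3 ≠ μ - 1 := by omega
  have hcl := inClass_normalCoeff hμ hl hc
  have hm : μ - 3 ≠ 0 := by omega
  have e1 := h.one
  have e2 := h.two
  have e3 := h.three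
  have e4 := h.four
  rw [hc' _ (Finset.mem_Icc.2 (by omega))] at e1 e2 e3 e4
  have es (k : ℕ) (hk : 1 ≤ k) (hk' : k < μ - 3) :
      slot c' k = if 4 + k ∈ l.params μ then v (4 + k) else 0 := by
    rw [slot_eq c' hk, hc' _ (Finset.mem_Icc.2 (by omega))]
  cases l with
  | zero =>
    simp [normalCoeff, leadIndex, params] at e1 e2 e3 ⊢
    obtain ⟨rfl, rfl⟩ := h.eq_zero hm one_pos zero_le_one (by linarith)
    simp [e2, e3]
  | two k =>
    obtain ⟨hk, hk'⟩ := hl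
    have e5 := h.lead k (by omega) (by omega) hcl.1
    rw [es k hk (by omega), slot_eq _ hk] at e5
    simp [normalCoeff, leadIndex, params, nk] at e2 e3 e5 ⊢
    obtain ⟨rfl, rfl⟩ := h.eq_zero hm one_pos zero_le_one (by linarith)
    simp [e3, e5]
  | twoTop =>
    have e5 := fun h' => h.lead (μ - 4) (by omega) (Or.inr h') hcl.1
    rw [es _ (by omega) (by omega), slot_eq _ (by omega), show 4 + (μ - 4) = μ by omega] at e5
    simp [normalCoeff, leadIndex, params, nμ] at e2 e3 e5 ⊢
    obtain ⟨rfl, rfl⟩ := h.eq_zero hm one_pos zero_le_one (by linarith)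
    have e3' : v 3 = 0 := by simpa using e3
    refine ⟨e3', ?_⟩
    by_cases h3 : c 3 = 0
    · simpa using e5 h3
    -- Here c₃ ≠ 0, v₃ = 0 and c_μ = 0, so admissibility at one small s ≠ 0 already reads c₃ s v_μ =
    -- 0.
    · obtain ⟨s, hs, hs0⟩ := ((hv.filter_mono nhdsWithin_le_nhds).and
        (self_mem_nhdsWithin : ({0}ᶜ : Set ℝ) ∈ 𝓝[≠] (0 : ℝ))).exists
      have h4 := (mul_eq_zero.1 hc).resolve_left h3
      simpa [Admissible, e3', h3, h4, Set.mem_compl_singleton_iff.1 hs0] using hs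
  | r k =>
    obtain ⟨hk, hk'⟩ := hl
    have e5 := h.lead k (by omega) (by omega) hcl.1
    have e6 := fun h1 h2 h3 h4' => h.next h1 h2 h3 h4' k (by omega) hcl.1
    rw [es k hk (by omega), slot_eq _ hk] at e5
    rw [es _ (by omega) (by omega), slot_succ, hc' _ (Finset.mem_Icc.2 (by omega))] at e6
    have n5 : k + 5 ≠ 4 + k := by omega
    have n4' : k ≠ 0 := by omega
    have n6 : 4 + (k + 1) = k + 5 := by omega
    simp [normalCoeff, leadIndex, params, nk, n5, n4', n6, add_comm 5 k] at e3 e5 e6 ⊢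
    obtain ⟨rfl, rfl⟩ := h.eq_zero hm two_pos le_rfl (by linarith)
    simp [e5, e6]
  | rTop =>
    have e5 := h.lead (μ - 5) (by omega) (by omega) hcl.1
    rw [es _ (by omega) (by omega), slot_eq _ (by omega), show 4 + (μ - 5) = μ - 1 by omega] at e5
    simp [normalCoeff, leadIndex, params, nμ] at e3 e5 ⊢
    obtain ⟨rfl, rfl⟩ := h.eq_zero hm two_pos le_rfl (by linarith)
    simp [e5]
  | threeOne =>
    have e5 := h.lead 1 (by omega) (by omega) hcl.1
    rw [es _ (by omega) (by omega), slot_succ] at e5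
    simp [normalCoeff, leadIndex, params] at e4 e5 ⊢
    obtain ⟨rfl, rfl⟩ := h.eq_zero hm one_pos zero_le_two (by linarith)
    simp [e4]
  | one k =>
    obtain ⟨hk, hk'⟩ := hl
    have e5 := fun h' => h.lead k (by omega) (Or.inr h') hcl.1
    rw [es _ (by omega) (by omega), slot_eq _ (by omega)] at e5
    have n4 : k ≠ 0 := by omega
    simp [normalCoeff, leadIndex, params, nk, n4] at e4 e5 ⊢
    obtain ⟨rfl, rfl⟩ := h.eq_zero hm two_pos zero_le_one (by linarith)
    simp [e5]
  | iso k => simp [params]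
  | top => simp [params]

/-! ## The singularity classes as submanifolds -/

/-- The coordinates that vanish on a singularity class. -/
def zeros (μ : ℕ) : Label → Finset ℕ
  | zero => ∅
  | two k => {1} ∪ Finset.Icc 5 (3 + k)
  | twoTop => {1} ∪ Finset.Icc 5 (μ - 1)
  | r k => {1, 2} ∪ Finset.Icc 5 (3 + k)
  | rTop => {1, 2} ∪ Finset.Icc 5 (μ - 2)
  | threeOne => {1, 2, 3}
  | one k => {1, 2, 3} ∪ Finset.Icc 5 (3 + k)
  | iso k => {1, 2, 3, 4} ∪ Finset.Icc 5 (3 + k)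
  | top => Finset.Icc 1 μ

/-- The coordinates that vanish nowhere on a singularity class. -/
def nonzeros (μ : ℕ) : Label → Finset ℕ
  | zero => {1}
  | two k => {2, 4 + k}
  | twoTop => {2}
  | r k => {3, 4 + k}
  | rTop => {3}
  | threeOne => {5}
  | one k => if k ≤ μ - 5 then {4, 4 + k} else {4}
  | iso k => {4 + k}
  | top => ∅

theorem zeros_subset {μ : ℕ} (hμ : 5 < μ) {l : Label} (hl : l.Valid μ) :
    l.zeros μ ⊆ Finset.Icc 1 μ := by
  intro i hi
  rw [Finset.mem_Icc]
  cases l <;> simp [zeros, Valid] at hi hl <;> omega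

theorem nonzeros_subset {μ : ℕ} (hμ : 5 < μ) {l : Label} (hl : l.Valid μ) :
    l.nonzeros μ ⊆ Finset.Icc 1 μ := by
  intro i hi
  rw [Finset.mem_Icc]
  cases l <;> simp [nonzeros, Valid] at hi hl
  case one k =>
    split_ifs at hi <;> simp at hi <;> omega
  all_goals omega

theorem card_zeros {μ : ℕ} (hμ : 5 < μ) {l : Label} (hl : l.Valid μ) :
    (l.zeros μ).card = l.cod μ := by
  have hd (s : Finset ℕ) (hs : s ⊆ {1, 2, 3, 4}) (n : ℕ) :
      (s ∪ Finset.Icc 5 n).card = s.card + (n - 4) := by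
    rw [Finset.card_union_of_disjoint, Nat.card_Icc]
    · omega
    · refine Finset.disjoint_left.2 fun i hi hi' => ?_
      have h1 := hs hi
      simp at h1 hi'
      omega
  cases l <;> simp only [zeros, cod, Valid] at hl ⊢
  case zero => rfl
  case threeOne => rfl
  case top => simp
  all_goals
    rw [hd _ (by decide)]
    simp
    omega

theorem slot_eq_zero_iff (c : ℕ → ℝ) {k : ℕ} (hk : 1 ≤ k) :
    (∀ j < k, slot c j = 0) ↔ c 1 = 0 ∧ ∀ i ∈ Finset.Icc 5 (3 + k), c i = 0 := by
  refine ⟨fun h => ⟨slot_zero c ▸ h 0 (by omega), fun i hi => ?_⟩, fun h j hj => ?_⟩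
  · rw [Finset.mem_Icc] at hi
    obtain ⟨j, rfl⟩ : ∃ j, i = j + 5 := ⟨i - 5, by omega⟩
    rw [← slot_succ c, h _ (by omega)]
  · rcases j with _ | j
    · rw [slot_zero, h.1]
    · rw [slot_succ, h.2 _ (by rw [Finset.mem_Icc]; omega)]

theorem inClass_iff {μ : ℕ} (hμ : 5 < μ) {l : Label} (hl : l.Valid μ) (c : ℕ → ℝ) :
    l.InClass μ c ↔ (∀ i ∈ l.zeros μ, c i = 0) ∧ ∀ i ∈ l.nonzeros μ, c i ≠ 0 := by
  have hU (s t : Finset ℕ) : (∀ i ∈ s ∪ t, c i = 0) ↔ (∀ i ∈ s, c i = 0) ∧ ∀ i ∈ t, c i = 0 := by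
    simp [or_imp, forall_and]
  cases l with
  | zero => simp [InClass, zeros, nonzeros]
  | two k =>
    obtain ⟨hk, hk'⟩ := hl
    rw [InClass, slot_eq_zero_iff c hk, zeros, nonzeros, hU, slot_eq c hk]
    simp
  | twoTop =>
    rw [InClass, slot_eq_zero_iff c (by omega), zeros, nonzeros, hU,
      show 3 + (μ - 4) = μ - 1 by omega]
    simp
  | r k =>
    obtain ⟨hk, hk'⟩ := hl
    rw [InClass, slot_eq_zero_iff c hk, zeros, nonzeros, hU, slot_eq c hk]
    simp
    tauto
  | rTop =>
    rw [InClass, slot_eq_zero_iff c (by omega), zeros, nonzeros, hU,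
      show 3 + (μ - 5) = μ - 2 by omega]
    simp
    tauto
  | threeOne =>
    rw [InClass, slot_eq_zero_iff c le_rfl, zeros, nonzeros, slot_eq c le_rfl]
    simp
    tauto
  | one k =>
    obtain ⟨hk, hk'⟩ := hl
    rw [InClass, slot_eq_zero_iff c (by omega), zeros, nonzeros, hU, slot_eq c (by omega)]
    split_ifs with h <;> simp [h] <;> tauto
  | iso k =>
    obtain ⟨hk, hk'⟩ := hl
    rw [InClass, slot_eq_zero_iff c (by omega), zeros, nonzeros, hU, slot_eq c (by omega)]
    simp
    tauto
  | top =>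
    rw [InClass, slot_eq_zero_iff c (by omega), zeros, nonzeros]
    refine ⟨fun h => ⟨fun i hi => ?_, by simp⟩, fun h => ?_⟩
    · rcases mem_Icc_cases hi with rfl | rfl | rfl | rfl | ⟨k, hk, rfl⟩
      · exact h.1.1
      · exact h.2.1
      · exact h.2.2.1
      · exact h.2.2.2
      · exact h.1.2 _ (Finset.mem_Icc.2 (by omega))
    · have h1 (i : ℕ) (hi : 1 ≤ i ∧ i ≤ μ) := h.1 i (Finset.mem_Icc.2 hi)
      exact ⟨⟨h1 1 (by omega), fun i hi => h1 i (by rw [Finset.mem_Icc] at hi; omega)⟩,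
        h1 2 (by omega), h1 3 (by omega), h1 4 (by omega)⟩

theorem exists_admissible (μ : ℕ) (l : Label) : ∃ c, l.Admissible μ c := by
  cases l with
  | twoTop => exact ⟨0, by simp [Admissible]⟩
  | _ => exact ⟨1, by simp [Admissible]⟩

end Label

/-- Linear subspaces spanned by coordinate vectors, and their open subsets, are submanifolds. -/
theorem isSubmanifoldOfCodim_inter {m : ℕ} (Z : Finset (Fin m)) {U : Set (Fin m → ℝ)}
    (hU : IsOpen U) : IsSubmanifoldOfCodim ({x | ∀ i ∈ Z, x i = 0} ∩ U) Z.card := by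
  intro a ha
  let f : (Fin m → ℝ) →L[ℝ] (Fin Z.card → ℝ) :=
    ContinuousLinearMap.pi fun j => ContinuousLinearMap.proj (Z.equivFin.symm j : Fin m)
  have hf (x : Fin m → ℝ) (j : Fin Z.card) : f x j = x (Z.equivFin.symm j) := rfl
  refine ⟨U, f, hU, ha.2, f.contDiff.contDiffOn, fun x _ y => ?_, ?_⟩
  · rw [f.fderiv]
    refine ⟨fun i => if h : i ∈ Z then y (Z.equivFin ⟨i, h⟩) else 0, funext fun j => ?_⟩
    simp [hf]
  · ext x
    have : f x = 0 ↔ ∀ i ∈ Z, x i = 0 := by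
      refine ⟨fun h i hi => ?_, fun h => funext fun j => h _ (Z.equivFin.symm j).2⟩
      have := congrFun h (Z.equivFin ⟨i, hi⟩)
      simpa [hf] using this
    simp only [Set.mem_inter_iff, Set.mem_ofPred_eq, this]
    tauto

/-! ### Identification of the classes with their coordinate conditions, and the consequences. -/

section
variable {d : ℕ} {hd : 3 ≤ d}

theorem Reaches.transforms {μ : ℕ} (hμ : 5 < μ) {c c' : ℕ → ℝ} (h : Reaches hd μ c c') :
    ∃ α a γ, Transforms (μ - 3) α a γ c c' := by
  obtain ⟨Φ, hΦ, h⟩ := diffeomorphic_iff.1 h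
  obtain ⟨α, a, γ, ht⟩ := hΦ.transforms hμ c
  have e (i : ℕ) (hi : 1 ≤ i ∧ i ≤ μ) : coords hd μ (hΦ.pull (comb hd μ c)) i = c' i := by
    rw [coords_eq_of_restr_eq hμ h hi.2, coords_comb hd c' (Finset.mem_Icc.2 hi)]
  have es (k : ℕ) (hk : k < μ - 3) : slot (coords hd μ (hΦ.pull (comb hd μ c))) k = slot c' k := by
    rw [slot, slot, e 1 (by omega)]
    split_ifs
    · rfl
    · exact e _ (by omega)
  obtain ⟨t1, t2, t3, t4, t5, t6, t7, t8, t9⟩ := ht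
  rw [e 1 (by omega)] at t4
  rw [e 2 (by omega)] at t5
  rw [e 3 (by omega)] at t6
  rw [e 4 (by omega)] at t7 t9
  exact ⟨α, a, γ, t1, t2, t3, t4, t5, t6, t7, fun k hk => es k hk ▸ t8 k hk,
    fun h1 h2 h3 h4 h5 k hk => es (k + 1) (by omega) ▸ t9 h1 h2 h3 h4 h5 k hk⟩

theorem normalForm_eq {μ : ℕ} (hμ : 5 < μ) {l : Label} (hl : l.Valid μ) (c : ℕ → ℝ) :
    normalForm d hd μ l c = restr _ (comb hd μ (l.normalCoeff μ c)) := by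
  rw [comb_normalCoeff hμ hl, normalForm]

theorem exists_diffeomorphic_normalForm {μ : ℕ} (hμ : 5 < μ) {l : Label} (hl : l.Valid μ)
    {η : SmoothForm d 2} (hη : η ∈ closedForms d) (h : l.InClass μ (coords hd μ η)) :
    ∃ c, l.Admissible μ c ∧ Diffeomorphic (restr _ η) (normalForm d hd μ l c) := by
  obtain ⟨p, hp, hp'⟩ := h.exists_reaches (hd := hd) hμ hl
  exact ⟨p, hp, by rw [normalForm_eq hμ hl, restr_eq_comb hd hμ hη]; exact hp'⟩

/-- For the forward direction the coordinates of η satisfy the conditions of some family l'. By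
invariance so does the normal form it reaches, and uniqueness gives l' = l; inverses of symmetries
are not needed. -/
theorem mem_singularityClass_iff {μ : ℕ} (hμ : 5 < μ) {l : Label} (hl : l.Valid μ)
    {η : SmoothForm d 2} (hη : η ∈ closedForms d) {a : closedRestr (curve d hd μ)}
    (ha : a.1 = restr _ η) :
    a ∈ singularityClass d hd μ l ↔ l.InClass μ (coords hd μ η) := by
  rw [singularityClass, Set.mem_ofPred_eq, ha]
  refine ⟨fun ⟨c, hc, h⟩ => ?_, exists_diffeomorphic_normalForm hμ hl hη⟩
  rw [normalForm_eq hμ hl, restr_eq_comb hd hμ hη] at h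
  obtain ⟨α, a, γ, ht⟩ := Reaches.transforms hμ h
  obtain ⟨l', hl', h'⟩ := Label.exists_inClass hμ (coords hd μ η)
  obtain rfl := (h'.of_transforms hμ hl' ht).unique hμ hl' hl (Label.inClass_normalCoeff hμ hl hc)
  exact h'

theorem exists_rep {μ : ℕ} (a : closedRestr (curve d hd μ)) :
    ∃ η ∈ closedForms d, a.1 = restr _ η := by
  obtain ⟨η, hη, h⟩ := a.2
  exact ⟨η, hη, h.symm⟩

theorem disjoint_singularityClass {μ : ℕ} (hμ : 5 < μ) {l l' : Label} (hl : l.Valid μ)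
    (hl' : l'.Valid μ) (h : l ≠ l') :
    Disjoint (singularityClass d hd μ l) (singularityClass d hd μ l') := by
  refine Set.disjoint_left.2 fun a ha ha' => h ?_
  obtain ⟨η, hη, e⟩ := exists_rep a
  rw [mem_singularityClass_iff hμ hl hη e] at ha
  rw [mem_singularityClass_iff hμ hl' hη e] at ha'
  exact ha.unique hμ hl hl' ha'

variable (hd) in
/-- The coordinates on the space of algebraic restrictions of closed forms. -/
def coordMap {μ : ℕ} (hμ : 5 < μ) : closedRestr (curve d hd μ) →ₗ[ℝ] (Fin μ → ℝ) :=
  ((zeroRestr (curve d hd μ)).liftQ (LinearMap.pi fun j : Fin μ => coordsₗ hd μ (j + 1))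
    (fun η hη => by
      have h : restr (curve d hd μ) η = restr _ 0 := by
        rw [map_zero]
        exact (Submodule.Quotient.mk_eq_zero _).2 hη
      refine LinearMap.mem_ker.2 (funext fun j => ?_)
      exact (coords_eq_of_restr_eq hμ h (i := j + 1) (by omega)).trans
        (map_zero (coordsₗ hd μ (j + 1))))).domRestrict _

theorem coordMap_apply {μ : ℕ} (hμ : 5 < μ) {a : closedRestr (curve d hd μ)} {η : SmoothForm d 2}
    (h : a.1 = restr _ η) (j : Fin μ) : coordMap hd hμ a j = coords hd μ η (j + 1) := by
  rw [coordMap, LinearMap.domRestrict_apply, h]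
  rfl

/-- Injectivity says that θ₁, …, θ_μ span, surjectivity that they are independent. -/
theorem coordMap_bijective {μ : ℕ} (hμ : 5 < μ) : Function.Bijective (coordMap hd hμ) := by
  constructor
  · rw [injective_iff_map_eq_zero]
    intro a ha
    obtain ⟨η, hη, e⟩ := exists_rep a
    refine Subtype.ext ?_
    rw [e, restr_eq_comb hd hμ hη, comb_congr (c' := 0) fun i hi => ?_]
    · simp [comb]
    · rw [Finset.mem_Icc] at hi
      have h1 := coordMap_apply hμ e ⟨i - 1, by omega⟩
      rw [ha] at h1
      simp only [Nat.sub_add_cancel hi.1] at h1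
      exact h1.symm
  · intro x
    -- Vectors are indexed from 0 and forms from 1; the values of c outside 1, …, μ play no role.
    let c : ℕ → ℝ := fun i => if h : i - 1 < μ then x ⟨i - 1, h⟩ else 0
    refine ⟨⟨restr _ (comb hd μ c), _, comb_mem_closedForms hd c, rfl⟩, funext fun j => ?_⟩
    rw [coordMap_apply hμ rfl, coords_comb hd c (Finset.mem_Icc.2 (by omega))]
    simp [c]

theorem hasCodim_singularityClass {μ : ℕ} (hμ : 5 < μ) {l : Label} (hl : l.Valid μ) :
    HasCodim (singularityClass d hd μ l) (l.cod μ) := by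
  refine ⟨?_, μ, LinearEquiv.ofBijective _ (coordMap_bijective hμ), ?_⟩
  · obtain ⟨c, hc⟩ := l.exists_admissible μ
    refine ⟨⟨restr _ (comb hd μ (l.normalCoeff μ c)), _, comb_mem_closedForms hd _, rfl⟩, c, hc, ?_⟩
    rw [normalForm_eq hμ hl]
    exact Reaches.refl _ _
  · have hZ : (Finset.univ.filter fun j : Fin μ => (j : ℕ) + 1 ∈ l.zeros μ).card = l.cod μ := by
      rw [← Label.card_zeros hμ hl]
      refine Finset.card_bij (fun j _ => (j : ℕ) + 1) (by simp) ?_ fun i hi => ?_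
      · intro i _ j _ h
        exact Fin.ext (Nat.succ_injective h)
      · have := Finset.mem_Icc.1 (Label.zeros_subset hμ hl hi)
        have e : i - 1 + 1 = i := by omega
        exact ⟨⟨i - 1, by omega⟩, by simpa [e] using hi, e⟩
    rw [← hZ]
    have hU : IsOpen {x : Fin μ → ℝ | ∀ j : Fin μ, (j : ℕ) + 1 ∈ l.nonzeros μ → x j ≠ 0} := by
      simp only [Set.ofPred_forall]
      refine isOpen_iInter_of_finite fun j => isOpen_iInter_of_finite fun _ => ?_
      exact isOpen_ne_fun (continuous_apply j) continuous_const
    convert isSubmanifoldOfCodim_inter _ hU using 1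
    rw [LinearEquiv.image_eq_preimage_symm]
    ext x
    obtain ⟨a, rfl⟩ := (coordMap_bijective (hd := hd) hμ).2 x
    obtain ⟨η, hη, e⟩ := exists_rep a
    have h1 (i : ℕ) (hi : i ∈ Finset.Icc 1 μ) :
        ∃ j : Fin μ, (j : ℕ) + 1 = i ∧ coordMap hd hμ a j = coords hd μ η i := by
      rw [Finset.mem_Icc] at hi
      have e' : i - 1 + 1 = i := by omega
      refine ⟨⟨i - 1, by omega⟩, e', ?_⟩
      rw [coordMap_apply hμ e]
      simp only [e']
    have h2 : (LinearEquiv.ofBijective _ (coordMap_bijective hμ)).symm (coordMap hd hμ a) = a :=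
      (LinearEquiv.ofBijective _ (coordMap_bijective (hd := hd) hμ)).symm_apply_apply a
    rw [Set.mem_preimage, h2, mem_singularityClass_iff hμ hl hη e, Label.inClass_iff hμ hl]
    simp only [Set.mem_inter_iff, Set.mem_ofPred_eq, Finset.mem_filter, Finset.mem_univ, true_and,
      coordMap_apply hμ e]
    refine and_congr ⟨fun h j hj => h _ hj, fun h i hi => ?_⟩
      ⟨fun h j hj => h _ hj, fun h i hi => ?_⟩
    · obtain ⟨j, rfl, -⟩ := h1 i (Label.zeros_subset hμ hl hi)
      exact h j hi
    · obtain ⟨j, rfl, -⟩ := h1 i (Label.nonzeros_subset hμ hl hi)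
      exact h j hi

/-- Finiteness holds because each parameter of an equivalent normal form lies in {c_i, -c_i}. -/
theorem parametersAreModuli {μ : ℕ} (hμ : 5 < μ) {l : Label} (hl : l.Valid μ) :
    ParametersAreModuli d hd μ l := by
  intro c hc
  refine ⟨?_, fun v hv h => ?_⟩
  · refine (Set.Finite.pi' fun i : l.params μ => Set.toFinite {c i, -c i}).subset ?_
    rintro t ⟨c', hc', ht, h⟩ i
    rw [normalForm_eq hμ hl, normalForm_eq hμ hl] at h
    obtain ⟨α, a, γ, h⟩ := Reaches.transforms hμ h
    rw [ht]
    rcases Label.eq_or_eq_neg_of_transforms hμ hl hc hc' h i i.2 with e | e <;> simp [e]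
  · rw [normalForm_eq hμ hl, ← comb_indicator (Label.params_subset hμ hl)] at h
    obtain ⟨l₁, l₃, c', h1, h2⟩ := varies_of_mem_orbitTangent hμ h
    refine Label.eq_zero_of_varies hμ hl hc hv h1 fun i hi => ?_
    rw [← h2 i (Finset.mem_Icc.1 hi).2, coords_comb hd _ hi]

end

end SMu
end

theorem theorem4p4 (n μ : ℕ) (hn : 2 ≤ n) (hμ : 5 < μ) :
    -- (i) every algebraic restriction of a closed form can be brought to a normal form
    (∀ a ∈ SMu.closedRestr (SMu.curve (2 * n) (SMu.three_le hn) μ),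
      ∃ (l : SMu.Label) (c : ℕ → ℝ), l.Valid μ ∧ l.Admissible μ c ∧
        SMu.Diffeomorphic a (SMu.normalForm (2 * n) (SMu.three_le hn) μ l c)) ∧
    -- (ii) the singularity classes are disjoint
    (∀ l l' : SMu.Label, l.Valid μ → l'.Valid μ → l ≠ l' →
      Disjoint (SMu.singularityClass (2 * n) (SMu.three_le hn) μ l)
        (SMu.singularityClass (2 * n) (SMu.three_le hn) μ l')) ∧
    -- (iii) the parameters of the normal forms are moduli
    (∀ l : SMu.Label, l.Valid μ → SMu.ParametersAreModuli (2 * n) (SMu.three_le hn) μ l) ∧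
    -- (iv) the codimension of the singularity classes
    (∀ l : SMu.Label, l.Valid μ →
      SMu.HasCodim (SMu.singularityClass (2 * n) (SMu.three_le hn) μ l) (l.cod μ)) := by
  refine ⟨?_, fun l l' hl hl' h => SMu.disjoint_singularityClass hμ hl hl' h,
    fun l hl => SMu.parametersAreModuli hμ hl, fun l hl => SMu.hasCodim_singularityClass hμ hl⟩
  rintro _ ⟨η, hη, rfl⟩
  obtain ⟨l, hl, h⟩ := SMu.Label.exists_inClass hμ (SMu.coords (SMu.three_le hn) μ η)
  obtain ⟨c, hc, h⟩ := SMu.exists_diffeomorphic_normalForm hμ hl hη h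
  exact ⟨l, c, hl, hc, h⟩
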